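/- Let $\Gamma$ be the compact metric graph with three vertices $A,B,C$, four edges $e_1,\dots,e_4$ of lengths $\ell_1,\dots,\ell_4>0$ joining $A$ and $B$, and one edge (tail) $e_0$ of length $\ell_0>0$ joining $A$ and $C$. Let $X$ be its maximal abelian ($\mathbb Z^3$-periodic) cover, with the lifted edge lengths, and let $-\Delta_X$ be the Laplacian $-d^2/dx^2$ on $L^2(X)$ with Neumann–Kirchhoff conditions at all vertices. For $\mathbf k\in\mathbb T^3=(\mathbb R/2\pi\mathbb Z)^3$ let $\lambda_1(\mathbf k)$ be the smallest eigenvalue of the Floquet operator at quasimomentum $\mathbf k$, i.e. the smallest $\lambda$ such that $-u''=\lambda u$ has a nonzero solution on $X$ satisfying the Neumann–Kirchhoff conditions and multiplied by $e^{ik_j}$ under the $j$-th generator of $\mathbb Z^3$. Let $\Gamma^B$ be the graph $\Gamma$ with the Laplacian $-d^2/dx^2$, a Dirichlet condition at $B$, and Neumann–Kirchhoff conditions at $A$ and $C$. For a function $\varphi$ on $\Gamma$, write $\varphi_j$ for its restriction to $e_j$ and $\varphi_j'(B)$ for its derivative at $B$ along $e_j$. The equation $\rho^2-\rho^3/3=\pi^2/24$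 has a unique solution $\rho_0$ in $(2,3)$. Assume $$\min\Bigl\{\rho_0\cdot\min_{1\le j\le 4}\ell_j,\ \ell_0\Bigr\}\ \ge\ \max_{1\le j\le 4}\ell_j .$$ Then: 1. $\Gamma^B$ has a ground state (an eigenfunction for its smallest eigenvalue), and every ground state $\varphi$ satisfies $$2\,|\varphi_j'(B)|<|\varphi_1'(B)|+|\varphi_2'(B)|+|\varphi_3'(B)|+|\varphi_4'(B)|\qquad (1\le j\le 4).$$ 2. Consequently, $-\Delta_X$ has a degenerate band edge: $\lambda_1(\mathbf k)$ exists for every $\mathbf k\in\mathbb T^3$; the set $\mu\subset\mathbb T^3$ of all points at which $\lambda_1$ attains its maximum $M$ is a nonempty real algebraic subset of $\mathbb T^3$ (the common zero set of real polynomials in $\cos k_j,\sin k_j$) that has dimension one at each of its points; and $M$ is the lower endpoint of a spectral gap, i.e. $M\in\sigma(-\Delta_X)$ and $(M,M+\delta)\cap\sigma(-\Delta_X)=\emptyset$ for some $\delta>0$. -/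

import Mathlib

open MeasureTheory Set

/-- `f` belongs to the Sobolev space `H²(0, L)`, with (continuous) first derivative `f₁` and weak
second derivative `f₂ ∈ L²(0, L)`; `f` and `f₁` are the continuous representatives on `[0, L]`. -/
structure IsH2 (L : ℝ) (f f₁ f₂ : ℝ → ℂ) : Prop where
  memLp : MemLp f₂ 2 (volume.restrict (Ioo 0 L))
  deriv_eq : ∀ x ∈ Icc 0 L, f₁ x = f₁ 0 + ∫ t in (0 : ℝ)..x, f₂ t
  eq : ∀ x ∈ Icc 0 L, f x = f 0 + ∫ t in (0 : ℝ)..x, f₁ t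

/-- A (possibly infinite, locally finite) metric graph: the edge `e` is identified with the
interval `[0, len e]`, with `0` at the vertex `src e` and `len e` at the vertex `tgt e`.
A function on the graph is a family `u : E → ℝ → ℂ`, where only the values `u e x` with
`x ∈ [0, len e]` matter. -/
structure MetricGraph (V E : Type) where
  src : E → V
  tgt : E → V
  len : E → ℝ
  len_pos : ∀ e, 0 < len e
  finite_src : ∀ v, {e | src e = v}.Finite
  finite_tgt : ∀ v, {e | tgt e = v}.Finite

namespace MetricGraph

variable {V E : Type}

/-- `u` takes the value `c` at the end at `v` of every edge incident to `v`. -/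
def HasValueAt (G : MetricGraph V E) (u : E → ℝ → ℂ) (v : V) (c : ℂ) : Prop :=
  ∀ e, (G.src e = v → u e 0 = c) ∧ (G.tgt e = v → u e (G.len e) = c)

/-- The sum of the derivatives of `u` at `v`, each taken in the direction into the edge;
`u₁` is the derivative of `u` along the edges. -/
noncomputable def outflow (G : MetricGraph V E) (u₁ : E → ℝ → ℂ) (v : V) : ℂ :=
  ∑ e ∈ (G.finite_src v).toFinset, u₁ e 0 - ∑ e ∈ (G.finite_tgt v).toFinset, u₁ e (G.len e)

/-- `u` is locally `H²`, with derivatives `u₁`, `u₂`, satisfies the Dirichlet condition at the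
vertices in `D` and the Neumann-Kirchhoff condition at all other vertices. -/
structure IsAdmissible (G : MetricGraph V E) (D : Set V) (u u₁ u₂ : E → ℝ → ℂ) : Prop where
  isH2 : ∀ e, IsH2 (G.len e) (u e) (u₁ e) (u₂ e)
  dirichlet : ∀ v ∈ D, G.HasValueAt u v 0
  continuous : ∀ v ∉ D, ∃ c, G.HasValueAt u v c
  kirchhoff : ∀ v ∉ D, G.outflow u₁ v = 0

/-- `u`, with derivative `u₁` along the edges, is a nonzero solution of `-u'' = Λ u` that satisfies
the vertex conditions (Dirichlet on `D`, Neumann-Kirchhoff elsewhere). -/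
def IsEigenfunction (G : MetricGraph V E) (D : Set V) (Λ : ℝ) (u u₁ : E → ℝ → ℂ) : Prop :=
  (∃ u₂ : E → ℝ → ℂ, G.IsAdmissible D u u₁ u₂ ∧
    ∀ e, ∀ᵐ x ∂(volume.restrict (Ioo 0 (G.len e))), -u₂ e x = Λ * u e x) ∧
  ∃ e, ∃ x ∈ Icc 0 (G.len e), u e x ≠ 0

/-- The eigenvalues of `-d²/dx²` on a compact graph. -/
def eigenvalues (G : MetricGraph V E) (D : Set V) : Set ℝ :=
  {Λ | ∃ u u₁, G.IsEigenfunction D Λ u u₁}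

/-- `u` is a ground state: an eigenfunction for the least eigenvalue. -/
def IsGroundState (G : MetricGraph V E) (D : Set V) (u u₁ : E → ℝ → ℂ) : Prop :=
  ∃ Λ, IsLeast (G.eigenvalues D) Λ ∧ G.IsEigenfunction D Λ u u₁

/-- `f ∈ L²(G)`. -/
def MemL2 (G : MetricGraph V E) (f : E → ℝ → ℂ) : Prop :=
  (∀ e, MemLp (f e) 2 (volume.restrict (Ioo 0 (G.len e)))) ∧
    Summable fun e => ∫ x in Ioo 0 (G.len e), ‖f e x‖ ^ 2

/-- The squared norm in `L²(G)`. -/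
noncomputable def normSq (G : MetricGraph V E) (f : E → ℝ → ℂ) : ℝ :=
  ∑' e, ∫ x in Ioo 0 (G.len e), ‖f e x‖ ^ 2

/-- The domain of the Laplacian `-Δ` on `L²(G)` with Neumann-Kirchhoff conditions at all vertices:
the functions in `H²(G)` that satisfy these conditions. -/
structure InDomain (G : MetricGraph V E) (u u₁ u₂ : E → ℝ → ℂ) : Prop where
  admissible : G.IsAdmissible ∅ u u₁ u₂
  memL2 : G.MemL2 u
  memL2_deriv : G.MemL2 u₁
  memL2_deriv2 : G.MemL2 u₂

/-- `-Δ - Λ` is a bijection from the domain of `-Δ` onto `L²(G)` with bounded inverse. -/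
def InResolventSet (G : MetricGraph V E) (Λ : ℝ) : Prop :=
  (∃ C : ℝ, ∀ u u₁ u₂ : E → ℝ → ℂ, G.InDomain u u₁ u₂ →
    G.normSq u ≤ C * G.normSq fun e x => -u₂ e x - Λ * u e x) ∧
  ∀ f : E → ℝ → ℂ, G.MemL2 f → ∃ u u₁ u₂ : E → ℝ → ℂ, G.InDomain u u₁ u₂ ∧
    ∀ e, ∀ᵐ x ∂(volume.restrict (Ioo 0 (G.len e))), -u₂ e x - Λ * u e x = f e x

/-- The spectrum of the (self-adjoint, hence with real spectrum) operator `-Δ` on `L²(G)` with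
Neumann-Kirchhoff conditions at all vertices. -/
def laplaceSpectrum (G : MetricGraph V E) : Set ℝ := {Λ | ¬ G.InResolventSet Λ}

/-- The `ℤ³`-periodic cover of `G` with voltages `g`: the lift of the edge `e` that starts
in the cell `n` ends in the cell `n + g e`. The group `ℤ³` acts by translation of the cells. -/
def cover (G : MetricGraph V E) (g : E → Fin 3 → ℤ) :
    MetricGraph (V × (Fin 3 → ℤ)) (E × (Fin 3 → ℤ)) where
  src e := (G.src e.1, e.2)
  tgt e := (G.tgt e.1, e.2 + g e.1)
  len e := G.len e.1
  len_pos e := G.len_pos e.1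
  finite_src v := by
    refine ((G.finite_src v.1).image fun e => (e, v.2)).subset ?_
    rintro ⟨e, n⟩ rfl
    exact ⟨e, rfl, rfl⟩
  finite_tgt v := by
    refine ((G.finite_tgt v.1).image fun e => (e, v.2 - g e)).subset ?_
    rintro ⟨e, n⟩ rfl
    exact ⟨e, rfl, by simp⟩

/-- The Floquet condition with quasimomentum `k` for a function on a `ℤ³`-periodic cover of `G`:
translation by the `j`-th generator multiplies `u` by `exp (i kⱼ)`. -/
def IsFloquet (G : MetricGraph V E) (k : Fin 3 → Real.Angle)
    (u : E × (Fin 3 → ℤ) → ℝ → ℂ) : Prop :=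
  ∀ (j : Fin 3) (e : E) (n : Fin 3 → ℤ), ∀ x ∈ Icc 0 (G.len e),
    u (e, n + Pi.single j 1) x = ((k j).toCircle : ℂ) * u (e, n) x

/-- The (discrete) spectrum of the Floquet operator at quasimomentum `k`: the `Λ` for which
`-u'' = Λ u` has a nonzero, locally `H²` solution on the cover which satisfies the
Neumann-Kirchhoff conditions and the Floquet condition. -/
def floquetSpectrum (G : MetricGraph V E) (g : E → Fin 3 → ℤ) (k : Fin 3 → Real.Angle) : Set ℝ :=
  {Λ | ∃ u u₁, (G.cover g).IsEigenfunction ∅ Λ u u₁ ∧ G.IsFloquet k u}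

/-- The first band function `λ₁(k)`. -/
noncomputable def firstBand (G : MetricGraph V E) (g : E → Fin 3 → ℤ)
    (k : Fin 3 → Real.Angle) : ℝ :=
  sInf (G.floquetSpectrum g k)

end MetricGraph

/-- The three vertices of the compact graph `Γ`. -/
inductive Vtx
  | A
  | B
  | C

/-- The compact graph `Γ`: four edges `some j`, of lengths `ℓ j`, join `B` (at `x = 0`) to `A`,
and the tail `none`, of length `ℓ₀`, joins the vertex `C` of degree one to `A`. -/
def compactGraph (ℓ₀ : ℝ) (ℓ : Fin 4 → ℝ) (h₀ : 0 < ℓ₀) (h : ∀ j, 0 < ℓ j) :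
    MetricGraph Vtx (Option (Fin 4)) where
  src e := e.elim Vtx.C fun _ => Vtx.B
  tgt _ := Vtx.A
  len e := e.elim ℓ₀ ℓ
  len_pos e := by cases e with
    | none => exact h₀
    | some j => exact h j
  finite_src _ := Set.toFinite _
  finite_tgt _ := Set.toFinite _

/-- The voltages whose cover is the maximal abelian cover `X` of `Γ`: the first three edges from
`B` to `A` carry the three generators of `ℤ³`, the fourth one and the tail carry `0`. -/
def voltage : Option (Fin 4) → Fin 3 → ℤ
  | none => 0
  | some j => fun i => if j = i.castSucc then 1 else 0

/-- `μ` is a real algebraic subset of the torus `(ℝ/2πℤ)³`: the common zero set of a family of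
real polynomials in the `cos kⱼ` and `sin kⱼ`. -/
def IsTorusAlgebraic (μ : Set (Fin 3 → Real.Angle)) : Prop :=
  ∃ P : Set (MvPolynomial (Fin 3 ⊕ Fin 3) ℝ), μ = {k | ∀ p ∈ P,
    MvPolynomial.eval (Sum.elim (fun j => (k j).cos) fun j => (k j).sin) p = 0}

/-- `μ` is a nonempty real algebraic subset of the torus, of (Hausdorff) dimension one at each of
its points. -/
def IsAlgebraicCurve (μ : Set (Fin 3 → Real.Angle)) : Prop :=
  IsTorusAlgebraic μ ∧ μ.Nonempty ∧ ∀ k ∈ μ, ∀ U ∈ nhds k, dimH (μ ∩ U) = 1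

/-!
On an edge, a solution of `-u'' = Λ u` is determined by its values at the two ends, and its
derivatives there are given by the Dirichlet-to-Neumann matrix of the edge, with entries `s cot (s
L)` and `-s / sin (s L)` for `Λ = s²`; a tail with a free end contributes `s tan (s L)`. So the
spectral problems for `Γ` with a Dirichlet condition at `B` and for the cover become equations for
the values `a`, `b` at the lifts of `A`, `B`. With `T = ∑ⱼ s cot (s ℓⱼ)` and `R = s tan (s ℓ₀)`,
they are `T = R` for the Dirichlet graph, and on the cover `T b = F a`, `(T - R) a = F* b`, where
`F` is a weighted sum of four translations of `ℤ³` with the weights `qⱼ = s / sin (s ℓⱼ)`. At the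
quasimomentum `k`, the operator `F` is multiplication by the number `F(k) = q₀ e^{ik₀} + q₁ e^{ik₁}
+ q₂ e^{ik₂} + q₃`, and the secular equation of the Floquet operator is `T (T - R) = |F(k)|²`.

Since the tail is the longest edge, the equation `T = R` has a solution `s₀` with `s₀ ℓ₀ < π / 2`,
and all functions involved are monotone up to there: `T` decreases and `R` increases. Hence `s₀²` is
the ground state energy of the Dirichlet graph, with slopes at `B` proportional to the `qⱼ`, which
satisfy the quadrangle inequalities because the lengths differ by less than a factor of three
(`two_mul_edgeCsc_lt`). At `s = s₀` the left-hand side of the secular equation vanishes, so that the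
first band does not exceed `s₀²` (intermediate value theorem). It attains this value exactly where
`F(k) = 0`: since `csc + cot` is decreasing, between `s < s₀` and `s₀` the number `F(k)` changes by
at most the amount by which `T` falls, so if `F(k)` vanishes at `s₀`, there is no solution below
`s₀` (`norm_fluxSum_sq_lt`, `exists_isLeast_floquetSpectrum`).

The set `F(k) = 0` at `s = s₀` is the configuration space of the planar quadrangles with sides `qⱼ`.
It has dimension at most one because, away from the countably many degenerate points, two of the
sides are not parallel, and then one angle is a local coordinate with a Lipschitz inverse
(`dimH_quadrangles_le`). It has dimension at least one at each point because every quadrangle can be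
flexed explicitly, by changing the diagonal that cuts it into two triangles (or, if this diagonal
has length zero, by rotating two antiparallel sides), along a path on which the cosine of one angle
fills an interval (`one_le_dimH_quadrangles`).

The gap above `s₀²`: for `s₀ < s < π / (2 ℓ₀)` one has `T < R`, so that elimination of `b` leaves
the operator `(R - T) + F* F / T` on `ℓ²(ℤ³)`, which is bounded below by `R - T`. Hence the
difference equations are uniquely solvable in `ℓ²`, and `s²` is in the resolvent set
(`inResolventSet`). The value `s₀²` itself is in the spectrum: if `F(k) = 0`, the generalized
eigenfunction with quasimomentum `k`, cut off exponentially with a slow rate, is almost a solution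
(`not_inResolventSet`).
-/

/-! ### Monotonicity of trigonometric quotients -/

lemma Real.sinc_pos {x : ℝ} (h₀ : 0 ≤ x) (h₁ : x < Real.pi) : 0 < Real.sinc x := by
  rcases h₀.eq_or_lt with rfl | h₀
  · simp
  · rw [Real.sinc_of_ne_zero h₀.ne']
    exact div_pos (Real.sin_pos_of_pos_of_lt_pi h₀ h₁) h₀

lemma Real.sinc_le_sinc {x y : ℝ} (h₀ : 0 ≤ x) (hxy : x ≤ y) (h₁ : y ≤ Real.pi) :
    Real.sinc y ≤ Real.sinc x := by
  rcases h₀.eq_or_lt with rfl | h₀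
  · simpa using Real.sinc_le_one y
  have hy : 0 < y := h₀.trans_le hxy
  rw [Real.sinc_of_ne_zero h₀.ne', Real.sinc_of_ne_zero hy.ne', div_le_div_iff₀ hy h₀]
  -- `sin` is concave on `[0, π]` and vanishes at `0`
  have hmem : (0 : ℝ) ∈ Icc 0 Real.pi ∧ y ∈ Icc 0 Real.pi :=
    ⟨⟨le_rfl, Real.pi_pos.le⟩, hy.le, h₁⟩
  have ht : 0 ≤ 1 - x / y := by rw [sub_nonneg, div_le_one hy]; exact hxy
  have ht' : 0 ≤ x / y := by positivity
  have := strictConcaveOn_sin_Icc.concaveOn.2 hmem.1 hmem.2 ht ht' (by ring)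
  simp only [smul_eq_mul, mul_zero, Real.sin_zero, zero_add] at this
  rw [div_mul_cancel₀ _ hy.ne', div_mul_eq_mul_div, div_le_iff₀ hy] at this
  linarith

/-- `x cot x` is nonincreasing on `[0, π/2]`, in a form without denominators. -/
lemma Real.cos_mul_sinc_le {x y : ℝ} (h₀ : 0 ≤ x) (hxy : x ≤ y) (h₁ : y ≤ Real.pi / 2) :
    Real.cos y * Real.sinc x ≤ Real.cos x * Real.sinc y := by
  rcases hxy.eq_or_lt with rfl | hxy
  · exact le_rfl
  have hy : 0 < y := h₀.trans_lt hxy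
  -- the product formulas reduce the claim to the monotonicity of `sinc` at `y - x ≤ y + x`
  have key : Real.sinc (y + x) ≤ Real.sinc (y - x) :=
    Real.sinc_le_sinc (by linarith) (by linarith) (by linarith)
  rcases h₀.eq_or_lt with rfl | h₀
  · rcases h₁.eq_or_lt with rfl | h₁
    · simpa using (Real.sinc_pos (by positivity) (by linarith [Real.pi_pos])).le
    rw [Real.sinc_of_ne_zero hy.ne', Real.cos_zero, one_mul, Real.sinc_zero, mul_one, le_div_iff₀ hy]
    have := Real.le_tan hy.le h₁
    have hc : 0 < Real.cos y := Real.cos_pos_of_mem_Ioo ⟨by linarith, h₁⟩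
    rw [Real.tan_eq_sin_div_cos, le_div_iff₀ hc] at this
    linarith
  rw [Real.sinc_of_ne_zero (by linarith), Real.sinc_of_ne_zero (by linarith),
    div_le_div_iff₀ (by linarith) (by linarith), Real.sin_add, Real.sin_sub] at key
  rw [Real.sinc_of_ne_zero h₀.ne', Real.sinc_of_ne_zero hy.ne', ← mul_div_assoc, ← mul_div_assoc,
    div_le_div_iff₀ h₀ hy]
  nlinarith

/-! ### Fundamental solutions of `-u'' = Λ u` -/

/-- The solution of `-u'' = Λ u` with `u 0 = 1`, `u' 0 = 0`. -/
noncomputable def cosL (Λ x : ℝ) : ℝ :=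
  if 0 < Λ then Real.cos (√Λ * x) else Real.cosh (√(-Λ) * x)

/-- The solution of `-u'' = Λ u` with `u 0 = 0`, `u' 0 = 1`. -/
noncomputable def sinL (Λ x : ℝ) : ℝ :=
  if 0 < Λ then Real.sin (√Λ * x) / √Λ else if Λ = 0 then x else Real.sinh (√(-Λ) * x) / √(-Λ)

@[simp] lemma cosL_zero (Λ : ℝ) : cosL Λ 0 = 1 := by simp [cosL]

@[simp] lemma sinL_zero (Λ : ℝ) : sinL Λ 0 = 0 := by simp [sinL]

lemma cosL_sq {s : ℝ} (hs : 0 ≤ s) (x : ℝ) : cosL (s ^ 2) x = Real.cos (s * x) := by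
  rcases hs.eq_or_lt with rfl | hs
  · simp [cosL]
  · rw [cosL, if_pos (by positivity), Real.sqrt_sq hs.le]

lemma sinL_sq {s : ℝ} (hs : 0 ≤ s) (x : ℝ) : sinL (s ^ 2) x = x * Real.sinc (s * x) := by
  rcases hs.eq_or_lt with rfl | hs
  · simp [sinL]
  · rw [sinL, if_pos (by positivity), Real.sqrt_sq hs.le]
    rcases eq_or_ne x 0 with rfl | hx
    · simp
    · rw [Real.sinc_of_ne_zero (by positivity)]
      field_simp

lemma hasDerivAt_sinL (Λ x : ℝ) : HasDerivAt (sinL Λ) (cosL Λ x) x := by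
  rcases lt_trichotomy Λ 0 with h | rfl | h
  · have h' : √(-Λ) ≠ 0 := (Real.sqrt_pos.2 (by linarith)).ne'
    have : sinL Λ = fun x => Real.sinh (√(-Λ) * x) / √(-Λ) := by
      ext x; rw [sinL, if_neg h.not_gt, if_neg h.ne]
    rw [this, cosL, if_neg h.not_gt]
    convert! (((hasDerivAt_id x).const_mul √(-Λ)).sinh).div_const √(-Λ) using 1
    simp [h']
  · have : sinL 0 = fun x => x := by ext x; simp [sinL]
    rw [this]
    simpa [cosL] using hasDerivAt_id' x
  · have h' : √Λ ≠ 0 := (Real.sqrt_pos.2 h).ne'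
    have : sinL Λ = fun x => Real.sin (√Λ * x) / √Λ := by ext x; rw [sinL, if_pos h]
    rw [this, cosL, if_pos h]
    convert! (((hasDerivAt_id x).const_mul √Λ).sin).div_const √Λ using 1
    simp [h']

lemma hasDerivAt_cosL (Λ x : ℝ) : HasDerivAt (cosL Λ) (-Λ * sinL Λ x) x := by
  rcases le_or_gt Λ 0 with h | h
  · have : cosL Λ = fun x => Real.cosh (√(-Λ) * x) := by ext x; rw [cosL, if_neg h.not_gt]
    rw [this]
    convert! ((hasDerivAt_id x).const_mul √(-Λ)).cosh using 1
    rcases h.eq_or_lt with rfl | h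
    · simp
    · have h' : √(-Λ) ≠ 0 := (Real.sqrt_pos.2 (by linarith)).ne'
      rw [sinL, if_neg h.not_gt, if_neg h.ne]
      field_simp
      simp [Real.sq_sqrt (neg_nonneg.2 h.le), mul_comm]
  · have : cosL Λ = fun x => Real.cos (√Λ * x) := by ext x; rw [cosL, if_pos h]
    rw [this]
    convert! ((hasDerivAt_id x).const_mul √Λ).cos using 1
    have h' : √Λ ≠ 0 := (Real.sqrt_pos.2 h).ne'
    rw [sinL, if_pos h]
    field_simp
    simp [Real.sq_sqrt h.le, mul_comm]

lemma continuous_sinL (Λ : ℝ) : Continuous (sinL Λ) :=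
  continuous_iff_continuousAt.2 fun x => (hasDerivAt_sinL Λ x).continuousAt

lemma continuous_cosL (Λ : ℝ) : Continuous (cosL Λ) :=
  continuous_iff_continuousAt.2 fun x => (hasDerivAt_cosL Λ x).continuousAt

lemma cosL_sq_add (Λ x : ℝ) : cosL Λ x ^ 2 + Λ * sinL Λ x ^ 2 = 1 := by
  have hd : ∀ y, HasDerivAt (fun y => cosL Λ y ^ 2 + Λ * sinL Λ y ^ 2) 0 y := fun y => by
    convert! ((hasDerivAt_cosL Λ y).pow 2).add (((hasDerivAt_sinL Λ y).pow 2).const_mul Λ) using 1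
    push_cast
    ring
  have := is_const_of_deriv_eq_zero (fun y => (hd y).differentiableAt) (fun y => (hd y).deriv) x 0
  simpa using this

lemma sinL_pos_of_nonpos {Λ x : ℝ} (hΛ : Λ ≤ 0) (hx : 0 < x) : 0 < sinL Λ x := by
  rcases hΛ.eq_or_lt with rfl | h
  · simpa [sinL]
  · have h' : 0 < √(-Λ) := Real.sqrt_pos.2 (by linarith)
    rw [sinL, if_neg h.not_gt, if_neg h.ne]
    exact div_pos (Real.sinh_pos_iff.2 (by positivity)) h'

lemma one_lt_cosL {Λ x : ℝ} (h : Λ < 0) (hx : 0 < x) : 1 < cosL Λ x := by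
  have h' : 0 < √(-Λ) := Real.sqrt_pos.2 (by linarith)
  rw [cosL, if_neg h.not_gt]
  exact Real.one_lt_cosh.2 (by positivity)

/-- The entry of the Dirichlet-to-Neumann matrix of an edge of length `L` that couples its ends, `s
/ sin (s L)` for `Λ = s ^ 2`; meaningful only if `Λ` is not a Dirichlet eigenvalue of the edge. -/
noncomputable def edgeCsc (Λ L : ℝ) : ℝ := (sinL Λ L)⁻¹

/-- The diagonal entry of the Dirichlet-to-Neumann matrix of an edge of length `L`, `s cot (s L)`
for `Λ = s ^ 2`; meaningful only if `Λ` is not a Dirichlet eigenvalue of the edge. -/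
noncomputable def edgeCot (Λ L : ℝ) : ℝ := cosL Λ L / sinL Λ L

/-- The Dirichlet-to-Neumann coefficient of an edge of length `L` with a free end, `s tan (s L)` for
`Λ = s ^ 2`; meaningful only if `cosL Λ L ≠ 0`. -/
noncomputable def edgeTan (Λ L : ℝ) : ℝ := Λ * sinL Λ L / cosL Λ L

lemma edgeCsc_mono {r s L : ℝ} (hL : 0 < L) (hr : 0 ≤ r) (hrs : r ≤ s) (hs : s * L < Real.pi) :
    edgeCsc (r ^ 2) L ≤ edgeCsc (s ^ 2) L := by
  have h1 : r * L ≤ s * L := by gcongr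
  have h0 : 0 ≤ r * L := by positivity
  have h2 : 0 < Real.sinc (s * L) := Real.sinc_pos (by linarith) hs
  rw [edgeCsc, edgeCsc, sinL_sq hr, sinL_sq (hr.trans hrs)]
  gcongr
  exact Real.sinc_le_sinc (by positivity) h1 hs.le

/-- The half-angle formula `csc x + cot x = cot (x / 2)`, in a form that covers `s = 0`. -/
lemma edgeCsc_add_edgeCot_sq {s L : ℝ} (hs : 0 ≤ s) (hL : 0 < L) (hsL : s * L < Real.pi) :
    edgeCsc (s ^ 2) L + edgeCot (s ^ 2) L =
      2 * (Real.cos (s * L / 2) / Real.sinc (s * L / 2)) / L := by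
  have hc : 0 < Real.cos (s * L / 2) :=
    Real.cos_pos_of_mem_Ioo ⟨by linarith [mul_nonneg hs hL.le, Real.pi_pos], by linarith⟩
  have hS : 0 < Real.sinc (s * L / 2) := Real.sinc_pos (by positivity) (by
    linarith [mul_nonneg hs hL.le, Real.pi_pos])
  have h2 : Real.sinc (s * L) = Real.sinc (s * L / 2) * Real.cos (s * L / 2) := by
    rcases eq_or_ne (s * L) 0 with h | h
    · simp [h]
    · rw [Real.sinc_of_ne_zero h, Real.sinc_of_ne_zero (by simpa using h)]
      have : Real.sin (s * L) = 2 * Real.sin (s * L / 2) * Real.cos (s * L / 2) := by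
        rw [← Real.sin_two_mul]; ring_nf
      rw [this]
      field_simp
  have h1 : Real.cos (s * L) = 2 * Real.cos (s * L / 2) ^ 2 - 1 := by
    rw [← Real.cos_two_mul]; ring_nf
  rw [edgeCsc, edgeCot, sinL_sq hs, cosL_sq hs, h2, h1]
  generalize Real.cos (s * L / 2) = c at *
  generalize Real.sinc (s * L / 2) = d at *
  field_simp
  ring

lemma edgeCsc_add_edgeCot_anti {r s L : ℝ} (hL : 0 < L) (hr : 0 ≤ r) (hrs : r ≤ s)
    (hs : s * L < Real.pi) :
    edgeCsc (s ^ 2) L + edgeCot (s ^ 2) L ≤ edgeCsc (r ^ 2) L + edgeCot (r ^ 2) L := by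
  have h1 : r * L ≤ s * L := by gcongr
  have h0 : 0 ≤ r * L := by positivity
  rw [edgeCsc_add_edgeCot_sq hr hL (by linarith), edgeCsc_add_edgeCot_sq (hr.trans hrs) hL hs]
  gcongr 2 * ?_ / L
  rw [div_le_div_iff₀ (Real.sinc_pos (by linarith) (by linarith))
    (Real.sinc_pos (by linarith) (by linarith))]
  exact Real.cos_mul_sinc_le (by linarith) (by linarith) (by linarith)

lemma edgeTan_sq {s : ℝ} (hs : 0 ≤ s) (L : ℝ) : edgeTan (s ^ 2) L = s * Real.tan (s * L) := by
  rw [edgeTan, sinL_sq hs, cosL_sq hs, Real.tan_eq_sin_div_cos]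
  rcases eq_or_ne (s * L) 0 with h | h
  · simp [h, pow_two, mul_assoc]
  · rw [Real.sinc_of_ne_zero h]
    have : s ≠ 0 := left_ne_zero_of_mul h
    have : L ≠ 0 := right_ne_zero_of_mul h
    field_simp

lemma edgeTan_lt {r s L : ℝ} (hL : 0 < L) (hr : 0 ≤ r) (hrs : r < s) (hs : s * L < Real.pi / 2) :
    edgeTan (r ^ 2) L < edgeTan (s ^ 2) L := by
  have h1 : r * L < s * L := by gcongr
  have h0 : 0 ≤ r * L := by positivity
  rw [edgeTan_sq hr, edgeTan_sq (hr.trans hrs.le)]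
  have := Real.tan_lt_tan_of_nonneg_of_lt_pi_div_two h0 hs h1
  have h3 := Real.tan_nonneg_of_nonneg_of_le_pi_div_two h0 (by linarith)
  calc r * Real.tan (r * L) ≤ s * Real.tan (r * L) := by gcongr
    _ < s * Real.tan (s * L) := by gcongr; linarith

lemma sinL_sq_pos {s L : ℝ} (hs : 0 ≤ s) (hL : 0 < L) (hsL : s * L < Real.pi) :
    0 < sinL (s ^ 2) L := by
  rw [sinL_sq hs]
  exact mul_pos hL (Real.sinc_pos (by positivity) hsL)

lemma cosL_sq_pos {s L : ℝ} (hs : 0 ≤ s) (hL : 0 < L) (hsL : s * L < Real.pi / 2) :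
    0 < cosL (s ^ 2) L := by
  rw [cosL_sq hs]
  exact Real.cos_pos_of_mem_Ioo ⟨by linarith [mul_nonneg hs hL.le, Real.pi_pos], hsL⟩

lemma continuousOn_edgeCsc {L : ℝ} (hL : 0 < L) {I : Set ℝ}
    (hI : ∀ s ∈ I, 0 ≤ s ∧ s * L < Real.pi) : ContinuousOn (fun s => edgeCsc (s ^ 2) L) I := by
  have : ContinuousOn (fun s => (L * Real.sinc (s * L))⁻¹) I := by
    refine ContinuousOn.inv₀ (Continuous.continuousOn ?_) fun s hs => ?_
    · exact continuous_const.mul (Real.continuous_sinc.comp (continuous_id.mul continuous_const))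
    · have := Real.sinc_pos (mul_nonneg (hI s hs).1 hL.le) (hI s hs).2
      positivity
  refine this.congr fun s hs => ?_
  simp only [edgeCsc, sinL_sq (hI s hs).1]

lemma continuousOn_edgeCot {L : ℝ} (hL : 0 < L) {I : Set ℝ}
    (hI : ∀ s ∈ I, 0 ≤ s ∧ s * L < Real.pi) : ContinuousOn (fun s => edgeCot (s ^ 2) L) I := by
  have : ContinuousOn (fun s => Real.cos (s * L) * edgeCsc (s ^ 2) L) I :=
    (by fun_prop : Continuous fun s => Real.cos (s * L)).continuousOn.mul
      (continuousOn_edgeCsc hL hI)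
  refine this.congr fun s hs => ?_
  simp only [edgeCot, edgeCsc, cosL_sq (hI s hs).1, div_eq_mul_inv]

lemma continuousOn_edgeTan {L : ℝ} (hL : 0 < L) {I : Set ℝ}
    (hI : ∀ s ∈ I, 0 ≤ s ∧ s * L < Real.pi / 2) :
    ContinuousOn (fun s => edgeTan (s ^ 2) L) I := by
  have : ContinuousOn (fun s => s * (Real.sin (s * L) / Real.cos (s * L))) I := by
    refine continuousOn_id.mul (ContinuousOn.div (by fun_prop) (by fun_prop) fun s hs => ?_)
    have := cosL_sq_pos (hI s hs).1 hL (hI s hs).2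
    rw [cosL_sq (hI s hs).1] at this
    exact this.ne'
  refine this.congr fun s hs => ?_
  simp only [edgeTan_sq (hI s hs).1, Real.tan_eq_sin_div_cos]

/-! ### The space `H²` of an interval -/

lemma MemLp.intervalIntegrable_Ioo {L : ℝ} {g : ℝ → ℂ}
    (hg : MemLp g 2 (volume.restrict (Ioo 0 L))) {x y : ℝ} (hx : x ∈ Icc 0 L) (hy : y ∈ Icc 0 L) :
    IntervalIntegrable g volume x y := by
  have h : IntegrableOn g (Ioo 0 L) := hg.integrable (by norm_num)
  rw [← integrableOn_Icc_iff_integrableOn_Ioo] at h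
  rw [intervalIntegrable_iff]
  exact h.mono_set (uIoc_subset_uIcc.trans (uIcc_subset_Icc hx hy))

lemma memLp_of_continuousOn {L : ℝ} {g : ℝ → ℂ} (hg : ContinuousOn g (Icc 0 L)) :
    MemLp g 2 (volume.restrict (Ioo 0 L)) := by
  obtain ⟨K, hK⟩ := isCompact_Icc.exists_bound_of_continuousOn hg
  have : IsFiniteMeasure (volume.restrict (Ioo 0 L)) := ⟨by simp⟩
  refine MemLp.of_bound ((hg.mono Ioo_subset_Icc_self).aestronglyMeasurable measurableSet_Ioo) K ?_
  filter_upwards [ae_restrict_mem measurableSet_Ioo] with x hx using hK x (Ioo_subset_Icc_self hx)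

lemma continuousOn_primitive_Icc {L : ℝ} {g : ℝ → ℂ}
    (hg : MemLp g 2 (volume.restrict (Ioo 0 L))) :
    ContinuousOn (fun x => ∫ t in (0 : ℝ)..x, g t) (Icc 0 L) := by
  rcases lt_or_ge L 0 with hL | hL
  · simp [Icc_eq_empty hL.not_ge]
  have := intervalIntegral.continuousOn_primitive_interval'
    (MemLp.intervalIntegrable_Ioo hg ⟨le_rfl, hL⟩ ⟨hL, le_rfl⟩) (left_mem_uIcc)
  rwa [uIcc_of_le hL] at this

namespace IsH2

variable {L : ℝ} {f f₁ f₂ g g₁ g₂ : ℝ → ℂ}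

lemma continuousOn_deriv (h : IsH2 L f f₁ f₂) : ContinuousOn f₁ (Icc 0 L) :=
  (continuousOn_const.add (continuousOn_primitive_Icc h.memLp)).congr h.deriv_eq

lemma continuousOn (h : IsH2 L f f₁ f₂) : ContinuousOn f (Icc 0 L) :=
  (continuousOn_const.add (continuousOn_primitive_Icc
    (memLp_of_continuousOn h.continuousOn_deriv))).congr h.eq

lemma const_mul (c : ℂ) (hf : IsH2 L f f₁ f₂) :
    IsH2 L (fun x => c * f x) (fun x => c * f₁ x) (fun x => c * f₂ x) where
  memLp := hf.memLp.const_mul c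
  deriv_eq x hx := by
    rw [intervalIntegral.integral_const_mul, hf.deriv_eq x hx]; ring
  eq x hx := by
    rw [intervalIntegral.integral_const_mul, hf.eq x hx]; ring

lemma add (hf : IsH2 L f f₁ f₂) (hg : IsH2 L g g₁ g₂) :
    IsH2 L (fun x => f x + g x) (fun x => f₁ x + g₁ x) (fun x => f₂ x + g₂ x) where
  memLp := hf.memLp.add hg.memLp
  deriv_eq x hx := by
    have h0 : (0 : ℝ) ∈ Icc 0 L := ⟨le_rfl, hx.1.trans hx.2⟩
    rw [intervalIntegral.integral_add (MemLp.intervalIntegrable_Ioo hf.memLp h0 hx)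
      (MemLp.intervalIntegrable_Ioo hg.memLp h0 hx), hf.deriv_eq x hx, hg.deriv_eq x hx]
    ring
  eq x hx := by
    have h0 : (0 : ℝ) ∈ Icc 0 L := ⟨le_rfl, hx.1.trans hx.2⟩
    rw [intervalIntegral.integral_add
      (MemLp.intervalIntegrable_Ioo (memLp_of_continuousOn hf.continuousOn_deriv) h0 hx)
      (MemLp.intervalIntegrable_Ioo (memLp_of_continuousOn hg.continuousOn_deriv) h0 hx),
      hf.eq x hx, hg.eq x hx]
    ring

lemma sub (hf : IsH2 L f f₁ f₂) (hg : IsH2 L g g₁ g₂) :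
    IsH2 L (fun x => f x - g x) (fun x => f₁ x - g₁ x) (fun x => f₂ x - g₂ x) := by
  simpa only [neg_one_mul, ← sub_eq_add_neg] using hf.add (hg.const_mul (-1))

lemma of_hasDerivAt (hf : ∀ x, HasDerivAt f (f₁ x) x) (hf₁ : ∀ x, HasDerivAt f₁ (f₂ x) x)
    (hf₂ : Continuous f₂) : IsH2 L f f₁ f₂ where
  memLp := memLp_of_continuousOn hf₂.continuousOn
  deriv_eq x _ := by
    rw [intervalIntegral.integral_eq_sub_of_hasDerivAt (fun y _ => hf₁ y)
      (hf₂.intervalIntegrable _ _)]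
    ring
  eq x _ := by
    have hc : Continuous f₁ := continuous_iff_continuousAt.2 fun x => (hf₁ x).continuousAt
    rw [intervalIntegral.integral_eq_sub_of_hasDerivAt (fun y _ => hf y)
      (hc.intervalIntegrable _ _)]
    ring

/-- The solution of `-u'' = Λ u` with Cauchy data `α`, `β` at `0`. -/
lemma cauchy (Λ L : ℝ) (α β : ℂ) :
    IsH2 L (fun x => α * cosL Λ x + β * sinL Λ x) (fun x => -Λ * α * sinL Λ x + β * cosL Λ x)
      (fun x => -Λ * (α * cosL Λ x + β * sinL Λ x)) := by
  have hc := continuous_cosL Λ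
  have hs := continuous_sinL Λ
  refine of_hasDerivAt (fun x => ?_) (fun x => ?_) (by fun_prop)
  · convert! ((hasDerivAt_cosL Λ x).ofReal_comp.const_mul α).add
      ((hasDerivAt_sinL Λ x).ofReal_comp.const_mul β) using 1
    push_cast; ring
  · convert! ((hasDerivAt_sinL Λ x).ofReal_comp.const_mul (-Λ * α)).add
      ((hasDerivAt_cosL Λ x).ofReal_comp.const_mul β) using 1
    push_cast; ring

/-- A function in `H²` with `-f'' = Λ f` is determined by its Cauchy data at `0`. -/
lemma eq_cauchy (h : IsH2 L f f₁ f₂) {Λ : ℝ}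
    (hΛ : ∀ᵐ x ∂(volume.restrict (Ioo 0 L)), -f₂ x = Λ * f x) {x : ℝ} (hx : x ∈ Icc 0 L) :
    f x = f 0 * cosL Λ x + f₁ 0 * sinL Λ x ∧ f₁ x = -Λ * f 0 * sinL Λ x + f₁ 0 * cosL Λ x := by
  have hL : 0 ≤ L := hx.1.trans hx.2
  have h0 : (0 : ℝ) ∈ Icc 0 L := ⟨le_rfl, hL⟩
  -- continuous extensions of `f` and `f₁` whose primitives are differentiable everywhere
  let F : ℝ → ℂ := IccExtend hL ((Icc 0 L).domRestrict f)
  let F₁ : ℝ → ℂ := IccExtend hL ((Icc 0 L).domRestrict f₁)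
  have hF : Continuous F := (continuousOn_iff_continuous_domRestrict.1 h.continuousOn).Icc_extend'
  have hF₁ : Continuous F₁ :=
    (continuousOn_iff_continuous_domRestrict.1 h.continuousOn_deriv).Icc_extend'
  have eF : ∀ y ∈ Icc 0 L, F y = f y := fun y hy => IccExtend_of_mem hL _ hy
  have eF₁ : ∀ y ∈ Icc 0 L, F₁ y = f₁ y := fun y hy => IccExtend_of_mem hL _ hy
  let G : ℝ → ℂ := fun y => f 0 + ∫ t in (0 : ℝ)..y, F₁ t
  let G₁ : ℝ → ℂ := fun y => f₁ 0 + ∫ t in (0 : ℝ)..y, -Λ * F t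
  have eG : ∀ y ∈ Icc 0 L, G y = f y := fun y hy => by
    rw [h.eq y hy]
    refine congrArg (f 0 + ·) (intervalIntegral.integral_congr fun t ht => ?_)
    exact eF₁ t (uIcc_subset_Icc h0 hy ht)
  have eG₁ : ∀ y ∈ Icc 0 L, G₁ y = f₁ y := fun y hy => by
    rw [h.deriv_eq y hy]
    refine congrArg (f₁ 0 + ·) (intervalIntegral.integral_congr_ae ?_)
    rw [uIoc_of_le hy.1]
    have h' := (ae_restrict_iff' measurableSet_Ioo).1 hΛ
    filter_upwards [h', Measure.ae_ne volume L] with t ht htL htm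
    have htL' : t ∈ Ioo 0 L := ⟨htm.1, lt_of_le_of_ne (htm.2.trans hy.2) htL⟩
    rw [eF t (Ioo_subset_Icc_self htL'), neg_mul, ← ht htL', neg_neg]
  have dG : ∀ y, HasDerivAt G (F₁ y) y := fun y =>
    (hF₁.integral_hasStrictDerivAt 0 y).hasDerivAt.const_add _
  have dG₁ : ∀ y, HasDerivAt G₁ (-Λ * F y) y := fun y =>
    ((by fun_prop : Continuous fun t => -(Λ : ℂ) * F t).integral_hasStrictDerivAt 0 y
      ).hasDerivAt.const_add _
  have dC : ∀ y, HasDerivAt (fun y => (cosL Λ y : ℂ)) (-Λ * sinL Λ y : ℝ) y := fun y =>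
    (hasDerivAt_cosL Λ y).ofReal_comp
  have dS : ∀ y, HasDerivAt (fun y => (sinL Λ y : ℂ)) (cosL Λ y : ℝ) y := fun y =>
    (hasDerivAt_sinL Λ y).ofReal_comp
  -- the Wronskians with the two fundamental solutions are constant
  have hA : ∀ y ∈ Icc 0 L, G y * cosL Λ y - G₁ y * sinL Λ y
      = G 0 * cosL Λ 0 - G₁ 0 * sinL Λ 0 := by
    have hd := fun y => ((dG y).mul (dC y)).sub ((dG₁ y).mul (dS y))
    refine constant_of_has_deriv_right_zero
      (fun y _ => (hd y).continuousAt.continuousWithinAt) fun y hy => ?_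
    refine HasDerivAt.hasDerivWithinAt ?_
    convert! hd y using 1
    have hy' := Ico_subset_Icc_self hy
    rw [eF y hy', eF₁ y hy', eG y hy', eG₁ y hy']
    push_cast; ring
  have hB : ∀ y ∈ Icc 0 L, G₁ y * cosL Λ y + G y * (Λ * sinL Λ y)
      = G₁ 0 * cosL Λ 0 + G 0 * (Λ * sinL Λ 0) := by
    have hd := fun y => ((dG₁ y).mul (dC y)).add ((dG y).mul ((dS y).const_mul (Λ : ℂ)))
    refine constant_of_has_deriv_right_zero
      (fun y _ => (hd y).continuousAt.continuousWithinAt) fun y hy => ?_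
    refine HasDerivAt.hasDerivWithinAt ?_
    convert! hd y using 1
    have hy' := Ico_subset_Icc_self hy
    rw [eF y hy', eF₁ y hy', eG y hy', eG₁ y hy']
    push_cast; ring
  have hA := hA x hx
  have hB := hB x hx
  rw [eG x hx, eG₁ x hx, eG 0 h0, eG₁ 0 h0] at hA hB
  simp only [cosL_zero, sinL_zero, Complex.ofReal_one, Complex.ofReal_zero, mul_one, mul_zero,
    sub_zero, add_zero] at hA hB
  have hW : (cosL Λ x : ℂ) ^ 2 + Λ * sinL Λ x ^ 2 = 1 := mod_cast cosL_sq_add Λ x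
  constructor
  · linear_combination (-f x) * hW + cosL Λ x * hA + sinL Λ x * hB
  · linear_combination (-f₁ x) * hW - Λ * sinL Λ x * hA + cosL Λ x * hB

end IsH2

/-! ### The inhomogeneous equation on an interval -/

/-- Integration by parts against a primitive of an integrable function. -/
lemma integral_deriv_mul_primitive {φ φ' : ℝ → ℝ} (hφ : ∀ x, HasDerivAt φ (φ' x) x)
    (hφ' : Continuous φ') {g : ℝ → ℂ} {x : ℝ} (hg : IntervalIntegrable g volume 0 x) :
    ∫ t in (0 : ℝ)..x, (φ' t : ℂ) * ∫ r in (0 : ℝ)..t, g r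
      = φ x * (∫ t in (0 : ℝ)..x, g t) - ∫ t in (0 : ℝ)..x, (φ t : ℂ) * g t := by
  have hφc : Continuous φ := continuous_iff_continuousAt.2 fun x => (hφ x).continuousAt
  have hφd : deriv φ = φ' := funext fun x => (hφ x).deriv
  have hφ1 : ContDiff ℝ 1 φ :=
    contDiff_one_iff_deriv.2 ⟨fun x => (hφ x).differentiableAt, hφd ▸ hφ'⟩
  -- the scalar case, applied below to the real and the imaginary part of `g`
  have real : ∀ g : ℝ → ℝ, IntervalIntegrable g volume 0 x →
      ∫ t in (0 : ℝ)..x, φ' t * ∫ r in (0 : ℝ)..t, g r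
      = φ x * (∫ t in (0 : ℝ)..x, g t) - ∫ t in (0 : ℝ)..x, φ t * g t := by
    intro g hg
    have hac := hg.absolutelyContinuousOnInterval_intervalIntegral (left_mem_uIcc)
    have := AbsolutelyContinuousOnInterval.integral_mul_deriv_eq_deriv_mul
      (hφ1.contDiffOn.absolutelyContinuousOnInterval (a := 0) (b := x)) hac
    have h2 : ∫ t in (0 : ℝ)..x, φ t * deriv (fun y => ∫ r in (0 : ℝ)..y, g r) t
        = ∫ t in (0 : ℝ)..x, φ t * g t := by
      refine intervalIntegral.integral_congr_ae ?_
      filter_upwards [hg.ae_hasDerivAt_integral] with t ht htm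
      rw [(ht (uIoc_subset_uIcc htm) 0 left_mem_uIcc).deriv]
    rw [h2, hφd] at this
    simp only [intervalIntegral.integral_same, mul_zero, sub_zero] at this
    linarith
  have hgc : ContinuousOn (fun t => ∫ r in (0 : ℝ)..t, g r) (uIcc 0 x) :=
    intervalIntegral.continuousOn_primitive_interval' hg left_mem_uIcc
  have hi1 : IntervalIntegrable (fun t => (φ' t : ℂ) * ∫ r in (0 : ℝ)..t, g r) volume 0 x :=
    ContinuousOn.intervalIntegrable
      ((by fun_prop : Continuous fun t => (φ' t : ℂ)).continuousOn.mul hgc)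
  have hi2 : IntervalIntegrable (fun t => (φ t : ℂ) * g t) volume 0 x :=
    hg.continuousOn_mul (by fun_prop : Continuous fun t => (φ t : ℂ)).continuousOn
  have hsub : ∀ t ∈ uIcc 0 x, IntervalIntegrable g volume 0 t := fun t ht =>
    hg.mono_set (uIcc_subset_uIcc left_mem_uIcc ht)
  have H : ∀ l : ℂ →L[ℝ] ℝ, l (∫ t in (0 : ℝ)..x, (φ' t : ℂ) * ∫ r in (0 : ℝ)..t, g r)
      = l (φ x * (∫ t in (0 : ℝ)..x, g t) - ∫ t in (0 : ℝ)..x, (φ t : ℂ) * g t) := by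
    intro l
    have hl : ∀ (r : ℝ) (z : ℂ), l (r * z) = r * l z := fun r z => by
      rw [← Complex.real_smul, map_smul, smul_eq_mul]
    rw [map_sub, hl, ← l.intervalIntegral_comp_comm hi1, ← l.intervalIntegral_comp_comm hi2,
      ← l.intervalIntegral_comp_comm hg]
    simp only [hl]
    rw [← real _ ⟨l.integrable_comp hg.1, l.integrable_comp hg.2⟩]
    refine intervalIntegral.integral_congr fun t ht => ?_
    simp only [l.intervalIntegral_comp_comm (hsub t ht)]
  exact Complex.ext (H Complex.reCLM) (H Complex.imCLM)

/-- The Cauchy-Schwarz inequality on an interval. -/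
lemma sq_integral_norm_le {L : ℝ} (hL : 0 < L) {g : ℝ → ℂ}
    (hg : MemLp g 2 (volume.restrict (Ioo 0 L))) :
    (∫ x in Ioo 0 L, ‖g x‖) ^ 2 ≤ L * ∫ x in Ioo 0 L, ‖g x‖ ^ 2 := by
  have h1 : Integrable (fun x => ‖g x‖) (volume.restrict (Ioo 0 L)) :=
    (hg.integrable (by norm_num)).norm
  have h2 : Integrable (fun x => ‖g x‖ ^ 2) (volume.restrict (Ioo 0 L)) :=
    hg.integrable_norm_pow two_ne_zero
  set m := (∫ x in Ioo 0 L, ‖g x‖) / L with hm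
  have h3 : 0 ≤ ∫ x in Ioo 0 L, (‖g x‖ - m) ^ 2 := integral_nonneg fun x => sq_nonneg _
  have h4 : ∫ x in Ioo 0 L, (‖g x‖ - m) ^ 2
      = (∫ x in Ioo 0 L, ‖g x‖ ^ 2) - 2 * m * (∫ x in Ioo 0 L, ‖g x‖) + L * m ^ 2 := by
    have : ∀ x, (‖g x‖ - m) ^ 2 = ‖g x‖ ^ 2 - 2 * m * ‖g x‖ + m ^ 2 := fun x => by ring
    simp only [this]
    have h12 : Integrable (fun x => ‖g x‖ ^ 2 - 2 * m * ‖g x‖) (volume.restrict (Ioo 0 L)) :=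
      h2.sub (h1.const_mul _)
    rw [integral_add h12 (integrable_const _),
      integral_sub h2 (h1.const_mul _), integral_const_mul]
    simp [hL.le]
  have h5 : ∫ x in Ioo 0 L, ‖g x‖ = m * L := by rw [hm]; field_simp
  rw [h4, h5] at h3
  rw [h5]
  nlinarith

/-- The solution of `-w'' - Λ w = g` with vanishing Cauchy data at `0`, by variation of
constants. -/
lemma exists_zero_cauchy (Λ : ℝ) {L : ℝ} (hL : 0 < L) :
    ∃ K : ℝ, 0 ≤ K ∧ ∀ g : ℝ → ℂ, MemLp g 2 (volume.restrict (Ioo 0 L)) →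
      ∃ w w₁ : ℝ → ℂ, IsH2 L w w₁ (fun x => -g x - Λ * w x) ∧ w 0 = 0 ∧ w₁ 0 = 0 ∧
        ∀ x ∈ Icc 0 L, ‖w x‖ ≤ K * (∫ x in Ioo 0 L, ‖g x‖) ∧
          ‖w₁ x‖ ≤ K * (∫ x in Ioo 0 L, ‖g x‖) := by
  have hc := continuous_cosL Λ
  have hs := continuous_sinL Λ
  obtain ⟨K₁, hK₁⟩ := isCompact_Icc.exists_bound_of_continuousOn (s := Icc 0 L) hc.continuousOn
  obtain ⟨K₂, hK₂⟩ := isCompact_Icc.exists_bound_of_continuousOn (s := Icc 0 L) hs.continuousOn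
  have h0 : (0 : ℝ) ∈ Icc 0 L := ⟨le_rfl, hL.le⟩
  have hK₁0 : 0 ≤ K₁ := (norm_nonneg _).trans (hK₁ 0 h0)
  have hK₂0 : 0 ≤ K₂ := (norm_nonneg _).trans (hK₂ 0 h0)
  refine ⟨K₂ * K₁ + K₁ * K₂ + K₁ * K₁ + |Λ| * (K₂ * K₂), by positivity, fun g hg => ?_⟩
  have hgi : ∀ x ∈ Icc 0 L, IntervalIntegrable g volume 0 x := fun x hx =>
    MemLp.intervalIntegrable_Ioo hg h0 hx
  have prim : ∀ {φ : ℝ → ℝ} {K : ℝ}, Continuous φ → 0 ≤ K → (∀ x ∈ Icc 0 L, ‖φ x‖ ≤ K) →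
      (∀ x ∈ Icc 0 L, IntervalIntegrable (fun t => (φ t : ℂ) * g t) volume 0 x) ∧
      ContinuousOn (fun x => ∫ t in (0 : ℝ)..x, (φ t : ℂ) * g t) (Icc 0 L) ∧
      ∀ x ∈ Icc 0 L, ‖∫ t in (0 : ℝ)..x, (φ t : ℂ) * g t‖ ≤ K * ∫ x in Ioo 0 L, ‖g x‖ := by
    intro φ K hφ hK hb
    have hi : ∀ x ∈ Icc 0 L, IntervalIntegrable (fun t => (φ t : ℂ) * g t) volume 0 x :=
      fun x hx => (hgi x hx).continuousOn_mul
        (by fun_prop : Continuous fun t => (φ t : ℂ)).continuousOn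
    refine ⟨hi, ?_, fun x hx => ?_⟩
    · have := intervalIntegral.continuousOn_primitive_interval' (hi L ⟨hL.le, le_rfl⟩)
        left_mem_uIcc
      rwa [uIcc_of_le hL.le] at this
    · calc ‖∫ t in (0 : ℝ)..x, (φ t : ℂ) * g t‖ ≤ ∫ t in (0 : ℝ)..x, ‖(φ t : ℂ) * g t‖ :=
          intervalIntegral.norm_integral_le_integral_norm hx.1
        _ ≤ ∫ t in (0 : ℝ)..x, K * ‖g t‖ := by
          refine intervalIntegral.integral_mono_on hx.1 (hi x hx).norm
            ((hgi x hx).norm.const_mul K) fun t ht => ?_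
          rw [norm_mul, Complex.norm_real]
          exact mul_le_mul_of_nonneg_right (hb t ⟨ht.1, ht.2.trans hx.2⟩) (norm_nonneg _)
        _ ≤ ∫ t in (0 : ℝ)..L, K * ‖g t‖ := by
          refine intervalIntegral.integral_mono_interval le_rfl hx.1 hx.2
            (Filter.Eventually.of_forall fun t => by positivity)
            ((hgi L ⟨hL.le, le_rfl⟩).norm.const_mul K)
        _ = K * ∫ x in Ioo 0 L, ‖g x‖ := by
          rw [intervalIntegral.integral_const_mul, intervalIntegral.integral_of_le hL.le,
            integral_Ioc_eq_integral_Ioo]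
  obtain ⟨hPi, hPc, hPb⟩ := prim hc hK₁0 hK₁
  obtain ⟨hQi, hQc, hQb⟩ := prim hs hK₂0 hK₂
  set N := ∫ x in Ioo 0 L, ‖g x‖ with hN
  have hN0 : 0 ≤ N := integral_nonneg fun x => norm_nonneg _
  set P : ℝ → ℂ := fun x => ∫ t in (0 : ℝ)..x, (cosL Λ t : ℂ) * g t with hP
  set Q : ℝ → ℂ := fun x => ∫ t in (0 : ℝ)..x, (sinL Λ t : ℂ) * g t with hQ
  have hcC : Continuous fun x => (cosL Λ x : ℂ) := by fun_prop
  have hsC : Continuous fun x => (sinL Λ x : ℂ) := by fun_prop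
  have ii : ∀ {a b : ℝ → ℂ}, Continuous a → ContinuousOn b (Icc 0 L) → ∀ x ∈ Icc 0 L,
      IntervalIntegrable (fun t => a t * b t) volume 0 x := fun ha hb x hx =>
    ContinuousOn.intervalIntegrable (ha.continuousOn.mul
      (hb.mono (uIcc_subset_Icc h0 hx)))
  have dS : ∀ y, HasDerivAt (sinL Λ) (cosL Λ y) y := hasDerivAt_sinL Λ
  have dC : ∀ y, HasDerivAt (cosL Λ) (-Λ * sinL Λ y) y := hasDerivAt_cosL Λ
  have hc' : Continuous fun y => -Λ * sinL Λ y := by fun_prop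
  refine ⟨fun x => cosL Λ x * Q x - sinL Λ x * P x,
    fun x => -(cosL Λ x * P x + Λ * (sinL Λ x * Q x)), ⟨?_, fun x hx => ?_, fun x hx => ?_⟩,
    ?_, ?_, fun x hx => ⟨?_, ?_⟩⟩
  · refine hg.neg.sub (memLp_of_continuousOn ?_)
    exact continuousOn_const.mul ((hcC.continuousOn.mul hQc).sub (hsC.continuousOn.mul hPc))
  · have e1 := integral_deriv_mul_primitive dC hc' (hPi x hx)
    have e2 := integral_deriv_mul_primitive dS hc (hQi x hx)
    have hW : ∫ t in (0 : ℝ)..x, g t = (∫ t in (0 : ℝ)..x, (cosL Λ t : ℂ) * (cosL Λ t * g t))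
        + Λ * ∫ t in (0 : ℝ)..x, (sinL Λ t : ℂ) * (sinL Λ t * g t) := by
      rw [← intervalIntegral.integral_const_mul, ← intervalIntegral.integral_add
        ((hPi x hx).continuousOn_mul hcC.continuousOn)
        (((hQi x hx).continuousOn_mul hsC.continuousOn).const_mul _)]
      refine intervalIntegral.integral_congr fun t _ => ?_
      have hW : (cosL Λ t : ℂ) ^ 2 + Λ * sinL Λ t ^ 2 = 1 := mod_cast cosL_sq_add Λ t
      linear_combination (-g t) * hW
    have e3 : ∫ t in (0 : ℝ)..x, (-g t - Λ * (cosL Λ t * Q t - sinL Λ t * P t))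
        = -(∫ t in (0 : ℝ)..x, g t) - Λ * (∫ t in (0 : ℝ)..x, cosL Λ t * Q t)
          - ∫ t in (0 : ℝ)..x, ((-Λ * sinL Λ t : ℝ) : ℂ) * P t := by
      have i1 : IntervalIntegrable (fun t => -g t) volume 0 x := (hgi x hx).neg
      have i2 : IntervalIntegrable (fun t => (Λ : ℂ) * (cosL Λ t * Q t)) volume 0 x :=
        (ii hcC hQc x hx).const_mul _
      have i3 : IntervalIntegrable (fun t => -g t - Λ * (cosL Λ t * Q t)) volume 0 x := i1.sub i2
      rw [← intervalIntegral.integral_const_mul, ← intervalIntegral.integral_neg,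
        ← intervalIntegral.integral_sub i1 i2,
        ← intervalIntegral.integral_sub i3 (ii (by fun_prop) hPc x hx)]
      refine intervalIntegral.integral_congr fun t _ => ?_
      push_cast
      ring
    rw [e3, e1, e2, hW]
    simp only [hP, hQ, intervalIntegral.integral_same, mul_zero, add_zero, neg_zero, zero_add]
    ring
  · have e1 := integral_deriv_mul_primitive dS hc (hPi x hx)
    have e2 := integral_deriv_mul_primitive dC hc' (hQi x hx)
    have e3 : ∫ t in (0 : ℝ)..x, -((cosL Λ t : ℂ) * P t + Λ * (sinL Λ t * Q t))
        = (∫ t in (0 : ℝ)..x, ((-Λ * sinL Λ t : ℝ) : ℂ) * Q t)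
          - ∫ t in (0 : ℝ)..x, (cosL Λ t : ℂ) * P t := by
      rw [← intervalIntegral.integral_sub (ii (by fun_prop) hQc x hx) (ii hcC hPc x hx)]
      refine intervalIntegral.integral_congr fun t _ => ?_
      push_cast
      ring
    have e4 : ∫ t in (0 : ℝ)..x, (cosL Λ t : ℂ) * (sinL Λ t * g t)
        = ∫ t in (0 : ℝ)..x, (sinL Λ t : ℂ) * (cosL Λ t * g t) :=
      intervalIntegral.integral_congr fun t _ => mul_left_comm _ _ _
    rw [e3, e1, e2, e4]
    simp only [hP, hQ, intervalIntegral.integral_same, mul_zero, sub_zero, zero_add]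
    ring
  · simp [hP, hQ]
  · simp [hP, hQ]
  · have h1 := hK₁ x hx
    have h2 := hK₂ x hx
    calc ‖cosL Λ x * Q x - sinL Λ x * P x‖ ≤ ‖(cosL Λ x : ℂ)‖ * ‖Q x‖ + ‖(sinL Λ x : ℂ)‖ * ‖P x‖ := by
          rw [← norm_mul, ← norm_mul]; exact norm_sub_le _ _
      _ ≤ K₁ * (K₂ * N) + K₂ * (K₁ * N) := by
          rw [Complex.norm_real, Complex.norm_real]
          gcongr
          exacts [hQb x hx, hPb x hx]
      _ ≤ _ := by nlinarith [mul_nonneg (mul_nonneg hK₁0 hK₁0) hN0,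
          mul_nonneg (mul_nonneg (abs_nonneg Λ) (mul_nonneg hK₂0 hK₂0)) hN0]
  · have h1 := hK₁ x hx
    have h2 := hK₂ x hx
    calc ‖-(cosL Λ x * P x + Λ * (sinL Λ x * Q x))‖
        ≤ ‖(cosL Λ x : ℂ)‖ * ‖P x‖ + ‖(Λ : ℂ)‖ * (‖(sinL Λ x : ℂ)‖ * ‖Q x‖) := by
          rw [← norm_mul, ← norm_mul, ← norm_mul, norm_neg]; exact norm_add_le _ _
      _ ≤ K₁ * (K₁ * N) + |Λ| * (K₂ * (K₂ * N)) := by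
          rw [Complex.norm_real, Complex.norm_real, Complex.norm_real, Real.norm_eq_abs Λ]
          gcongr
          exacts [hPb x hx, hQb x hx]
      _ ≤ _ := by nlinarith [mul_nonneg (mul_nonneg hK₁0 hK₂0) hN0]

lemma edgeCsc_mul_sinL {Λ L : ℝ} (h : sinL Λ L ≠ 0) : (edgeCsc Λ L : ℂ) * sinL Λ L = 1 := by
  rw [← Complex.ofReal_mul, edgeCsc, inv_mul_cancel₀ h, Complex.ofReal_one]

lemma edgeCot_eq (Λ L : ℝ) : (edgeCot Λ L : ℂ) = cosL Λ L * edgeCsc Λ L := by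
  rw [← Complex.ofReal_mul, edgeCsc, edgeCot, div_eq_mul_inv]

lemma edgeTan_mul_cosL {Λ L : ℝ} (h : cosL Λ L ≠ 0) :
    (edgeTan Λ L : ℂ) * cosL Λ L = Λ * sinL Λ L := by
  rw [← Complex.ofReal_mul, edgeTan, div_mul_cancel₀ _ h, Complex.ofReal_mul]

lemma cosL_sq_add' (Λ x : ℝ) : (cosL Λ x : ℂ) ^ 2 + Λ * sinL Λ x ^ 2 = 1 :=
  mod_cast cosL_sq_add Λ x

/-- A solution of `-w'' - Λ w = g`, with a bound, obtained from the one with vanishing Cauchy data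
by adding a multiple of the homogeneous solution with Cauchy data `c₁`, `c₂`; the factor `-z` is
the value of the former at `L`, up to sign. -/
lemma exists_source (Λ : ℝ) {L : ℝ} (hL : 0 < L) (c₁ c₂ : ℝ) :
    ∃ K : ℝ, 0 ≤ K ∧ ∀ g : ℝ → ℂ, MemLp g 2 (volume.restrict (Ioo 0 L)) →
      ∃ (w w₁ : ℝ → ℂ) (z : ℂ), IsH2 L w w₁ (fun x => -g x - Λ * w x) ∧ w 0 = -z * c₁ ∧
        w₁ 0 = -z * c₂ ∧ w L = z * (1 - (c₁ * cosL Λ L + c₂ * sinL Λ L)) ∧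
        ∀ x ∈ Icc 0 L, ‖w x‖ ^ 2 ≤ K * (∫ x in Ioo 0 L, ‖g x‖ ^ 2) ∧
          ‖w₁ x‖ ^ 2 ≤ K * (∫ x in Ioo 0 L, ‖g x‖ ^ 2) := by
  obtain ⟨K, hK, H⟩ := exists_zero_cauchy Λ hL
  have hc := continuous_cosL Λ
  have hs := continuous_sinL Λ
  have h0 : (0 : ℝ) ∈ Icc 0 L := ⟨le_rfl, hL.le⟩
  have hLm : L ∈ Icc 0 L := ⟨hL.le, le_rfl⟩
  obtain ⟨B₁, hB₁⟩ := isCompact_Icc.exists_bound_of_continuousOn (s := Icc 0 L)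
    (f := fun x => c₁ * cosL Λ x + c₂ * sinL Λ x) (by fun_prop)
  obtain ⟨B₂, hB₂⟩ := isCompact_Icc.exists_bound_of_continuousOn (s := Icc 0 L)
    (f := fun x => -Λ * c₁ * sinL Λ x + c₂ * cosL Λ x) (by fun_prop)
  have hB₁0 : 0 ≤ B₁ := (norm_nonneg _).trans (hB₁ 0 h0)
  have hB₂0 : 0 ≤ B₂ := (norm_nonneg _).trans (hB₂ 0 h0)
  refine ⟨(K + K * (B₁ + B₂)) ^ 2 * L, by positivity, fun g hg => ?_⟩
  obtain ⟨v, v₁, hv, hv0, hv₁0, hvb⟩ := H g hg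
  set N := ∫ x in Ioo 0 L, ‖g x‖ with hN
  have hN0 : 0 ≤ N := integral_nonneg fun x => norm_nonneg _
  have hN2 := sq_integral_norm_le hL hg
  rw [← hN] at hN2
  have hbd : ∀ (z y : ℂ) (c : ℝ), ‖z‖ ≤ K * N → ‖c‖ ≤ B₁ + B₂ → y = z + -v L * c → ‖y‖ ^ 2 ≤
      (K + K * (B₁ + B₂)) ^ 2 * L * (∫ x in Ioo 0 L, ‖g x‖ ^ 2) := by
    rintro z y c hz hc rfl
    have : ‖z + -v L * c‖ ≤ (K + K * (B₁ + B₂)) * N := by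
      calc ‖z + -v L * c‖ ≤ ‖z‖ + ‖v L‖ * ‖c‖ := by
            rw [← Complex.norm_real, ← norm_neg (v L), ← norm_mul]; exact norm_add_le _ _
        _ ≤ K * N + K * N * (B₁ + B₂) := by
            have := (hvb L hLm).1
            gcongr
        _ = _ := by ring
    calc ‖z + -v L * c‖ ^ 2 ≤ ((K + K * (B₁ + B₂)) * N) ^ 2 := by gcongr
      _ = (K + K * (B₁ + B₂)) ^ 2 * N ^ 2 := by ring
      _ ≤ (K + K * (B₁ + B₂)) ^ 2 * (L * ∫ x in Ioo 0 L, ‖g x‖ ^ 2) := by gcongr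
      _ = _ := by ring
  have hH := hv.add (IsH2.cauchy Λ L (-v L * c₁) (-v L * c₂))
  refine ⟨fun x => v x + (-v L * c₁ * cosL Λ x + -v L * c₂ * sinL Λ x),
    fun x => v₁ x + (-Λ * (-v L * c₁) * sinL Λ x + -v L * c₂ * cosL Λ x), v L, ?_, ?_, ?_, ?_,
    fun x hx => ⟨hbd (v x) _ (c₁ * cosL Λ x + c₂ * sinL Λ x) (hvb x hx).1 ?_ ?_,
      hbd (v₁ x) _ (-Λ * c₁ * sinL Λ x + c₂ * cosL Λ x) (hvb x hx).2 ?_ ?_⟩⟩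
  · convert! hH using 2
    ring
  · simp [hv0]
  · simp [hv₁0]
  · ring
  · exact (hB₁ x hx).trans (by linarith)
  · push_cast; ring
  · exact (hB₂ x hx).trans (by linarith)
  · push_cast; ring

/-- The solution of `-w'' - Λ w = g` with Dirichlet conditions at both ends. -/
lemma exists_dirichlet_source {Λ L : ℝ} (hL : 0 < L) (hS : sinL Λ L ≠ 0) :
    ∃ K : ℝ, 0 ≤ K ∧ ∀ g : ℝ → ℂ, MemLp g 2 (volume.restrict (Ioo 0 L)) →
      ∃ w w₁ : ℝ → ℂ, IsH2 L w w₁ (fun x => -g x - Λ * w x) ∧ w 0 = 0 ∧ w L = 0 ∧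
        ∀ x ∈ Icc 0 L, ‖w x‖ ^ 2 ≤ K * (∫ x in Ioo 0 L, ‖g x‖ ^ 2) ∧
          ‖w₁ x‖ ^ 2 ≤ K * (∫ x in Ioo 0 L, ‖g x‖ ^ 2) := by
  obtain ⟨K, hK, H⟩ := exists_source Λ hL 0 (edgeCsc Λ L)
  refine ⟨K, hK, fun g hg => ?_⟩
  obtain ⟨w, w₁, z, hw, h0, -, hL, hb⟩ := H g hg
  refine ⟨w, w₁, hw, by simp [h0], ?_, hb⟩
  rw [hL, edgeCsc_mul_sinL hS]
  simp

/-- The solution of `-w'' - Λ w = g` with a Neumann condition at `0` and a Dirichlet condition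
at `L`. -/
lemma exists_mixed_source {Λ L : ℝ} (hL : 0 < L) (hC : cosL Λ L ≠ 0) :
    ∃ K : ℝ, 0 ≤ K ∧ ∀ g : ℝ → ℂ, MemLp g 2 (volume.restrict (Ioo 0 L)) →
      ∃ w w₁ : ℝ → ℂ, IsH2 L w w₁ (fun x => -g x - Λ * w x) ∧ w₁ 0 = 0 ∧ w L = 0 ∧
        ∀ x ∈ Icc 0 L, ‖w x‖ ^ 2 ≤ K * (∫ x in Ioo 0 L, ‖g x‖ ^ 2) ∧
          ‖w₁ x‖ ^ 2 ≤ K * (∫ x in Ioo 0 L, ‖g x‖ ^ 2) := by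
  obtain ⟨K, hK, H⟩ := exists_source Λ hL (cosL Λ L)⁻¹ 0
  refine ⟨K, hK, fun g hg => ?_⟩
  obtain ⟨w, w₁, z, hw, -, h0, hL, hb⟩ := H g hg
  refine ⟨w, w₁, hw, by simp [h0], ?_, hb⟩
  rw [hL, ← Complex.ofReal_mul, inv_mul_cancel₀ hC]
  simp

namespace IsH2

variable {L Λ : ℝ} {f f₁ f₂ : ℝ → ℂ}

/-- The Dirichlet-to-Neumann map of an edge. -/
lemma dirichletToNeumann (h : IsH2 L f f₁ f₂) (hL : 0 < L)
    (hΛ : ∀ᵐ x ∂(volume.restrict (Ioo 0 L)), -f₂ x = Λ * f x) (hS : sinL Λ L ≠ 0) :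
    f₁ 0 = edgeCsc Λ L * f L - edgeCot Λ L * f 0 ∧
      f₁ L = edgeCot Λ L * f L - edgeCsc Λ L * f 0 := by
  obtain ⟨h1, h2⟩ := h.eq_cauchy hΛ (x := L) ⟨hL.le, le_rfl⟩
  have e1 := edgeCsc_mul_sinL hS
  have e2 := cosL_sq_add' Λ L
  rw [edgeCot_eq]
  refine ⟨?_, ?_⟩
  · linear_combination (-f₁ 0) * e1 - edgeCsc Λ L * h1
  · rw [h2, h1]
    linear_combination (Λ * f 0 * sinL Λ L - f₁ 0 * cosL Λ L) * e1 - f 0 * edgeCsc Λ L * e2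

lemma eq_zero_of_ends (h : IsH2 L f f₁ f₂) (hL : 0 < L)
    (hΛ : ∀ᵐ x ∂(volume.restrict (Ioo 0 L)), -f₂ x = Λ * f x) (hS : sinL Λ L ≠ 0)
    (h0 : f 0 = 0) (h1 : f L = 0) {x : ℝ} (hx : x ∈ Icc 0 L) : f x = 0 := by
  have := (h.dirichletToNeumann hL hΛ hS).1
  rw [(h.eq_cauchy hΛ hx).1, this, h0, h1]
  simp

/-- The Dirichlet-to-Neumann map of an edge with a free end. -/
lemma dirichletToNeumann_of_free (h : IsH2 L f f₁ f₂) (hL : 0 < L)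
    (hΛ : ∀ᵐ x ∂(volume.restrict (Ioo 0 L)), -f₂ x = Λ * f x) (hC : cosL Λ L ≠ 0)
    (h0 : f₁ 0 = 0) :
    f₁ L = -(edgeTan Λ L * f L) ∧ ∀ x ∈ Icc 0 L, f x = f L / cosL Λ L * cosL Λ x := by
  obtain ⟨h1, h2⟩ := h.eq_cauchy hΛ (x := L) ⟨hL.le, le_rfl⟩
  have hC' : (cosL Λ L : ℂ) ≠ 0 := mod_cast hC
  refine ⟨?_, fun x hx => ?_⟩
  · rw [h2, h1, h0]
    linear_combination f 0 * edgeTan_mul_cosL hC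
  · rw [(h.eq_cauchy hΛ hx).1, h1, h0]
    field_simp
    ring

end IsH2

/-! ### Functions on the maximal abelian cover -/

section Cover

variable {ℓ₀ : ℝ} {ℓ : Fin 4 → ℝ} (h₀ : 0 < ℓ₀) (h : ∀ j, 0 < ℓ j)

local notation "Γ" => compactGraph ℓ₀ ℓ h₀ h
local notation "X" => MetricGraph.cover (compactGraph ℓ₀ ℓ h₀ h) voltage

lemma outflow_cover_B (u₁ : Option (Fin 4) × (Fin 3 → ℤ) → ℝ → ℂ) (n : Fin 3 → ℤ) :
    (X).outflow u₁ (Vtx.B, n) = ∑ j, u₁ (some j, n) 0 := by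
  have e1 : ((X).finite_src (Vtx.B, n)).toFinset = Finset.univ.image fun j => (some j, n) := by
    ext ⟨_ | j, m⟩ <;> simp [MetricGraph.cover, compactGraph, eq_comm]
  have e2 : ((X).finite_tgt (Vtx.B, n)).toFinset = ∅ := by
    ext ⟨_ | j, m⟩ <;> simp [MetricGraph.cover, compactGraph]
  rw [MetricGraph.outflow, e1, e2, Finset.sum_image (by intro i _ j _; simp)]
  simp

lemma outflow_cover_C (u₁ : Option (Fin 4) × (Fin 3 → ℤ) → ℝ → ℂ) (n : Fin 3 → ℤ) :
    (X).outflow u₁ (Vtx.C, n) = u₁ (none, n) 0 := by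
  have e1 : ((X).finite_src (Vtx.C, n)).toFinset = {(none, n)} := by
    ext ⟨_ | j, m⟩ <;> simp [MetricGraph.cover, compactGraph]
  have e2 : ((X).finite_tgt (Vtx.C, n)).toFinset = ∅ := by
    ext ⟨_ | j, m⟩ <;> simp [MetricGraph.cover, compactGraph]
  rw [MetricGraph.outflow, e1, e2]
  simp

lemma outflow_cover_A (u₁ : Option (Fin 4) × (Fin 3 → ℤ) → ℝ → ℂ) (n : Fin 3 → ℤ) :
    (X).outflow u₁ (Vtx.A, n) =
      -(u₁ (none, n) ℓ₀ + ∑ j, u₁ (some j, n - voltage (some j)) (ℓ j)) := by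
  have e1 : ((X).finite_src (Vtx.A, n)).toFinset = ∅ := by
    ext ⟨_ | j, m⟩ <;> simp [MetricGraph.cover, compactGraph]
  have e2 : ((X).finite_tgt (Vtx.A, n)).toFinset =
      insert (none, n) (Finset.univ.image fun j => (some j, n - voltage (some j))) := by
    ext ⟨_ | j, m⟩
    · simp [MetricGraph.cover, compactGraph, voltage]
    · simp only [MetricGraph.cover, compactGraph, Set.Finite.mem_toFinset, mem_ofPred_eq,
        Prod.mk.injEq, true_and, Finset.mem_insert, reduceCtorEq, false_and, Finset.mem_image,
        Finset.mem_univ, Option.some.injEq, false_or, exists_eq_left, ← eq_sub_iff_add_eq]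
      exact eq_comm
  rw [MetricGraph.outflow, e1, e2, Finset.sum_insert (by simp), Finset.sum_image
    (by intro i _ j _; simp +contextual)]
  simp [MetricGraph.cover, compactGraph]

lemma outflow_A (u₁ : Option (Fin 4) → ℝ → ℂ) :
    (Γ).outflow u₁ Vtx.A = -(u₁ none ℓ₀ + ∑ j, u₁ (some j) (ℓ j)) := by
  have e1 : ((Γ).finite_src Vtx.A).toFinset = ∅ := by
    ext (_ | j) <;> simp [compactGraph]
  have e2 : ((Γ).finite_tgt Vtx.A).toFinset = Finset.univ := by
    ext (_ | j) <;> simp [compactGraph]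
  rw [MetricGraph.outflow, e1, e2, Fintype.sum_option]
  simp [compactGraph]

lemma outflow_C (u₁ : Option (Fin 4) → ℝ → ℂ) : (Γ).outflow u₁ Vtx.C = u₁ none 0 := by
  have e1 : ((Γ).finite_src Vtx.C).toFinset = {none} := by
    ext (_ | j) <;> simp [compactGraph]
  have e2 : ((Γ).finite_tgt Vtx.C).toFinset = ∅ := by
    ext (_ | j) <;> simp [compactGraph]
  rw [MetricGraph.outflow, e1, e2]
  simp

end Cover

/-! ### Reduction of the differential equation to the vertices -/

/-- The Dirichlet-to-Neumann coefficient of the four parallel edges at one of their ends. -/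
noncomputable def cotSum (Λ : ℝ) (ℓ : Fin 4 → ℝ) : ℝ := ∑ j, edgeCot Λ (ℓ j)

section Cover

variable {ℓ₀ : ℝ} {ℓ : Fin 4 → ℝ} (h₀ : 0 < ℓ₀) (h : ∀ j, 0 < ℓ j)

local notation "Γ" => compactGraph ℓ₀ ℓ h₀ h
local notation "X" => MetricGraph.cover (compactGraph ℓ₀ ℓ h₀ h) voltage

/-- A solution of `-u'' = Λ u` on the cover is given by its values `b` at the lifts of `B` and `a`
at the lifts of `A`, and the Kirchhoff conditions become difference equations for `a` and `b`. -/
lemma cover_reduction {Λ : ℝ} (hS : ∀ j, sinL Λ (ℓ j) ≠ 0) (hC : cosL Λ ℓ₀ ≠ 0)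
    {u u₁ u₂ : Option (Fin 4) × (Fin 3 → ℤ) → ℝ → ℂ} (hu : (X).IsAdmissible ∅ u u₁ u₂)
    (hΛ : ∀ e, ∀ᵐ x ∂(volume.restrict (Ioo 0 ((X).len e))), -u₂ e x = Λ * u e x) :
    ∃ a b : (Fin 3 → ℤ) → ℂ,
      (∀ j n, u (some j, n) 0 = b n ∧ u (some j, n) (ℓ j) = a (n + voltage (some j))) ∧
      (∀ n, ∀ x ∈ Icc 0 ℓ₀, u (none, n) x = a n / cosL Λ ℓ₀ * cosL Λ x) ∧
      (∀ n, cotSum Λ ℓ * b n = ∑ j, edgeCsc Λ (ℓ j) * a (n + voltage (some j))) ∧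
      (∀ n, (cotSum Λ ℓ - edgeTan Λ ℓ₀) * a n
        = ∑ j, edgeCsc Λ (ℓ j) * b (n - voltage (some j))) ∧
      ((∀ n, a n = 0) → (∀ n, b n = 0) → ∀ e, ∀ x ∈ Icc 0 ((X).len e), u e x = 0) := by
  choose c hc using fun v => hu.continuous v (notMem_empty v)
  have hK := fun v => hu.kirchhoff v (notMem_empty v)
  have hb : ∀ j n, u (some j, n) 0 = c (Vtx.B, n) := fun j n => (hc (Vtx.B, n) (some j, n)).1 rfl
  have ha : ∀ j n, u (some j, n) (ℓ j) = c (Vtx.A, n + voltage (some j)) := fun j n =>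
    (hc (Vtx.A, n + voltage (some j)) (some j, n)).2 rfl
  have ha' : ∀ n, u (none, n) ℓ₀ = c (Vtx.A, n) := fun n => by
    refine (hc (Vtx.A, n) (none, n)).2 ?_
    simp [MetricGraph.cover, compactGraph, voltage]
  have h10 : ∀ n, u₁ (none, n) 0 = 0 := fun n => by
    have := hK (Vtx.C, n)
    rwa [outflow_cover_C] at this
  have hD := fun j n => (hu.isH2 (some j, n)).dirichletToNeumann (h j) (hΛ (some j, n)) (hS j)
  have hT := fun n => (hu.isH2 (none, n)).dirichletToNeumann_of_free h₀ (hΛ (none, n)) hC (h10 n)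
  refine ⟨fun n => c (Vtx.A, n), fun n => c (Vtx.B, n), fun j n => ⟨hb j n, ha j n⟩,
    fun n x hx => ?_, fun n => ?_, fun n => ?_, ?_⟩
  · change _ = c (Vtx.A, n) / _ * _
    rw [← ha']
    exact (hT n).2 x hx
  · have := hK (Vtx.B, n)
    rw [outflow_cover_B] at this
    have e : ∀ j, u₁ (some j, n) 0 = edgeCsc Λ (ℓ j) * c (Vtx.A, n + voltage (some j))
        - edgeCot Λ (ℓ j) * c (Vtx.B, n) := fun j => by
      rw [← hb j, ← ha j]; exact (hD j n).1
    simp only [e, Finset.sum_sub_distrib, ← Finset.sum_mul] at this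
    rw [cotSum, Complex.ofReal_sum]
    exact (sub_eq_zero.1 this).symm
  · have := hK (Vtx.A, n)
    rw [outflow_cover_A] at this
    have e : ∀ j, u₁ (some j, n - voltage (some j)) (ℓ j) = edgeCot Λ (ℓ j) * c (Vtx.A, n)
        - edgeCsc Λ (ℓ j) * c (Vtx.B, n - voltage (some j)) := fun j => by
      have hc' : c (Vtx.A, n) = u (some j, n - voltage (some j)) (ℓ j) := by
        rw [ha, sub_add_cancel]
      rw [← hb j, hc']
      exact (hD j _).2
    have e' : u₁ (none, n) ℓ₀ = -(edgeTan Λ ℓ₀ * c (Vtx.A, n)) := by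
      rw [← ha']; exact (hT n).1
    simp only [e, e', Finset.sum_sub_distrib, ← Finset.sum_mul] at this
    rw [cotSum, Complex.ofReal_sum]
    linear_combination -this
  · rintro hA hB ⟨_ | j, n⟩ x hx
    · rw [(hT n).2 x hx]
      have : u (none, n) ((X).len (none, n)) = 0 := (ha' n).trans (hA n)
      rw [this]
      simp
    · exact (hu.isH2 (some j, n)).eq_zero_of_ends (h j) (hΛ (some j, n)) (hS j)
        ((hb j n).trans (hB n)) ((ha j n).trans (hA _)) hx

/-- The solution of `-u'' = Λ u` on the edges of the cover with values `b` at the lifts of `B` and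
`a` at the lifts of `A`, and with a Neumann condition at the lifts of `C`. -/
noncomputable def interp (Λ ℓ₀ : ℝ) (ℓ : Fin 4 → ℝ) (a b : (Fin 3 → ℤ) → ℂ) :
    Option (Fin 4) × (Fin 3 → ℤ) → ℝ → ℂ
  | (none, n), x => a n / cosL Λ ℓ₀ * cosL Λ x + 0 * sinL Λ x
  | (some j, n), x => b n * cosL Λ x +
      (edgeCsc Λ (ℓ j) * a (n + voltage (some j)) - edgeCot Λ (ℓ j) * b n) * sinL Λ x

/-- The derivative of `interp` along the edges. -/
noncomputable def interpDeriv (Λ ℓ₀ : ℝ) (ℓ : Fin 4 → ℝ) (a b : (Fin 3 → ℤ) → ℂ) :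
    Option (Fin 4) × (Fin 3 → ℤ) → ℝ → ℂ
  | (none, n), x => -Λ * (a n / cosL Λ ℓ₀) * sinL Λ x + 0 * cosL Λ x
  | (some j, n), x => -Λ * b n * sinL Λ x +
      (edgeCsc Λ (ℓ j) * a (n + voltage (some j)) - edgeCot Λ (ℓ j) * b n) * cosL Λ x

lemma isH2_interp (Λ : ℝ) (a b : (Fin 3 → ℤ) → ℂ) (e : Option (Fin 4) × (Fin 3 → ℤ)) (L : ℝ) :
    IsH2 L (interp Λ ℓ₀ ℓ a b e) (interpDeriv Λ ℓ₀ ℓ a b e)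
      (fun x => -Λ * interp Λ ℓ₀ ℓ a b e x) := by
  obtain ⟨_ | j, n⟩ := e
  · exact IsH2.cauchy Λ L _ _
  · exact IsH2.cauchy Λ L _ _

/-- A function on the cover that solves `-u'' - Λ u = g` on the edges, vanishes at the lifts of `A`
and `B`, and has vanishing derivative at the lifts of `C`, becomes admissible after adding the
homogeneous solution with vertex values `a`, `b`, if these solve the difference equations whose
right-hand sides are its defects in the Kirchhoff conditions. -/
lemma isAdmissible_add_interp {Λ : ℝ} (hS : ∀ j, sinL Λ (ℓ j) ≠ 0) (hC : cosL Λ ℓ₀ ≠ 0)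
    (a b : (Fin 3 → ℤ) → ℂ) {w w₁ g : Option (Fin 4) × (Fin 3 → ℤ) → ℝ → ℂ}
    (hw : ∀ e, IsH2 ((X).len e) (w e) (w₁ e) (fun x => -g e x - Λ * w e x))
    (hw0 : ∀ j n, w (some j, n) 0 = 0) (hwL : ∀ j n, w (some j, n) (ℓ j) = 0)
    (hwt : ∀ n, w (none, n) ℓ₀ = 0) (hwt' : ∀ n, w₁ (none, n) 0 = 0)
    (hB : ∀ n, cotSum Λ ℓ * b n - ∑ j, edgeCsc Λ (ℓ j) * a (n + voltage (some j))
      = ∑ j, w₁ (some j, n) 0)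
    (hA : ∀ n, (∑ j, edgeCsc Λ (ℓ j) * b (n - voltage (some j)))
        + (edgeTan Λ ℓ₀ - cotSum Λ ℓ) * a n
      = w₁ (none, n) ℓ₀ + ∑ j, w₁ (some j, n - voltage (some j)) (ℓ j)) :
    (X).IsAdmissible ∅ (fun e x => w e x + interp Λ ℓ₀ ℓ a b e x)
      (fun e x => w₁ e x + interpDeriv Λ ℓ₀ ℓ a b e x)
      (fun e x => -g e x - Λ * (w e x + interp Λ ℓ₀ ℓ a b e x)) := by
  have hC' : (cosL Λ ℓ₀ : ℂ) ≠ 0 := mod_cast hC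
  have i0 : ∀ j n, interp Λ ℓ₀ ℓ a b (some j, n) 0 = b n := fun j n => by simp [interp]
  have iL : ∀ j n, interp Λ ℓ₀ ℓ a b (some j, n) (ℓ j) = a (n + voltage (some j)) := fun j n => by
    rw [interp, edgeCot_eq]
    linear_combination (a (n + voltage (some j)) - cosL Λ (ℓ j) * b n) * edgeCsc_mul_sinL (hS j)
  have it : ∀ n, interp Λ ℓ₀ ℓ a b (none, n) ℓ₀ = a n := fun n => by
    rw [interp]; field_simp; ring
  refine ⟨fun e => ?_, fun v hv => absurd hv (notMem_empty v), fun v _ => ?_, fun v _ => ?_⟩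
  · convert! (hw e).add (isH2_interp Λ a b e _) using 2
    ring
  · obtain ⟨_ | _ | _, n⟩ := v
    · refine ⟨a n, fun e => ?_⟩
      obtain ⟨_ | j, m⟩ := e
      · refine ⟨fun he => by simp [MetricGraph.cover, compactGraph] at he, fun he => ?_⟩
        obtain rfl : m = n := by simpa [MetricGraph.cover, compactGraph, voltage] using he
        change w (none, m) ℓ₀ + interp Λ ℓ₀ ℓ a b (none, m) ℓ₀ = a m
        rw [hwt, it, zero_add]
      · refine ⟨fun he => by simp [MetricGraph.cover, compactGraph] at he, fun he => ?_⟩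
        obtain rfl : m + voltage (some j) = n := by
          simpa [MetricGraph.cover, compactGraph] using he
        change w (some j, m) (ℓ j) + interp Λ ℓ₀ ℓ a b (some j, m) (ℓ j) = _
        rw [hwL, iL, zero_add]
    · refine ⟨b n, fun e => ?_⟩
      obtain ⟨_ | j, m⟩ := e
      · exact ⟨fun he => by simp [MetricGraph.cover, compactGraph] at he,
          fun he => by simp [MetricGraph.cover, compactGraph] at he⟩
      · refine ⟨fun he => ?_, fun he => by simp [MetricGraph.cover, compactGraph] at he⟩
        obtain rfl : m = n := by simpa [MetricGraph.cover, compactGraph] using he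
        change w (some j, m) 0 + interp Λ ℓ₀ ℓ a b (some j, m) 0 = _
        rw [hw0, i0, zero_add]
    · refine ⟨w (none, n) 0 + interp Λ ℓ₀ ℓ a b (none, n) 0, fun e => ?_⟩
      obtain ⟨_ | j, m⟩ := e
      · refine ⟨fun he => ?_, fun he => by simp [MetricGraph.cover, compactGraph] at he⟩
        obtain rfl : m = n := by simpa [MetricGraph.cover, compactGraph] using he
        rfl
      · exact ⟨fun he => by simp [MetricGraph.cover, compactGraph] at he,
          fun he => by simp [MetricGraph.cover, compactGraph] at he⟩
  · have hcot : (cotSum Λ ℓ : ℂ) = ∑ j, (edgeCot Λ (ℓ j) : ℂ) := by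
      rw [cotSum, Complex.ofReal_sum]
    obtain ⟨_ | _ | _, n⟩ := v
    · rw [outflow_cover_A]
      have e : ∀ j, interpDeriv Λ ℓ₀ ℓ a b (some j, n - voltage (some j)) (ℓ j) =
          edgeCot Λ (ℓ j) * a n - edgeCsc Λ (ℓ j) * b (n - voltage (some j)) := fun j => by
        rw [interpDeriv, sub_add_cancel, edgeCot_eq]
        linear_combination (-b (n - voltage (some j)) * edgeCsc Λ (ℓ j)) * cosL_sq_add' Λ (ℓ j)
          + (Λ * b (n - voltage (some j)) * sinL Λ (ℓ j)) * edgeCsc_mul_sinL (hS j)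
      have e' : interpDeriv Λ ℓ₀ ℓ a b (none, n) ℓ₀ = -(edgeTan Λ ℓ₀ * a n) := by
        have := edgeTan_mul_cosL hC
        rw [interpDeriv]
        field_simp
        linear_combination a n * this
      have := hA n
      simp only [e, e', Finset.sum_add_distrib, Finset.sum_sub_distrib, ← Finset.sum_mul, ← hcot]
      linear_combination this
    · rw [outflow_cover_B]
      have := hB n
      simp only [interpDeriv, Finset.sum_add_distrib, sinL_zero, cosL_zero, Complex.ofReal_zero,
        mul_zero, zero_add, Complex.ofReal_one, mul_one, Finset.sum_sub_distrib, ← Finset.sum_mul,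
        ← hcot]
      linear_combination -this
    · rw [outflow_cover_C, hwt']
      simp [interpDeriv]

/-! ### Solutions on the compact graph with a Dirichlet condition at `B` -/

/-- A solution of `-u'' = Λ u` on `Γ` with a Dirichlet condition at `B` is given by its value `a` at
the vertex `A`. -/
lemma dirichlet_reduction {Λ : ℝ} (hS : ∀ j, sinL Λ (ℓ j) ≠ 0) (hC : cosL Λ ℓ₀ ≠ 0)
    {u u₁ u₂ : Option (Fin 4) → ℝ → ℂ} (hu : (Γ).IsAdmissible {Vtx.B} u u₁ u₂)
    (hΛ : ∀ e, ∀ᵐ x ∂(volume.restrict (Ioo 0 ((Γ).len e))), -u₂ e x = Λ * u e x) :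
    ∃ a : ℂ, (∀ j, u₁ (some j) 0 = edgeCsc Λ (ℓ j) * a) ∧
      (cotSum Λ ℓ - edgeTan Λ ℓ₀) * a = 0 ∧
      (a = 0 → ∀ e, ∀ x ∈ Icc 0 ((Γ).len e), u e x = 0) := by
  obtain ⟨a, ha⟩ := hu.continuous Vtx.A (by simp)
  have hB := hu.dirichlet Vtx.B rfl
  have hb : ∀ j, u (some j) 0 = 0 := fun j => (hB (some j)).1 rfl
  have hL : ∀ j, u (some j) (ℓ j) = a := fun j => (ha (some j)).2 rfl
  have ht : u none ℓ₀ = a := (ha none).2 rfl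
  have h10 : u₁ none 0 = 0 := by
    have := hu.kirchhoff Vtx.C (by simp)
    rwa [outflow_C] at this
  have hD := fun j => (hu.isH2 (some j)).dirichletToNeumann (h j) (hΛ (some j)) (hS j)
  have hT := (hu.isH2 none).dirichletToNeumann_of_free h₀ (hΛ none) hC h10
  have e1 : ∀ j, u₁ (some j) 0 = edgeCsc Λ (ℓ j) * a := fun j => by
    have := (hD j).1
    change _ = edgeCsc Λ (ℓ j) * u (some j) (ℓ j) - edgeCot Λ (ℓ j) * u (some j) 0 at this
    rw [this, hb, hL, mul_zero, sub_zero]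
  have e2 : ∀ j, u₁ (some j) (ℓ j) = edgeCot Λ (ℓ j) * a := fun j => by
    have := (hD j).2
    change _ = edgeCot Λ (ℓ j) * u (some j) (ℓ j) - edgeCsc Λ (ℓ j) * u (some j) 0 at this
    rw [hb, hL, mul_zero, sub_zero] at this
    exact this
  have e3 : u₁ none ℓ₀ = -(edgeTan Λ ℓ₀ * a) := by
    rw [← ht]; exact hT.1
  refine ⟨a, e1, ?_, ?_⟩
  · have := hu.kirchhoff Vtx.A (by simp)
    rw [outflow_A] at this
    simp only [e2, e3, ← Finset.sum_mul] at this
    rw [cotSum, Complex.ofReal_sum]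
    linear_combination -this
  · rintro rfl e x hx
    obtain _ | j := e
    · rw [hT.2 x hx]
      have : u none ((Γ).len none) = 0 := ht
      rw [this]
      simp
    · exact (hu.isH2 (some j)).eq_zero_of_ends (h j) (hΛ (some j)) (hS j) (hb j) (hL j) hx

lemma exists_dirichlet_eigenfunction {Λ : ℝ} (hS : ∀ j, sinL Λ (ℓ j) ≠ 0) (hC : cosL Λ ℓ₀ ≠ 0)
    (hΛ : cotSum Λ ℓ = edgeTan Λ ℓ₀) : ∃ u u₁, (Γ).IsEigenfunction {Vtx.B} Λ u u₁ := by
  have hC' : (cosL Λ ℓ₀ : ℂ) ≠ 0 := mod_cast hC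
  let α : Option (Fin 4) → ℂ := fun e => e.elim (1 / cosL Λ ℓ₀) fun _ => 0
  let β : Option (Fin 4) → ℂ := fun e => e.elim 0 fun j => edgeCsc Λ (ℓ j)
  refine ⟨fun e x => α e * cosL Λ x + β e * sinL Λ x,
    fun e x => -Λ * α e * sinL Λ x + β e * cosL Λ x,
    ⟨fun e x => -Λ * (α e * cosL Λ x + β e * sinL Λ x), ⟨fun e => IsH2.cauchy Λ _ _ _, ?_, ?_, ?_⟩,
      fun e => Filter.Eventually.of_forall fun x => by ring⟩, none, ℓ₀, ⟨h₀.le, le_rfl⟩, ?_⟩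
  · rintro v rfl (_ | j)
    · exact ⟨fun he => by simp [compactGraph] at he, fun he => by simp [compactGraph] at he⟩
    · exact ⟨fun _ => by simp [α], fun he => by simp [compactGraph] at he⟩
  · rintro (_ | _ | _) hv
    · refine ⟨1, ?_⟩
      rintro (_ | j)
      · refine ⟨fun he => by simp [compactGraph] at he, fun _ => ?_⟩
        change α none * cosL Λ ℓ₀ + β none * sinL Λ ℓ₀ = 1
        simp [α, β, hC']
      · refine ⟨fun he => by simp [compactGraph] at he, fun _ => ?_⟩
        change α (some j) * cosL Λ (ℓ j) + β (some j) * sinL Λ (ℓ j) = 1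
        simp [α, β, edgeCsc_mul_sinL (hS j)]
    · exact absurd rfl hv
    · refine ⟨α none, ?_⟩
      rintro (_ | j)
      · exact ⟨fun _ => by simp, fun he => by simp [compactGraph] at he⟩
      · exact ⟨fun he => by simp [compactGraph] at he, fun he => by simp [compactGraph] at he⟩
  · rintro (_ | _ | _) hv
    · rw [outflow_A]
      have e1 : ∀ j, -Λ * α (some j) * sinL Λ (ℓ j) + β (some j) * cosL Λ (ℓ j)
          = edgeCot Λ (ℓ j) := fun j => by
        simp [α, β, edgeCot_eq, mul_comm]
      have e2 : -Λ * α none * sinL Λ ℓ₀ + β none * cosL Λ ℓ₀ = -edgeTan Λ ℓ₀ := by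
        have := edgeTan_mul_cosL hC
        simp only [α, β, Option.elim]
        field_simp
        linear_combination this
      simp only [e1, e2]
      rw [← hΛ, cotSum, Complex.ofReal_sum]
      ring
    · exact absurd rfl hv
    · rw [outflow_C]
      simp [β]
  · simp [α, β, hC']

end Cover

/-! ### The secular equation -/

lemma mul_lt_pi_div_two {s L L₀ : ℝ} (hs : 0 ≤ s) (hL : L ≤ L₀) (hs' : s * L₀ < Real.pi / 2) :
    s * L < Real.pi / 2 := (mul_le_mul_of_nonneg_left hL hs).trans_lt hs'

section Secular

variable {ℓ₀ : ℝ} {ℓ : Fin 4 → ℝ} (h₀ : 0 < ℓ₀) (h : ∀ j, 0 < ℓ j) (hle : ∀ j, ℓ j ≤ ℓ₀)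

include h hle in
lemma sinL_sq_ne_zero {s : ℝ} (hs : 0 ≤ s) (hs' : s * ℓ₀ < Real.pi / 2) (j : Fin 4) :
    sinL (s ^ 2) (ℓ j) ≠ 0 :=
  (sinL_sq_pos hs (h j) ((mul_lt_pi_div_two hs (hle j) hs').trans
    (by linarith [Real.pi_pos]))).ne'

include h hle in
lemma edgeCsc_sq_pos {s : ℝ} (hs : 0 ≤ s) (hs' : s * ℓ₀ < Real.pi / 2) (j : Fin 4) :
    0 < edgeCsc (s ^ 2) (ℓ j) :=
  inv_pos.2 (sinL_sq_pos hs (h j) ((mul_lt_pi_div_two hs (hle j) hs').trans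
    (by linarith [Real.pi_pos])))

include h hle in
lemma cotSum_sq_pos {s : ℝ} (hs : 0 ≤ s) (hs' : s * ℓ₀ < Real.pi / 2) : 0 < cotSum (s ^ 2) ℓ := by
  refine Finset.sum_pos (fun j _ => ?_) Finset.univ_nonempty
  have := mul_lt_pi_div_two hs (hle j) hs'
  exact div_pos (cosL_sq_pos hs (h j) this)
    (sinL_sq_pos hs (h j) (this.trans (by linarith [Real.pi_pos])))

include h hle in
/-- The diagonal part of the Dirichlet-to-Neumann matrix decreases at least as fast as its
off-diagonal part increases. -/
lemma sum_edgeCsc_sub_le {r s : ℝ} (hr : 0 ≤ r) (hrs : r ≤ s) (hs : s * ℓ₀ < Real.pi / 2) :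
    ∑ j, (edgeCsc (s ^ 2) (ℓ j) - edgeCsc (r ^ 2) (ℓ j)) ≤ cotSum (r ^ 2) ℓ - cotSum (s ^ 2) ℓ := by
  rw [cotSum, cotSum, ← Finset.sum_sub_distrib]
  refine Finset.sum_le_sum fun j _ => ?_
  have := mul_lt_pi_div_two (hr.trans hrs) (hle j) hs
  linarith [edgeCsc_add_edgeCot_anti (h j) hr hrs (by linarith [Real.pi_pos])]

include h hle in
lemma sum_edgeCsc_sub_nonneg {r s : ℝ} (hr : 0 ≤ r) (hrs : r ≤ s) (hs : s * ℓ₀ < Real.pi / 2)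
    (j : Fin 4) : 0 ≤ edgeCsc (s ^ 2) (ℓ j) - edgeCsc (r ^ 2) (ℓ j) := by
  have := mul_lt_pi_div_two (hr.trans hrs) (hle j) hs
  exact sub_nonneg.2 (edgeCsc_mono (h j) hr hrs (by linarith [Real.pi_pos]))

include h hle in
lemma cotSum_anti {r s : ℝ} (hr : 0 ≤ r) (hrs : r ≤ s) (hs : s * ℓ₀ < Real.pi / 2) :
    cotSum (s ^ 2) ℓ ≤ cotSum (r ^ 2) ℓ := by
  have := sum_edgeCsc_sub_le h hle hr hrs hs
  have := Finset.sum_nonneg fun j (_ : j ∈ Finset.univ) => sum_edgeCsc_sub_nonneg h hle hr hrs hs j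
  linarith

include h hle h₀ in
/-- The secular equation of `Γ` with a Dirichlet condition at `B`. -/
lemma exists_cotSum_eq_edgeTan :
    ∃ s : ℝ, 0 < s ∧ s * ℓ₀ < Real.pi / 2 ∧ cotSum (s ^ 2) ℓ = edgeTan (s ^ 2) ℓ₀ := by
  have hpi := Real.pi_pos
  set R := Real.pi / 2 / ℓ₀ with hR
  have hR0 : 0 < R := by positivity
  have hRl : R * ℓ₀ = Real.pi / 2 := by rw [hR]; field_simp
  -- clearing the denominator of the tangent makes the equation continuous up to its pole
  let g : ℝ → ℝ := fun s => cotSum (s ^ 2) ℓ * Real.cos (s * ℓ₀) - s * Real.sin (s * ℓ₀)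
  have hg : ContinuousOn g (Icc 0 R) := by
    refine ContinuousOn.sub (ContinuousOn.mul ?_ (by fun_prop)) (by fun_prop)
    refine continuousOn_finsetSum _ fun j _ => ?_
    refine continuousOn_edgeCot (h j) fun s hs => ⟨hs.1, ?_⟩
    calc s * ℓ j ≤ R * ℓ₀ := mul_le_mul hs.2 (hle j) (h j).le hR0.le
      _ < Real.pi := by rw [hRl]; linarith
  have hg0 : 0 < g 0 := by
    have := cotSum_sq_pos h hle le_rfl (by simpa using half_pos hpi)
    simpa [g] using this
  have hgR : g R < 0 := by
    simp only [g, hRl, Real.cos_pi_div_two, Real.sin_pi_div_two]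
    linarith
  obtain ⟨s, hs, hgs⟩ := intermediate_value_Icc' hR0.le hg ⟨hgR.le, hg0.le⟩
  have hs0 : 0 < s := lt_of_le_of_ne hs.1 (by rintro rfl; exact hg0.ne' hgs)
  have hsR : s < R := lt_of_le_of_ne hs.2 (by rintro rfl; exact hgR.ne hgs)
  have hs' : s * ℓ₀ < Real.pi / 2 := by rw [← hRl]; gcongr
  refine ⟨s, hs0, hs', ?_⟩
  have hc := cosL_sq_pos hs0.le h₀ hs'
  rw [cosL_sq hs0.le] at hc
  rw [edgeTan_sq hs0.le, Real.tan_eq_sin_div_cos, ← mul_div_assoc, eq_div_iff hc.ne']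
  exact sub_eq_zero.1 hgs

include h hle h₀ in
lemma edgeTan_lt_cotSum {s₀ : ℝ} (hs1 : s₀ * ℓ₀ < Real.pi / 2)
    (hs2 : cotSum (s₀ ^ 2) ℓ = edgeTan (s₀ ^ 2) ℓ₀) {r : ℝ} (hr : 0 ≤ r) (hrs : r < s₀) :
    edgeTan (r ^ 2) ℓ₀ < cotSum (r ^ 2) ℓ :=
  calc edgeTan (r ^ 2) ℓ₀ < edgeTan (s₀ ^ 2) ℓ₀ := edgeTan_lt h₀ hr hrs hs1
    _ = cotSum (s₀ ^ 2) ℓ := hs2.symm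
    _ ≤ cotSum (r ^ 2) ℓ := cotSum_anti h hle hr hrs.le hs1

include h hle h₀ in
lemma cotSum_lt_edgeTan {s₀ : ℝ} (hs0 : 0 < s₀)
    (hs2 : cotSum (s₀ ^ 2) ℓ = edgeTan (s₀ ^ 2) ℓ₀) {r : ℝ} (hrs : s₀ < r)
    (hr : r * ℓ₀ < Real.pi / 2) : cotSum (r ^ 2) ℓ < edgeTan (r ^ 2) ℓ₀ :=
  calc cotSum (r ^ 2) ℓ ≤ cotSum (s₀ ^ 2) ℓ := cotSum_anti h hle hs0.le hrs.le hr
    _ = edgeTan (s₀ ^ 2) ℓ₀ := hs2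
    _ < edgeTan (r ^ 2) ℓ₀ := edgeTan_lt h₀ hs0.le hrs hr

include h in
lemma sum_edgeCsc_lt_cotSum_of_neg {Λ : ℝ} (hΛ : Λ < 0) :
    ∑ j, edgeCsc Λ (ℓ j) < cotSum Λ ℓ := by
  refine Finset.sum_lt_sum_of_nonempty Finset.univ_nonempty fun j _ => ?_
  rw [edgeCsc, edgeCot, ← one_div]
  exact div_lt_div_of_pos_right (one_lt_cosL hΛ (h j)) (sinL_pos_of_nonpos hΛ.le (h j))

include h in
lemma sum_edgeCsc_nonneg_of_neg {Λ : ℝ} (hΛ : Λ < 0) : 0 ≤ ∑ j, edgeCsc Λ (ℓ j) :=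
  Finset.sum_nonneg fun j _ => (inv_pos.2 (sinL_pos_of_nonpos hΛ.le (h j))).le

include h₀ in
lemma edgeTan_nonpos_of_neg {Λ : ℝ} (hΛ : Λ < 0) : edgeTan Λ ℓ₀ ≤ 0 :=
  div_nonpos_of_nonpos_of_nonneg
    (mul_nonpos_of_nonpos_of_nonneg hΛ.le (sinL_pos_of_nonpos hΛ.le h₀).le)
    (one_pos.trans (one_lt_cosL hΛ h₀)).le

/-! ### The ground state of the graph with a Dirichlet condition at `B` -/

local notation "Γ" => compactGraph ℓ₀ ℓ h₀ h

include hle in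
lemma isLeast_dirichlet_eigenvalues {s₀ : ℝ} (hs0 : 0 < s₀) (hs1 : s₀ * ℓ₀ < Real.pi / 2)
    (hs2 : cotSum (s₀ ^ 2) ℓ = edgeTan (s₀ ^ 2) ℓ₀) :
    IsLeast ((Γ).eigenvalues {Vtx.B}) (s₀ ^ 2) := by
  refine ⟨exists_dirichlet_eigenfunction h₀ h (sinL_sq_ne_zero h hle hs0.le hs1)
    (cosL_sq_pos hs0.le h₀ hs1).ne' hs2, ?_⟩
  rintro Λ ⟨u, u₁, ⟨u₂, hu, hΛ⟩, e, x, hx, hne⟩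
  by_contra! hlt
  have key : (∀ j, sinL Λ (ℓ j) ≠ 0) ∧ cosL Λ ℓ₀ ≠ 0 ∧ edgeTan Λ ℓ₀ < cotSum Λ ℓ := by
    rcases lt_or_ge Λ 0 with hneg | hnn
    · refine ⟨fun j => (sinL_pos_of_nonpos hneg.le (h j)).ne',
        (one_pos.trans (one_lt_cosL hneg h₀)).ne', ?_⟩
      linarith [edgeTan_nonpos_of_neg h₀ hneg, sum_edgeCsc_lt_cotSum_of_neg h hneg,
        sum_edgeCsc_nonneg_of_neg h hneg]
    · obtain ⟨r, hr, rfl⟩ : ∃ r : ℝ, 0 ≤ r ∧ r ^ 2 = Λ := ⟨√Λ, Real.sqrt_nonneg _, Real.sq_sqrt hnn⟩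
      have hrs : r < s₀ := lt_of_pow_lt_pow_left₀ 2 hs0.le hlt
      have hr1 : r * ℓ₀ < Real.pi / 2 := (mul_lt_mul_of_pos_right hrs h₀).trans hs1
      exact ⟨sinL_sq_ne_zero h hle hr hr1, (cosL_sq_pos hr h₀ hr1).ne',
        edgeTan_lt_cotSum h₀ h hle hs1 hs2 hr hrs⟩
  obtain ⟨a, -, ha, ha'⟩ := dirichlet_reduction h₀ h key.1 key.2.1 hu hΛ
  refine hne (ha' ?_ e x hx)
  have hne' : (cotSum Λ ℓ - edgeTan Λ ℓ₀ : ℂ) ≠ 0 := by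
    exact_mod_cast (sub_pos.2 key.2.2).ne'
  exact (mul_eq_zero.1 ha).resolve_left hne'

include h hle in
/-- The quadrangle inequalities for the slopes at `B`: all ratios of these slopes are less than
three, so that each slope is less than the sum of the other three. -/
lemma two_mul_edgeCsc_lt {s : ℝ} (hs : 0 < s) (hs' : s * ℓ₀ < Real.pi / 2)
    (h3 : ∀ i j, ℓ i < 3 * ℓ j) (j : Fin 4) :
    2 * edgeCsc (s ^ 2) (ℓ j) < ∑ i, edgeCsc (s ^ 2) (ℓ i) := by
  have hpi := Real.pi_pos
  have hpos : ∀ i, 0 < sinL (s ^ 2) (ℓ i) := fun i => sinL_sq_pos hs.le (h i)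
    ((mul_lt_pi_div_two hs.le (hle i) hs').trans (by linarith))
  have hS : ∀ x, 0 < x → s * sinL (s ^ 2) x = Real.sin (s * x) := fun x hx => by
    rw [sinL_sq hs.le, Real.sinc_of_ne_zero (by positivity)]
    field_simp
  have key : ∀ i, edgeCsc (s ^ 2) (ℓ j) < 3 * edgeCsc (s ^ 2) (ℓ i) := fun i => by
    have hi := mul_lt_pi_div_two hs.le (hle i) hs'
    have hj := mul_lt_pi_div_two hs.le (hle j) hs'
    have e1 : sinL (s ^ 2) (ℓ i) ≤ 3 * sinL (s ^ 2) (ℓ i / 3) := by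
      rw [sinL_sq hs.le, sinL_sq hs.le]
      have : s * (ℓ i / 3) ≤ s * ℓ i := by
        have := h i
        gcongr
        linarith
      have := Real.sinc_le_sinc (x := s * (ℓ i / 3)) (y := s * ℓ i)
        (mul_nonneg hs.le (by linarith [h i])) this (by linarith)
      calc ℓ i * Real.sinc (s * ℓ i) ≤ ℓ i * Real.sinc (s * (ℓ i / 3)) := by
            have := h i
            gcongr
        _ = _ := by ring
    have e2 : sinL (s ^ 2) (ℓ i / 3) < sinL (s ^ 2) (ℓ j) := by
      refine lt_of_mul_lt_mul_left ?_ hs.le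
      rw [hS _ (by linarith [h i]), hS _ (h j)]
      refine Real.sin_lt_sin_of_lt_of_le_pi_div_two ?_ hj.le ?_
      · have : 0 ≤ s * (ℓ i / 3) := mul_nonneg hs.le (by linarith [h i])
        linarith
      · have := h3 i j
        gcongr
        linarith
    rw [edgeCsc, edgeCsc, ← div_eq_mul_inv, inv_eq_one_div, div_lt_div_iff₀ (hpos j) (hpos i)]
    linarith
  have k0 := key 0
  have k1 := key 1
  have k2 := key 2
  have k3 := key 3
  rw [Fin.sum_univ_four]
  fin_cases j <;> simp only [Fin.isValue, Fin.zero_eta, Fin.mk_one, Fin.reduceFinMk] at * <;>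
    linarith

end Secular

/-! ### The spectrum of the Floquet operators -/

/-- The character `n ↦ exp (i k ⋅ n)` of `ℤ³`. -/
noncomputable def floquetChar (k : Fin 3 → Real.Angle) (n : Fin 3 → ℤ) : ℂ :=
  ∏ i, ((k i).toCircle : ℂ) ^ n i

lemma floquetChar_add (k : Fin 3 → Real.Angle) (m n : Fin 3 → ℤ) :
    floquetChar k (m + n) = floquetChar k m * floquetChar k n := by
  rw [floquetChar, floquetChar, floquetChar, ← Finset.prod_mul_distrib]
  exact Finset.prod_congr rfl fun i _ => zpow_add₀ (Circle.coe_ne_zero _) _ _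

@[simp] lemma floquetChar_zero (k : Fin 3 → Real.Angle) : floquetChar k 0 = 1 := by
  simp [floquetChar]

@[simp] lemma norm_floquetChar (k : Fin 3 → Real.Angle) (n : Fin 3 → ℤ) :
    ‖floquetChar k n‖ = 1 := by
  simp [floquetChar, norm_prod, Circle.norm_coe]

lemma floquetChar_ne_zero (k : Fin 3 → Real.Angle) (n : Fin 3 → ℤ) : floquetChar k n ≠ 0 := by
  rw [← norm_ne_zero_iff]; simp

lemma floquetChar_neg (k : Fin 3 → Real.Angle) (n : Fin 3 → ℤ) :
    floquetChar k (-n) = (starRingEnd ℂ) (floquetChar k n) := by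
  have h1 : floquetChar k (-n) * floquetChar k n = 1 := by
    rw [← floquetChar_add, neg_add_cancel, floquetChar_zero]
  have h2 : (starRingEnd ℂ) (floquetChar k n) * floquetChar k n = 1 := by
    rw [Complex.conj_mul', norm_floquetChar]; simp
  exact mul_right_cancel₀ (floquetChar_ne_zero k n) (h1.trans h2.symm)

lemma floquetChar_single (k : Fin 3 → Real.Angle) (j : Fin 3) :
    floquetChar k (Pi.single j 1) = (k j).toCircle := by
  rw [floquetChar, Finset.prod_eq_single j]
  · simp
  · intro i _ hi
    simp [Pi.single_eq_of_ne hi]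
  · simp

/-- A function on `ℤ³` that is multiplied by `exp (i kⱼ)` under the `j`-th generator is a multiple
of the character with quasimomentum `k`. -/
lemma eq_floquetChar_mul {k : Fin 3 → Real.Angle} {f : (Fin 3 → ℤ) → ℂ}
    (hf : ∀ j n, f (n + Pi.single j 1) = (k j).toCircle * f n) (n : Fin 3 → ℤ) :
    f n = floquetChar k n * f 0 := by
  -- the periods of `f / χ` form a subgroup that contains the generators
  let P : AddSubgroup (Fin 3 → ℤ) :=
    { carrier := {m | ∀ n, f (n + m) = floquetChar k m * f n}
      zero_mem' := fun n => by simp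
      add_mem' := fun {a b} ha hb n => by
        rw [← add_assoc, hb, ha, floquetChar_add]; ring
      neg_mem' := fun {a} ha n => by
        have h1 := ha (n + -a)
        rw [neg_add_cancel_right] at h1
        rw [h1, ← mul_assoc, ← floquetChar_add, neg_add_cancel, floquetChar_zero, one_mul] }
  have hg : ∀ j, Pi.single j (1 : ℤ) ∈ P := fun j n => by rw [hf, floquetChar_single]
  have hn : n ∈ P := by
    have : n = ∑ j, n j • Pi.single j (1 : ℤ) := by
      ext i
      simp [Finset.sum_apply, Pi.single_apply]
    rw [this]
    exact P.sum_mem fun j _ => P.zsmul_mem (hg j) _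
  simpa using hn 0

/-- The total flux into `B`, in the Floquet operator with quasimomentum `k`, of the function that
vanishes at `B` and has the value `1` at `A`. -/
noncomputable def fluxSum (Λ : ℝ) (ℓ : Fin 4 → ℝ) (k : Fin 3 → Real.Angle) : ℂ :=
  ∑ j, edgeCsc Λ (ℓ j) * floquetChar k (voltage (some j))

lemma norm_fluxSum_le {Λ : ℝ} {ℓ : Fin 4 → ℝ} (h : ∀ j, 0 ≤ edgeCsc Λ (ℓ j))
    (k : Fin 3 → Real.Angle) : ‖fluxSum Λ ℓ k‖ ≤ ∑ j, edgeCsc Λ (ℓ j) := by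
  refine (norm_sum_le _ _).trans (Finset.sum_le_sum fun j _ => ?_)
  rw [norm_mul, norm_floquetChar, mul_one, Complex.norm_real, Real.norm_of_nonneg (h j)]

section Floquet

variable {ℓ₀ : ℝ} {ℓ : Fin 4 → ℝ} (h₀ : 0 < ℓ₀) (h : ∀ j, 0 < ℓ j) (hle : ∀ j, ℓ j ≤ ℓ₀)

local notation "Γ" => compactGraph ℓ₀ ℓ h₀ h
local notation "X" => MetricGraph.cover (compactGraph ℓ₀ ℓ h₀ h) voltage

/-- The secular equation of the Floquet operators. -/
lemma mem_floquetSpectrum_iff {Λ : ℝ} (hS : ∀ j, sinL Λ (ℓ j) ≠ 0) (hC : cosL Λ ℓ₀ ≠ 0)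
    (hT : 0 < cotSum Λ ℓ) (k : Fin 3 → Real.Angle) :
    Λ ∈ (Γ).floquetSpectrum voltage k ↔
      cotSum Λ ℓ * (cotSum Λ ℓ - edgeTan Λ ℓ₀) = ‖fluxSum Λ ℓ k‖ ^ 2 := by
  have hT' : (cotSum Λ ℓ : ℂ) ≠ 0 := mod_cast hT.ne'
  have hconj : ∑ j, (edgeCsc Λ (ℓ j) : ℂ) * floquetChar k (-voltage (some j))
      = (starRingEnd ℂ) (fluxSum Λ ℓ k) := by
    rw [fluxSum, map_sum]
    exact Finset.sum_congr rfl fun j _ => by rw [floquetChar_neg, map_mul, Complex.conj_ofReal]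
  constructor
  · rintro ⟨u, u₁, ⟨⟨u₂, hu, hΛ⟩, e, x, hx, hne⟩, hF⟩
    obtain ⟨a, b, hab, ht, hB, hA, hz⟩ := cover_reduction h₀ h hS hC hu hΛ
    have hFl : ∀ (e : Option (Fin 4)) (x : ℝ), x ∈ Icc 0 ((Γ).len e) → ∀ n,
        u (e, n) x = floquetChar k n * u (e, 0) x := fun e x hx n =>
      eq_floquetChar_mul (f := fun n => u (e, n) x) (fun j n => hF j e n x hx) n
    have hb : ∀ n, b n = floquetChar k n * b 0 := fun n => by
      rw [← (hab 0 n).1, ← (hab 0 0).1]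
      exact hFl (some 0) 0 ⟨le_rfl, (h 0).le⟩ n
    have ha : ∀ n, a n = floquetChar k n * a 0 := fun n => by
      have hC' : (cosL Λ ℓ₀ : ℂ) ≠ 0 := mod_cast hC
      have ht' : ∀ n, u (none, n) ℓ₀ = a n := fun n => by
        rw [ht n ℓ₀ ⟨h₀.le, le_rfl⟩, div_mul_cancel₀ _ hC']
      rw [← ht', ← ht']
      exact hFl none ℓ₀ ⟨h₀.le, le_rfl⟩ n
    have eB := hB 0
    have eA := hA 0
    simp only [zero_add, zero_sub] at eB eA
    rw [Finset.sum_congr rfl fun j _ => by rw [ha (voltage (some j)), ← mul_assoc],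
      ← Finset.sum_mul] at eB
    rw [Finset.sum_congr rfl fun j _ => by rw [hb (-voltage (some j)), ← mul_assoc],
      ← Finset.sum_mul, hconj] at eA
    change _ = fluxSum Λ ℓ k * _ at eB
    have ha0 : a 0 ≠ 0 := fun ha0 => by
      have hb0 : b 0 = 0 := by
        rw [ha0, mul_zero] at eB
        exact (mul_eq_zero.1 eB).resolve_left hT'
      exact hne (hz (fun n => by rw [ha, ha0, mul_zero]) (fun n => by rw [hb, hb0, mul_zero]) e x hx)
    have key : ((cotSum Λ ℓ * (cotSum Λ ℓ - edgeTan Λ ℓ₀) : ℝ) : ℂ)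
        = ((‖fluxSum Λ ℓ k‖ ^ 2 : ℝ) : ℂ) := by
      push_cast
      rw [← Complex.conj_mul']
      refine mul_right_cancel₀ ha0 ?_
      linear_combination (cotSum Λ ℓ : ℂ) * eA + (starRingEnd ℂ) (fluxSum Λ ℓ k) * eB
    exact_mod_cast key
  · intro heq
    let a : (Fin 3 → ℤ) → ℂ := fun n => floquetChar k n * cotSum Λ ℓ
    let b : (Fin 3 → ℤ) → ℂ := fun n => floquetChar k n * fluxSum Λ ℓ k
    have hc : (cotSum Λ ℓ : ℂ) * (cotSum Λ ℓ - edgeTan Λ ℓ₀)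
        = (starRingEnd ℂ) (fluxSum Λ ℓ k) * fluxSum Λ ℓ k := by
      rw [Complex.conj_mul']
      exact_mod_cast heq
    have hadm := isAdmissible_add_interp h₀ h hS hC a b (w := fun _ _ => 0) (w₁ := fun _ _ => 0)
      (g := fun _ _ => 0) (fun e => by simpa using IsH2.cauchy Λ ((X).len e) 0 0)
      (fun _ _ => rfl) (fun _ _ => rfl) (fun _ => rfl) (fun _ => rfl)
      (fun n => by
        have : ∑ j, (edgeCsc Λ (ℓ j) : ℂ) * a (n + voltage (some j))
            = floquetChar k n * cotSum Λ ℓ * fluxSum Λ ℓ k := by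
          rw [fluxSum, Finset.mul_sum]
          exact Finset.sum_congr rfl fun j _ => by simp only [a, floquetChar_add]; ring
        rw [this]
        simp only [b, Finset.sum_const_zero]
        ring)
      (fun n => by
        have : ∑ j, (edgeCsc Λ (ℓ j) : ℂ) * b (n - voltage (some j))
            = floquetChar k n * ((starRingEnd ℂ) (fluxSum Λ ℓ k) * fluxSum Λ ℓ k) := by
          rw [← hconj, Finset.sum_mul, Finset.mul_sum]
          exact Finset.sum_congr rfl fun j _ => by
            simp only [b, sub_eq_add_neg, floquetChar_add]; ring
        rw [this]
        simp only [a, Finset.sum_const_zero, add_zero]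
        linear_combination (-floquetChar k n) * hc)
    refine ⟨_, _, ⟨⟨_, hadm, fun e => Filter.Eventually.of_forall fun x => by simp⟩, (none, 0), ℓ₀,
      ⟨h₀.le, le_rfl⟩, ?_⟩, ?_⟩
    · have hC' : (cosL Λ ℓ₀ : ℂ) ≠ 0 := mod_cast hC
      simp [interp, a, hC', hT']
    · rintro j (_ | i) n x -
      · simp only [interp, a, floquetChar_add, floquetChar_single]
        ring
      · simp only [interp, a, b, floquetChar_add, floquetChar_single, add_right_comm n]
        ring

include h hle h₀ in
/-- Where the flux vanishes at `s₀`, the secular equation has no solution below `s₀`: between `s`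
and `s₀` the flux changes by less than the diagonal of the Dirichlet-to-Neumann matrix. -/
lemma norm_fluxSum_sq_lt {s₀ : ℝ} (hs1 : s₀ * ℓ₀ < Real.pi / 2)
    (hs2 : cotSum (s₀ ^ 2) ℓ = edgeTan (s₀ ^ 2) ℓ₀) {k : Fin 3 → Real.Angle}
    (hk : fluxSum (s₀ ^ 2) ℓ k = 0) {r : ℝ} (hr : 0 ≤ r) (hrs : r < s₀) :
    ‖fluxSum (r ^ 2) ℓ k‖ ^ 2 < cotSum (r ^ 2) ℓ * (cotSum (r ^ 2) ℓ - edgeTan (r ^ 2) ℓ₀) := by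
  have h1 : ‖fluxSum (r ^ 2) ℓ k‖ ≤ cotSum (r ^ 2) ℓ - cotSum (s₀ ^ 2) ℓ := by
    calc ‖fluxSum (r ^ 2) ℓ k‖ = ‖∑ j, ((edgeCsc (s₀ ^ 2) (ℓ j) - edgeCsc (r ^ 2) (ℓ j) : ℝ) : ℂ)
          * floquetChar k (voltage (some j))‖ := by
          rw [← norm_neg, ← zero_sub, ← hk, fluxSum, fluxSum, ← Finset.sum_sub_distrib]
          simp only [Complex.ofReal_sub, sub_mul]
      _ ≤ ∑ j, (edgeCsc (s₀ ^ 2) (ℓ j) - edgeCsc (r ^ 2) (ℓ j)) := by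
          refine (norm_sum_le _ _).trans (Finset.sum_le_sum fun j _ => ?_)
          rw [norm_mul, norm_floquetChar, mul_one, Complex.norm_real,
            Real.norm_of_nonneg (sum_edgeCsc_sub_nonneg h hle hr hrs.le hs1 j)]
      _ ≤ _ := sum_edgeCsc_sub_le h hle hr hrs.le hs1
  have h2 := edgeTan_lt h₀ hr hrs hs1
  have h3 := cotSum_sq_pos h hle (hr.trans hrs.le) hs1
  have h4 := norm_nonneg (fluxSum (r ^ 2) ℓ k)
  calc ‖fluxSum (r ^ 2) ℓ k‖ ^ 2
      = ‖fluxSum (r ^ 2) ℓ k‖ * ‖fluxSum (r ^ 2) ℓ k‖ := by ring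
    _ < cotSum (r ^ 2) ℓ * (cotSum (r ^ 2) ℓ - edgeTan (r ^ 2) ℓ₀) :=
      mul_lt_mul'' (by linarith) (by linarith) h4 h4

/-- The Floquet operators are nonnegative. -/
lemma nonneg_of_mem_floquetSpectrum {Λ : ℝ} {k : Fin 3 → Real.Angle}
    (hΛ : Λ ∈ (Γ).floquetSpectrum voltage k) : 0 ≤ Λ := by
  by_contra! hneg
  have hpos : ∀ j, 0 < sinL Λ (ℓ j) := fun j => sinL_pos_of_nonpos hneg.le (h j)
  have h1 := sum_edgeCsc_lt_cotSum_of_neg h hneg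
  have h2 := norm_fluxSum_le (fun j => (inv_pos.2 (hpos j)).le) k
  have h3 := edgeTan_nonpos_of_neg h₀ hneg
  have h4 := sum_edgeCsc_nonneg_of_neg h hneg
  have h5 := (mem_floquetSpectrum_iff h₀ h (fun j => (hpos j).ne')
    (one_pos.trans (one_lt_cosL hneg h₀)).ne' (h4.trans_lt h1) k).1 hΛ
  have h6 := norm_nonneg (fluxSum Λ ℓ k)
  nlinarith

include hle in
/-- The first band function is at most `s₀²`, with equality exactly where the flux vanishes. -/
lemma exists_isLeast_floquetSpectrum {s₀ : ℝ} (hs0 : 0 < s₀) (hs1 : s₀ * ℓ₀ < Real.pi / 2)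
    (hs2 : cotSum (s₀ ^ 2) ℓ = edgeTan (s₀ ^ 2) ℓ₀) (k : Fin 3 → Real.Angle) :
    ∃ Λ, IsLeast ((Γ).floquetSpectrum voltage k) Λ ∧ Λ ≤ s₀ ^ 2 ∧
      (Λ = s₀ ^ 2 ↔ fluxSum (s₀ ^ 2) ℓ k = 0) := by
  have hpi := Real.pi_pos
  have hr1 : ∀ {r : ℝ}, r ≤ s₀ → r * ℓ₀ < Real.pi / 2 := fun hr =>
    (mul_le_mul_of_nonneg_right hr h₀.le).trans_lt hs1
  have hmem : ∀ {r : ℝ}, 0 ≤ r → r ≤ s₀ → (r ^ 2 ∈ (Γ).floquetSpectrum voltage k ↔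
      cotSum (r ^ 2) ℓ * (cotSum (r ^ 2) ℓ - edgeTan (r ^ 2) ℓ₀) = ‖fluxSum (r ^ 2) ℓ k‖ ^ 2) :=
    fun hr hrs => mem_floquetSpectrum_iff h₀ h (sinL_sq_ne_zero h hle hr (hr1 hrs))
      (cosL_sq_pos hr h₀ (hr1 hrs)).ne' (cotSum_sq_pos h hle hr (hr1 hrs)) k
  by_cases hk : fluxSum (s₀ ^ 2) ℓ k = 0
  · refine ⟨s₀ ^ 2, ⟨?_, fun Λ hΛ => ?_⟩, le_rfl, by simp [hk]⟩
    · rw [hmem hs0.le le_rfl, hk, hs2]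
      simp
    · by_contra! hlt
      have hnn := nonneg_of_mem_floquetSpectrum h₀ h hΛ
      obtain ⟨r, hr, rfl⟩ : ∃ r : ℝ, 0 ≤ r ∧ r ^ 2 = Λ := ⟨√Λ, Real.sqrt_nonneg _, Real.sq_sqrt hnn⟩
      have hrs : r < s₀ := lt_of_pow_lt_pow_left₀ 2 hs0.le hlt
      have h2 := norm_fluxSum_sq_lt h₀ h hle hs1 hs2 hk hr hrs
      exact h2.ne' ((hmem hr hrs.le).1 hΛ)
  let H : ℝ → ℝ := fun r =>
    cotSum (r ^ 2) ℓ * (cotSum (r ^ 2) ℓ - edgeTan (r ^ 2) ℓ₀) - ‖fluxSum (r ^ 2) ℓ k‖ ^ 2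
  have hH : ContinuousOn H (Icc 0 s₀) := by
    have hI : ∀ j, ∀ s ∈ Icc 0 s₀, 0 ≤ s ∧ s * ℓ j < Real.pi := fun j s hs =>
      ⟨hs.1, (mul_lt_pi_div_two hs.1 (hle j) (hr1 hs.2)).trans (by linarith)⟩
    have c1 : ContinuousOn (fun r : ℝ => cotSum (r ^ 2) ℓ) (Icc 0 s₀) :=
      continuousOn_finsetSum _ fun j _ => continuousOn_edgeCot (h j) (hI j)
    have c2 : ContinuousOn (fun r : ℝ => edgeTan (r ^ 2) ℓ₀) (Icc 0 s₀) :=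
      continuousOn_edgeTan h₀ fun s hs => ⟨hs.1, hr1 hs.2⟩
    have c3 : ContinuousOn (fun r : ℝ => fluxSum (r ^ 2) ℓ k) (Icc 0 s₀) :=
      continuousOn_finsetSum _ fun j _ => (Complex.continuous_ofReal.comp_continuousOn
        (continuousOn_edgeCsc (h j) (hI j))).mul continuousOn_const
    exact (c1.mul (c1.sub c2)).sub (c3.norm.pow 2)
  have hH0 : 0 ≤ H 0 := by
    have e : ∑ j, edgeCsc (0 ^ 2) (ℓ j) = cotSum (0 ^ 2) ℓ := by simp [cotSum, edgeCsc, edgeCot, cosL]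
    have h1 := norm_fluxSum_le (fun j => (edgeCsc_sq_pos h hle le_rfl (hr1 hs0.le) j).le) k
    have h2 := norm_nonneg (fluxSum (0 ^ 2) ℓ k)
    rw [e] at h1
    have h3 : edgeTan (0 ^ 2) ℓ₀ = 0 := by simp [edgeTan]
    simp only [H, h3, sub_zero]
    nlinarith
  have hH1 : H s₀ < 0 := by
    have : 0 < ‖fluxSum (s₀ ^ 2) ℓ k‖ := norm_pos_iff.2 hk
    simp only [H, hs2, sub_self, mul_zero, zero_sub]
    nlinarith
  obtain ⟨r₁, hr₁, hHr₁⟩ := intermediate_value_Icc' hs0.le hH ⟨hH1.le, hH0⟩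
  have hK : IsCompact (Icc 0 s₀ ∩ H ⁻¹' {0}) :=
    isCompact_Icc.of_isClosed_subset (hH.preimage_isClosed_of_isClosed isClosed_Icc
      isClosed_singleton) inter_subset_left
  obtain ⟨r, ⟨⟨hr0, hrs⟩, hHr⟩, hmin⟩ := hK.exists_isLeast ⟨r₁, hr₁, hHr₁⟩
  have hne : r ≠ s₀ := by rintro rfl; exact hH1.ne hHr
  have hrs2 : r ^ 2 < s₀ ^ 2 := pow_lt_pow_left₀ (lt_of_le_of_ne hrs hne) hr0 two_ne_zero
  refine ⟨r ^ 2, ⟨(hmem hr0 hrs).2 (sub_eq_zero.1 hHr), fun Λ hΛ => ?_⟩, hrs2.le, by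
    simp [hk, hrs2.ne]⟩
  have hnn := nonneg_of_mem_floquetSpectrum h₀ h hΛ
  obtain ⟨t, ht, rfl⟩ : ∃ r : ℝ, 0 ≤ r ∧ r ^ 2 = Λ := ⟨√Λ, Real.sqrt_nonneg _, Real.sq_sqrt hnn⟩
  rcases le_or_gt t s₀ with hts | hts
  · exact pow_le_pow_left₀ hr0 (hmin ⟨⟨ht, hts⟩, sub_eq_zero.2 ((hmem ht hts).1 hΛ)⟩) 2
  · exact pow_le_pow_left₀ hr0 (hrs.trans hts.le) 2

end Floquet

/-! ### Hausdorff dimension of subsets of the torus -/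

lemma Real.Angle.norm_coe (x : ℝ) :
    ‖(x : Real.Angle)‖ = |x - round ((2 * Real.pi)⁻¹ * x) * (2 * Real.pi)| :=
  AddCircle.norm_eq (2 * Real.pi)

lemma Real.Angle.norm_coe_le (x : ℝ) : ‖(x : Real.Angle)‖ ≤ |x| := by
  have h : 0 < 2 * Real.pi := by positivity
  have h1 := round_le ((2 * Real.pi)⁻¹ * x) 0
  rw [Int.cast_zero, sub_zero] at h1
  have h2 : x - round ((2 * Real.pi)⁻¹ * x) * (2 * Real.pi)
      = ((2 * Real.pi)⁻¹ * x - round ((2 * Real.pi)⁻¹ * x)) * (2 * Real.pi) := by field_simp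
  rw [Real.Angle.norm_coe, h2, abs_mul, abs_of_pos h]
  calc _ ≤ |(2 * Real.pi)⁻¹ * x| * (2 * Real.pi) := by gcongr
    _ = |x| := by rw [abs_mul, abs_of_pos (inv_pos.2 h)]; field_simp

lemma Real.Angle.lipschitzWith_cos : LipschitzWith 1 Real.Angle.cos := by
  refine LipschitzWith.of_dist_le_mul fun a b => ?_
  rw [NNReal.coe_one, one_mul, dist_eq_norm, dist_eq_norm, Real.norm_eq_abs]
  induction a using Real.Angle.induction_on with | _ x
  induction b using Real.Angle.induction_on with | _ y
  rw [← Real.Angle.coe_sub, Real.Angle.norm_coe, Real.Angle.cos_coe, Real.Angle.cos_coe]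
  set n := round ((2 * Real.pi)⁻¹ * (x - y))
  rw [← Real.cos_sub_int_mul_two_pi x n]
  convert Real.abs_cos_sub_cos_le _ _ using 2
  ring

lemma Real.Angle.lipschitzWith_coe_pi {ι : Type*} [Fintype ι] :
    LipschitzWith 1 fun (x : ι → ℝ) i => (x i : Real.Angle) := by
  refine LipschitzWith.of_dist_le_mul fun x y => ?_
  rw [NNReal.coe_one, one_mul]
  refine (dist_pi_le_iff dist_nonneg).2 fun i => ?_
  rw [dist_eq_norm, ← Real.Angle.coe_sub]
  exact (Real.Angle.norm_coe_le _).trans ((Real.dist_eq _ _).symm.le.trans (dist_le_pi_dist x y i))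

/-- A set on which a real-valued function is antilipschitz has dimension at most one. -/
lemma dimH_le_one_of_antilipschitz {E : Type*} [MetricSpace E] {S : Set E} (f : E → ℝ) {K : ℝ}
    (hf : ∀ x ∈ S, ∀ y ∈ S, dist x y ≤ K * dist (f x) (f y)) : dimH S ≤ 1 := by
  have h1 : AntilipschitzWith K.toNNReal fun x : S => f x :=
    AntilipschitzWith.of_le_mul_dist fun x y =>
      (hf x x.2 y y.2).trans (mul_le_mul_of_nonneg_right (Real.le_coe_toNNReal K) dist_nonneg)
  have h2 : dimH S = dimH (univ : Set S) := by
    rw [← (isometry_subtype_coe (s := S)).dimH_image, image_univ, Subtype.range_coe]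
  rw [h2]
  calc dimH (univ : Set S) ≤ dimH ((fun x : S => f x) '' univ) := h1.le_dimH_image _
    _ ≤ dimH (univ : Set ℝ) := dimH_mono (subset_univ _)
    _ = 1 := Real.dimH_univ

/-- A set has dimension at least one if it contains a continuous path along which the cosine of some
coordinate fills an interval. -/
lemma one_le_dimH_of_path {μ U : Set (Fin 3 → Real.Angle)} (γ : ℝ → Fin 3 → Real.Angle) (i : Fin 3)
    {α β y₀ : ℝ} (hαβ : α < β) (hy₀ : y₀ ∈ Icc α β)
    (hγ : ContinuousWithinAt γ (Icc α β) y₀) (hμ : ∀ᶠ y in nhdsWithin y₀ (Icc α β), γ y ∈ μ)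
    (hcos : ∀ᶠ y in nhdsWithin y₀ (Icc α β), (γ y i).cos = y) (hU : U ∈ nhds (γ y₀)) :
    1 ≤ dimH (μ ∩ U) := by
  have hW := hμ.and (hcos.and (hγ hU))
  obtain ⟨ε, hε, hsub⟩ := Metric.mem_nhdsWithin_iff.1 hW
  have hne : (interior (Metric.ball y₀ ε ∩ Icc α β)).Nonempty := by
    rw [interior_inter, interior_Icc, Metric.isOpen_ball.interior_eq]
    have : y₀ ∈ closure (Ioo α β) := by rwa [closure_Ioo hαβ.ne]
    exact mem_closure_iff_nhds.1 this _ (Metric.ball_mem_nhds y₀ hε)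
  have h1 : dimH (Metric.ball y₀ ε ∩ Icc α β) = 1 := by
    rw [Real.dimH_of_nonempty_interior hne]; simp
  have hlip : LipschitzWith 1 fun k : Fin 3 → Real.Angle => (k i).cos := by
    have := Real.Angle.lipschitzWith_cos.comp (LipschitzWith.eval (α := fun _ => Real.Angle) i)
    rwa [one_mul] at this
  rw [← h1]
  refine (dimH_mono ?_).trans (hlip.dimH_image_le (μ ∩ U))
  intro y hy
  obtain ⟨h1, h2, h3⟩ := hsub hy
  exact ⟨γ y, ⟨h1, h3⟩, h2⟩

/-! ### The configuration space of a planar quadrangle -/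

/-- The directions, relative to the last side, of the first three sides of the closed planar
quadrangles with side lengths `q`. -/
def quadrangles (q : Fin 4 → ℝ) : Set (Fin 3 → Real.Angle) :=
  {k | q 0 * ((k 0).toCircle : ℂ) + q 1 * (k 1).toCircle + q 2 * (k 2).toCircle + q 3 = 0}

lemma isTorusAlgebraic_quadrangles (q : Fin 4 → ℝ) : IsTorusAlgebraic (quadrangles q) := by
  let Q : (Fin 3 → Fin 3 ⊕ Fin 3) → ℝ → MvPolynomial (Fin 3 ⊕ Fin 3) ℝ := fun f c =>
    MvPolynomial.C (q 0) * MvPolynomial.X (f 0) + MvPolynomial.C (q 1) * MvPolynomial.X (f 1) +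
      MvPolynomial.C (q 2) * MvPolynomial.X (f 2) + MvPolynomial.C c
  refine ⟨{Q Sum.inl (q 3), Q Sum.inr 0}, ?_⟩
  ext k
  simp only [quadrangles, mem_ofPred_eq, mem_insert_iff, mem_singleton_iff, forall_eq_or_imp,
    forall_eq, Q, map_add, map_mul, MvPolynomial.eval_C, MvPolynomial.eval_X, Sum.elim_inl,
    Sum.elim_inr, Complex.ext_iff, Real.Angle.coe_toCircle]
  simp

lemma Fin.sum_eq_of_distinct {M : Type*} [AddCommMonoid M] {i j m : Fin 3} (hij : i ≠ j)
    (him : i ≠ m) (hjm : j ≠ m) (f : Fin 3 → M) : ∑ a, f a = f i + f j + f m := by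
  have : (Finset.univ : Finset (Fin 3)) = {i, j, m} := by
    revert i j m; decide
  rw [this, Finset.sum_insert (by simp [hij, him]), Finset.sum_pair hjm, add_assoc]

/-- A map whose strict derivative at `x` is injective is antilipschitz near `x`. -/
lemma HasStrictFDerivAt.exists_nhds_dist_le {E F : Type*} [NormedAddCommGroup E] [NormedSpace ℝ E]
    [FiniteDimensional ℝ E] [NormedAddCommGroup F] [NormedSpace ℝ F] {G : E → F} {G' : E →L[ℝ] F}
    {x : E} (hG : HasStrictFDerivAt G G' x) (hker : ∀ v, G' v = 0 → v = 0) :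
    ∃ V ∈ nhds x, ∃ K : ℝ, ∀ y ∈ V, ∀ z ∈ V, dist y z ≤ K * dist (G y) (G z) := by
  obtain ⟨K, hK, hanti⟩ := G'.toLinearMap.exists_antilipschitzWith (LinearMap.ker_eq_bot'.2 hker)
  have hlin : ∀ v, ‖v‖ ≤ K * ‖G' v‖ := fun v => by
    simpa using hanti.le_mul_dist v 0
  have hK' : 0 < (K : ℝ) := hK
  have hev := hG.isLittleO.def (c := (2 * K : ℝ)⁻¹) (by positivity)
  rw [nhds_prod_eq] at hev
  obtain ⟨V, hV, hVV⟩ := Filter.mem_prod_self_iff.1 hev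
  refine ⟨V, hV, 2 * K, fun y hy z hz => ?_⟩
  have h1 : ‖G y - G z - G' (y - z)‖ ≤ (2 * K : ℝ)⁻¹ * ‖y - z‖ := hVV (mk_mem_prod hy hz)
  have h4 : ‖G' (y - z)‖ ≤ ‖G y - G z‖ + (2 * K : ℝ)⁻¹ * ‖y - z‖ := by
    calc ‖G' (y - z)‖ = ‖(G y - G z) - (G y - G z - G' (y - z))‖ := by congr 1; abel
      _ ≤ ‖G y - G z‖ + ‖G y - G z - G' (y - z)‖ := norm_sub_le _ _
      _ ≤ _ := by gcongr
  have h5 : ‖y - z‖ ≤ K * (‖G y - G z‖ + (2 * K : ℝ)⁻¹ * ‖y - z‖) :=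
    (hlin (y - z)).trans (by gcongr)
  have h6 : K * (‖G y - G z‖ + (2 * K : ℝ)⁻¹ * ‖y - z‖)
      = K * ‖G y - G z‖ + ‖y - z‖ / 2 := by field_simp
  rw [h6] at h5
  rw [dist_eq_norm, dist_eq_norm]
  linarith

/-- Two sides of a quadrangle that are not parallel are linearly independent. -/
lemma eq_zero_of_sum_eq_zero {q : Fin 4 → ℝ} (hq : ∀ j, 0 < q j) {x v : Fin 3 → ℝ}
    {i j m : Fin 3} (hij : i ≠ j) (him : i ≠ m) (hjm : j ≠ m) (hx : Real.sin (x i - x j) ≠ 0)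
    (hv : ∑ a : Fin 3, (q a.castSucc : ℂ) *
      (Complex.exp (x a * Complex.I) * (v a * Complex.I)) = 0) (hm : v m = 0) : v = 0 := by
  rw [Fin.sum_eq_of_distinct hij him hjm, hm, Complex.ofReal_zero] at hv
  have hE : Complex.exp (x j * Complex.I) ≠ 0 := Complex.exp_ne_zero _
  have hsum : Complex.exp (x i * Complex.I)
      = Complex.exp ((x i - x j : ℝ) * Complex.I) * Complex.exp (x j * Complex.I) := by
    rw [← Complex.exp_add]; push_cast; ring_nf
  have hv3 : (q i.castSucc : ℂ) * v i * Complex.exp ((x i - x j : ℝ) * Complex.I)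
      + q j.castSucc * v j = 0 := by
    refine mul_right_cancel₀ (mul_ne_zero hE Complex.I_ne_zero) ?_
    rw [hsum] at hv
    linear_combination hv
  have him' := congrArg Complex.im hv3
  have hre' := congrArg Complex.re hv3
  rw [← Complex.ofReal_mul, ← Complex.ofReal_mul, Complex.add_im, Complex.im_ofReal_mul,
    Complex.exp_ofReal_mul_I_im, Complex.ofReal_im, add_zero, Complex.zero_im] at him'
  rw [← Complex.ofReal_mul, ← Complex.ofReal_mul, Complex.add_re, Complex.re_ofReal_mul,
    Complex.exp_ofReal_mul_I_re, Complex.ofReal_re, Complex.zero_re] at hre'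
  have hvi : v i = 0 := by
    simpa [hx, (hq i.castSucc).ne'] using him'
  have hvj : v j = 0 := by
    simpa [hvi, (hq j.castSucc).ne'] using hre'
  ext a
  have ha : ∀ i j m a : Fin 3, i ≠ j → i ≠ m → j ≠ m → a = i ∨ a = j ∨ a = m := by decide
  rcases ha i j m a hij him hjm with rfl | rfl | rfl <;> simp [hvi, hvj, hm]

/-- Near a quadrangle that is not contained in a line, the configuration space is parametrized, with
a Lipschitz inverse, by one of the angles. -/
lemma exists_nhds_dimH_le_one {q : Fin 4 → ℝ} (hq : ∀ j, 0 < q j) {x : Fin 3 → ℝ} {i j m : Fin 3}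
    (hij : i ≠ j) (him : i ≠ m) (hjm : j ≠ m) (hx : Real.sin (x i - x j) ≠ 0) :
    ∃ V ∈ nhds x, dimH ({y : Fin 3 → ℝ | (fun a => (y a : Real.Angle)) ∈ quadrangles q} ∩ V) ≤ 1 := by
  let G : (Fin 3 → ℝ) → ℂ × ℝ := fun y =>
    (∑ a : Fin 3, (q a.castSucc : ℂ) * Complex.exp (y a * Complex.I), y m)
  let p : Fin 3 → ((Fin 3 → ℝ) →L[ℝ] ℝ) := fun a =>
    ContinuousLinearMap.proj (R := ℝ) (φ := fun _ : Fin 3 => ℝ) a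
  have hG1 : HasStrictFDerivAt
      (fun y : Fin 3 → ℝ => ∑ a : Fin 3, (q a.castSucc : ℂ) * Complex.exp (y a * Complex.I))
      (∑ a : Fin 3, (q a.castSucc : ℂ) • (Complex.exp (x a * Complex.I) •
        (Complex.ofRealCLM.comp (p a)).smulRight Complex.I)) x := by
    refine HasStrictFDerivAt.fun_sum fun a _ => HasStrictFDerivAt.const_mul ?_ _
    exact HasStrictFDerivAt.cexp
      ((Complex.ofRealCLM.comp (p a)).smulRight Complex.I).hasStrictFDerivAt
  have hG : HasStrictFDerivAt G _ x := hG1.prodMk (p m).hasStrictFDerivAt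
  obtain ⟨V, hV, K, hK⟩ := hG.exists_nhds_dist_le fun v hv => by
    refine eq_zero_of_sum_eq_zero hq hij him hjm hx ?_ (congrArg Prod.snd hv)
    have := congrArg Prod.fst hv
    simpa [p] using this
  have hclosed : ∀ w : Fin 3 → ℝ, (fun a => (w a : Real.Angle)) ∈ quadrangles q →
      (G w).1 = -q 3 := fun w hw => by
    have : _ = _ := hw
    simp only [Real.Angle.toCircle_coe, Circle.coe_exp] at this
    simp only [G, Fin.sum_univ_three]
    exact eq_neg_of_add_eq_zero_left this
  refine ⟨V, hV, dimH_le_one_of_antilipschitz (fun y => y m) (K := K) ?_⟩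
  rintro y ⟨hy, hyV⟩ z ⟨hz, hzV⟩
  have h2 : dist (G y) (G z) = dist (y m) (z m) := by
    rw [Prod.dist_eq, hclosed y hy, hclosed z hz, dist_self, max_eq_right dist_nonneg]
  exact h2 ▸ hK y hyV z hzV

lemma dimH_quadrangles_le {q : Fin 4 → ℝ} (hq : ∀ j, 0 < q j) : dimH (quadrangles q) ≤ 1 := by
  let S : Set (Fin 3 → ℝ) := {y | (fun a => (y a : Real.Angle)) ∈ quadrangles q}
  -- the quadrangles contained in a line are isolated exceptions
  let D : Set (Fin 3 → ℝ) := {y | ∀ i, Real.sin (y i) = 0}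
  have hD : D.Countable := by
    refine (countable_range fun (n : Fin 3 → ℤ) i => (n i : ℝ) * Real.pi).mono fun y hy => ?_
    choose n hn using fun i => Real.sin_eq_zero_iff.1 (hy i)
    exact ⟨n, funext hn⟩
  have hlift : quadrangles q = (fun (x : Fin 3 → ℝ) i => (x i : Real.Angle)) '' S := by
    ext k
    constructor
    · intro hk
      refine ⟨fun i => (k i).toReal, ?_, ?_⟩ <;> simp [S, hk]
    · rintro ⟨x, hx, rfl⟩
      exact hx
  have hS : dimH (S \ D) ≤ 1 := by
    by_contra! hlt
    obtain ⟨x, ⟨hxS, hxD⟩, hx⟩ := exists_mem_nhdsWithin_lt_dimH_of_lt_dimH hlt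
    have key : ∃ i j m : Fin 3, i ≠ j ∧ i ≠ m ∧ j ≠ m ∧ Real.sin (x i - x j) ≠ 0 := by
      by_contra! hall
      have h01 := hall 0 1 2 (by decide) (by decide) (by decide)
      have h02 := hall 0 2 1 (by decide) (by decide) (by decide)
      have h12 := hall 1 2 0 (by decide) (by decide) (by decide)
      -- all sides are parallel, and their sum is real
      have him := congrArg Complex.im (show _ = _ from hxS)
      simp only [Real.Angle.toCircle_coe, Circle.coe_exp, Complex.add_im, Complex.im_ofReal_mul,
        Complex.exp_ofReal_mul_I_im, Complex.ofReal_im, add_zero, Complex.zero_im] at him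
      have hre := congrArg Complex.re (show _ = _ from hxS)
      simp only [Real.Angle.toCircle_coe, Circle.coe_exp, Complex.add_re, Complex.re_ofReal_mul,
        Complex.exp_ofReal_mul_I_re, Complex.ofReal_re, Complex.zero_re] at hre
      rw [Real.sin_sub] at h01 h02 h12
      have hq3 := (hq 3).ne'
      refine hxD fun i => ?_
      refine (mul_eq_zero.1 (?_ : q 3 * Real.sin (x i) = 0)).resolve_left hq3
      fin_cases i
      · change q 3 * Real.sin (x 0) = 0
        linear_combination Real.sin (x 0) * hre - Real.cos (x 0) * him - q 1 * h01 - q 2 * h02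
      · change q 3 * Real.sin (x 1) = 0
        linear_combination Real.sin (x 1) * hre - Real.cos (x 1) * him + q 0 * h01 - q 2 * h12
      · change q 3 * Real.sin (x 2) = 0
        linear_combination Real.sin (x 2) * hre - Real.cos (x 2) * him + q 0 * h02 + q 1 * h12
    obtain ⟨i, j, m, hij, him, hjm, hsin⟩ := key
    obtain ⟨V, hV, hdim⟩ := exists_nhds_dimH_le_one hq hij him hjm hsin
    refine absurd (hx ((S \ D) ∩ V) ?_) (not_lt.2 ((dimH_mono ?_).trans hdim))
    · exact Filter.inter_mem self_mem_nhdsWithin (mem_nhdsWithin_of_mem_nhds hV)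
    · exact inter_subset_inter_left _ sdiff_subset
  calc dimH (quadrangles q) ≤ dimH S := by
        rw [hlift]
        exact Real.Angle.lipschitzWith_coe_pi.dimH_image_le S
    _ ≤ dimH (S \ D ∪ D) := dimH_mono (by rw [sdiff_union_self]; exact subset_union_left)
    _ ≤ 1 := by
        rw [dimH_union, dimH_countable hD]
        exact max_le hS zero_le_one

/-! ### The configuration space is a curve -/

lemma coe_toCircle_coe_arg {w : ℂ} (hw : Complex.normSq w = 1) :
    (((w.arg : Real.Angle).toCircle : Circle) : ℂ) = w := by
  have h1 : ‖w‖ = 1 := by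
    rw [Complex.norm_def, hw, Real.sqrt_one]
  have h2 := Complex.norm_mul_exp_arg_mul_I w
  rw [h1, Complex.ofReal_one, one_mul] at h2
  rw [Real.Angle.toCircle_coe, Circle.coe_exp, h2]

lemma normSq_coe_toCircle (θ : Real.Angle) : Complex.normSq (θ.toCircle : ℂ) = 1 :=
  Circle.normSq_coe _

/-- The unit vector with real part `y`, in the half plane given by the sign `τ`. -/
noncomputable def unitDir (τ y : ℝ) : ℂ := ⟨y, τ * √(1 - y ^ 2)⟩

lemma continuous_unitDir (τ : ℝ) : Continuous (unitDir τ) := by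
  have : unitDir τ = fun y : ℝ => (y : ℂ) + ((τ * √(1 - y ^ 2) : ℝ) : ℂ) * Complex.I := by
    ext y
    exact Complex.mk_eq_add_mul_I _ _
  rw [this]
  fun_prop

lemma normSq_unitDir {τ y : ℝ} (hτ : τ ^ 2 = 1) (hy : y ^ 2 ≤ 1) :
    Complex.normSq (unitDir τ y) = 1 := by
  rw [Complex.normSq_apply]
  have := Real.sq_sqrt (sub_nonneg.2 hy)
  simp only [unitDir]
  linear_combination τ ^ 2 * this + (1 - y ^ 2) * hτ

lemma exists_eq_unitDir (w : ℂ) (hw : Complex.normSq w = 1) :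
    ∃ τ : ℝ, τ ^ 2 = 1 ∧ w = unitDir τ w.re := by
  rw [Complex.normSq_apply] at hw
  have h1 : 1 - w.re ^ 2 = w.im ^ 2 := by linear_combination -hw
  rcases le_total 0 w.im with h | h
  · refine ⟨1, by norm_num, Complex.ext rfl ?_⟩
    simp only [unitDir, h1, Real.sqrt_sq h, one_mul]
  · refine ⟨-1, by norm_num, Complex.ext rfl ?_⟩
    simp only [unitDir, h1, Real.sqrt_sq_eq_abs, abs_of_nonpos h]
    ring

/-- A triangle with sides `z`, `p w`, `q w'`, with `w`, `w'` of length one, closes up for `w` equal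
to this vector; the sign `σ` chooses between the two mirror images. -/
noncomputable def triangleDir (p q σ : ℝ) (z : ℂ) : ℂ :=
  -z * (((p ^ 2 + Complex.normSq z - q ^ 2) / (2 * p) : ℝ) + (σ *
    √(Complex.normSq z - ((p ^ 2 + Complex.normSq z - q ^ 2) / (2 * p)) ^ 2) : ℝ) * Complex.I) /
      (Complex.normSq z : ℂ)

lemma continuousAt_triangleDir (p q σ : ℝ) {z : ℂ} (hz : z ≠ 0) :
    ContinuousAt (triangleDir p q σ) z := by
  have h0 : (Complex.normSq z : ℂ) ≠ 0 := mod_cast (Complex.normSq_pos.2 hz).ne'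
  have h1 : Continuous fun z : ℂ => Complex.normSq z := Complex.continuous_normSq
  unfold triangleDir
  refine ContinuousAt.div ?_ (Complex.continuous_ofReal.comp h1).continuousAt h0
  fun_prop

/-- Heron's formula: sixteen times the squared area of a triangle. -/
lemma heron {p q R : ℝ} (hp : 0 < p) (h1 : (p - q) ^ 2 ≤ R) (h2 : R ≤ (p + q) ^ 2) :
    0 ≤ R - ((p ^ 2 + R - q ^ 2) / (2 * p)) ^ 2 := by
  have : R - ((p ^ 2 + R - q ^ 2) / (2 * p)) ^ 2
      = ((p + q) ^ 2 - R) * (R - (p - q) ^ 2) / (2 * p) ^ 2 := by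
    field_simp
    ring
  rw [this]
  exact div_nonneg (mul_nonneg (sub_nonneg.2 h2) (sub_nonneg.2 h1)) (sq_nonneg _)

lemma normSq_triangleDir {p q σ : ℝ} {z : ℂ} (hp : 0 < p) (hσ : σ ^ 2 = 1) (hz : z ≠ 0)
    (h1 : (p - q) ^ 2 ≤ Complex.normSq z) (h2 : Complex.normSq z ≤ (p + q) ^ 2) :
    Complex.normSq (triangleDir p q σ z) = 1 ∧
      Complex.normSq (z + p * triangleDir p q σ z) = q ^ 2 := by
  have hh := Real.sq_sqrt (heron hp h1 h2)
  have hR := Complex.normSq_pos.2 hz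
  have hRdef := Complex.normSq_apply z
  unfold triangleDir
  set R := Complex.normSq z
  set S := √(R - ((p ^ 2 + R - q ^ 2) / (2 * p)) ^ 2)
  set T := (p ^ 2 + R - q ^ 2) / (2 * p) with hT
  have hT' : 2 * p * T = p ^ 2 + R - q ^ 2 := by rw [hT]; field_simp
  have e1 : Complex.normSq ((T : ℂ) + (σ * S : ℝ) * Complex.I) = R := by
    rw [Complex.normSq_add_mul_I, mul_pow, hσ, hh]; ring
  constructor
  · rw [Complex.normSq_div, Complex.normSq_mul, Complex.normSq_neg, e1, Complex.normSq_ofReal]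
    field_simp
    rfl
  · have hR' : (R : ℂ) ≠ 0 := mod_cast hR.ne'
    have e2 : z + p * (-z * ((T : ℂ) + (σ * S : ℝ) * Complex.I) / R)
        = z * ((1 - p * T / R : ℝ) + (-(p * σ * S / R) : ℝ) * Complex.I) := by
      push_cast
      field_simp
      ring
    rw [e2, Complex.normSq_mul, Complex.normSq_add_mul_I]
    change R * _ = _
    have e3 : R * ((1 - p * T / R) ^ 2 + (-(p * σ * S / R)) ^ 2)
        = ((R - p * T) ^ 2 + p ^ 2 * σ ^ 2 * S ^ 2) / R := by
      field_simp
    rw [e3, hσ, hh, div_eq_iff hR.ne']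
    linear_combination -R * hT'

lemma exists_eq_triangleDir {p q : ℝ} {z w : ℂ} (hp : 0 < p) (hz : z ≠ 0)
    (hw : Complex.normSq w = 1) (hzw : Complex.normSq (z + p * w) = q ^ 2) :
    ∃ σ : ℝ, σ ^ 2 = 1 ∧ w = triangleDir p q σ z := by
  have hR := Complex.normSq_pos.2 hz
  have hR' : (Complex.normSq z : ℂ) ≠ 0 := mod_cast hR.ne'
  obtain ⟨v, hv⟩ : ∃ v, v = -((starRingEnd ℂ) z * w) := ⟨_, rfl⟩
  have hwv : w = -z * v / Complex.normSq z := by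
    rw [hv, eq_div_iff hR', ← Complex.mul_conj]; ring
  have h1 : v.re = (p ^ 2 + Complex.normSq z - q ^ 2) / (2 * p) := by
    rw [eq_div_iff (by positivity), ← hzw, hv]
    rw [Complex.normSq_apply] at hw
    rw [Complex.normSq_apply, Complex.normSq_apply, Complex.add_re, Complex.add_im,
      Complex.re_ofReal_mul, Complex.im_ofReal_mul, Complex.neg_re, Complex.mul_re, Complex.conj_re,
      Complex.conj_im]
    linear_combination p ^ 2 * hw
  have h2 : v.re ^ 2 + v.im ^ 2 = Complex.normSq z := by
    have : Complex.normSq v = Complex.normSq z := by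
      rw [hv, Complex.normSq_neg, Complex.normSq_mul, hw, Complex.normSq_conj, mul_one]
    rw [← this, Complex.normSq_apply]; ring
  have h3 : Complex.normSq z - v.re ^ 2 = v.im ^ 2 := by linarith
  have key : ∀ σ : ℝ, v.im = σ * √(v.im ^ 2) → w = triangleDir p q σ z := fun σ h => by
    rw [triangleDir, ← h1, h3, ← h, Complex.re_add_im, ← hwv]
  rcases le_total 0 v.im with h | h
  · exact ⟨1, by norm_num, key 1 (by rw [Real.sqrt_sq h, one_mul])⟩
  · exact ⟨-1, by norm_num, key (-1) (by rw [Real.sqrt_sq_eq_abs, abs_of_nonpos h]; ring)⟩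

/-- The values of the cosine of the angle between the last two sides of a quadrangle: the diagonal
has to form triangles with both pairs of sides. Such values fill a nondegenerate interval if no side
is as long as the other three together. -/
lemma exists_Icc_cos {q : Fin 4 → ℝ} (hq : ∀ j, 0 < q j) (hlt : ∀ j, 2 * q j < ∑ i, q i) :
    ∃ α β : ℝ, α < β ∧ ∀ y, y ∈ Icc α β ↔ (-1 ≤ y ∧ y ≤ 1) ∧
      (q 0 - q 1) ^ 2 ≤ q 3 ^ 2 + q 2 ^ 2 + 2 * q 2 * q 3 * y ∧
      q 3 ^ 2 + q 2 ^ 2 + 2 * q 2 * q 3 * y ≤ (q 0 + q 1) ^ 2 := by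
  have h0 := hlt 0
  have h1 := hlt 1
  have h2 := hlt 2
  have h3 := hlt 3
  rw [Fin.sum_univ_four] at h0 h1 h2 h3
  have q0 := hq 0
  have q1 := hq 1
  have q2 := hq 2
  have q3 := hq 3
  have hd : 0 < 2 * q 2 * q 3 := by positivity
  refine ⟨max (-1) (((q 0 - q 1) ^ 2 - q 3 ^ 2 - q 2 ^ 2) / (2 * q 2 * q 3)),
    min 1 (((q 0 + q 1) ^ 2 - q 3 ^ 2 - q 2 ^ 2) / (2 * q 2 * q 3)), ?_, fun y => ?_⟩
  · rw [max_lt_iff, lt_min_iff, lt_min_iff, lt_div_iff₀ hd, div_lt_iff₀ hd,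
      div_lt_div_iff_of_pos_right hd]
    refine ⟨⟨by norm_num, by nlinarith⟩, by nlinarith, by nlinarith⟩
  · rw [mem_Icc, max_le_iff, le_min_iff, div_le_iff₀ hd, le_div_iff₀ hd]
    constructor
    · rintro ⟨⟨a, b⟩, c, d⟩
      exact ⟨⟨a, c⟩, by linarith, by linarith⟩
    · rintro ⟨⟨a, c⟩, b, d⟩
      exact ⟨⟨a, by linarith⟩, c, by linarith⟩

/-- The quadrangle, up to reflection, for which the last two sides form an angle with cosine `y`:
the diagonal that separates these two sides from the other two cuts the quadrangle into two
triangles, whose orientations are given by the signs `τ` and `σ`. -/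
noncomputable def quadranglePath (q : Fin 4 → ℝ) (τ σ y : ℝ) : Fin 3 → Real.Angle :=
  let z := (q 3 : ℂ) + q 2 * unitDir τ y
  let w := triangleDir (q 0) (q 1) σ z
  ![(w.arg : Real.Angle), (((-(z + q 0 * w)) / q 1 : ℂ).arg : Real.Angle),
    ((unitDir τ y).arg : Real.Angle)]

lemma normSq_diagonal {q : Fin 4 → ℝ} {w : ℂ} (hw : Complex.normSq w = 1) :
    Complex.normSq (q 3 + q 2 * w) = q 3 ^ 2 + q 2 ^ 2 + 2 * q 2 * q 3 * w.re := by
  rw [Complex.normSq_apply] at hw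
  simp only [Complex.normSq_apply, Complex.add_re, Complex.add_im, Complex.re_ofReal_mul,
      Complex.im_ofReal_mul, Complex.ofReal_re, Complex.ofReal_im]
  linear_combination q 2 ^ 2 * hw

lemma quadranglePath_mem {q : Fin 4 → ℝ} (hq : ∀ j, 0 < q j) {τ σ y : ℝ} (hτ : τ ^ 2 = 1)
    (hσ : σ ^ 2 = 1) (hy : -1 ≤ y ∧ y ≤ 1)
    (h1 : (q 0 - q 1) ^ 2 ≤ q 3 ^ 2 + q 2 ^ 2 + 2 * q 2 * q 3 * y)
    (h2 : q 3 ^ 2 + q 2 ^ 2 + 2 * q 2 * q 3 * y ≤ (q 0 + q 1) ^ 2)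
    (hz : (q 3 : ℂ) + q 2 * unitDir τ y ≠ 0) :
    quadranglePath q τ σ y ∈ quadrangles q ∧ (quadranglePath q τ σ y 2).cos = y := by
  have hu := normSq_unitDir hτ (sq_le_one_iff_abs_le_one y |>.2 (abs_le.2 hy))
  have hR : Complex.normSq ((q 3 : ℂ) + q 2 * unitDir τ y)
      = q 3 ^ 2 + q 2 ^ 2 + 2 * q 2 * q 3 * y := normSq_diagonal hu
  rw [← hR] at h1 h2
  obtain ⟨hw, hzw⟩ := normSq_triangleDir (hq 0) hσ hz h1 h2
  have q1 : (q 1 : ℂ) ≠ 0 := mod_cast (hq 1).ne'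
  have hw' : Complex.normSq (-(q 3 + q 2 * unitDir τ y + q 0 *
      triangleDir (q 0) (q 1) σ (q 3 + q 2 * unitDir τ y)) / q 1 : ℂ) = 1 := by
    have := (hq 1).ne'
    rw [Complex.normSq_div, Complex.normSq_neg, hzw, Complex.normSq_ofReal]
    field_simp
  constructor
  · change _ * (((Complex.arg _ : Real.Angle).toCircle : Circle) : ℂ) +
      _ * (((Complex.arg _ : Real.Angle).toCircle : Circle) : ℂ) +
      _ * (((Complex.arg _ : Real.Angle).toCircle : Circle) : ℂ) + _ = _
    rw [coe_toCircle_coe_arg hw, coe_toCircle_coe_arg hw', coe_toCircle_coe_arg hu]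
    field_simp
    ring
  · change (Complex.arg (unitDir τ y) : Real.Angle).cos = y
    rw [Real.Angle.cos_coe, Complex.cos_arg (by rintro h; simp [h] at hu), Complex.norm_def, hu]
    simp [unitDir]

lemma continuousAt_quadranglePath {q : Fin 4 → ℝ} {τ σ y : ℝ}
    (hw1 : unitDir τ y ≠ 0) (hz : (q 3 : ℂ) + q 2 * unitDir τ y ≠ 0)
    (hw2 : triangleDir (q 0) (q 1) σ (q 3 + q 2 * unitDir τ y) ≠ 0)
    (hw3 : (-(q 3 + q 2 * unitDir τ y + q 0 *
      triangleDir (q 0) (q 1) σ (q 3 + q 2 * unitDir τ y)) / q 1 : ℂ) ≠ 0) :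
    ContinuousAt (quadranglePath q τ σ) y := by
  have c0 := (continuous_unitDir τ).continuousAt (x := y)
  have c1 : ContinuousAt (fun y => (q 3 : ℂ) + q 2 * unitDir τ y) y :=
    continuousAt_const.add (continuousAt_const.mul c0)
  have c2 : ContinuousAt (fun y => triangleDir (q 0) (q 1) σ (q 3 + q 2 * unitDir τ y)) y :=
    ContinuousAt.comp (f := fun y => (q 3 : ℂ) + q 2 * unitDir τ y)
      (continuousAt_triangleDir (q 0) (q 1) σ hz) c1
  have c3 : ContinuousAt (fun y => (-(q 3 + q 2 * unitDir τ y + q 0 *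
      triangleDir (q 0) (q 1) σ (q 3 + q 2 * unitDir τ y)) / q 1 : ℂ)) y :=
    (c1.add (continuousAt_const.mul c2)).neg.div_const (q 1 : ℂ)
  rw [continuousAt_pi]
  intro i
  fin_cases i
  · exact ContinuousAt.comp (g := fun w : ℂ => (w.arg : Real.Angle))
      (Complex.continuousAt_arg_coe_angle hw2) c2
  · exact ContinuousAt.comp (g := fun w : ℂ => (w.arg : Real.Angle))
      (Complex.continuousAt_arg_coe_angle hw3) c3
  · exact ContinuousAt.comp (g := fun w : ℂ => (w.arg : Real.Angle))
      (Complex.continuousAt_arg_coe_angle hw1) c0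

lemma ne_zero_of_normSq_eq_one {w : ℂ} (hw : Complex.normSq w = 1) : w ≠ 0 := by
  rintro rfl
  simp at hw

/-- The configuration space of the quadrangles has dimension at least one at each of its points. -/
lemma one_le_dimH_quadrangles {q : Fin 4 → ℝ} (hq : ∀ j, 0 < q j) (hlt : ∀ j, 2 * q j < ∑ i, q i)
    {k : Fin 3 → Real.Angle} (hk : k ∈ quadrangles q) {U : Set (Fin 3 → Real.Angle)}
    (hU : U ∈ nhds k) : 1 ≤ dimH (quadrangles q ∩ U) := by
  have n0 := normSq_coe_toCircle (k 0)
  have n1 := normSq_coe_toCircle (k 1)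
  have n2 := normSq_coe_toCircle (k 2)
  have hk' : _ = _ := hk
  have c1 : (q 1 : ℂ) ≠ 0 := mod_cast (hq 1).ne'
  obtain ⟨τ, hτ, hw⟩ := exists_eq_unitDir _ n2
  by_cases hz : (q 3 : ℂ) + q 2 * (k 2).toCircle = 0
  · -- the two triangles degenerate to segments; rotate the first two sides, which are antiparallel
    obtain ⟨τ', hτ', hw'⟩ := exists_eq_unitDir _ n0
    have e1 : (q 1 : ℂ) * (k 1).toCircle = - (q 0 * (k 0).toCircle) := by
      linear_combination hk' - hz
    have e2 : q 0 = q 1 := by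
      have := congrArg Complex.normSq e1
      rw [Complex.normSq_neg, Complex.normSq_mul, Complex.normSq_mul, n0, n1, Complex.normSq_ofReal,
        Complex.normSq_ofReal] at this
      nlinarith [hq 0, hq 1]
    have e3 : ((k 1).toCircle : ℂ) = - (k 0).toCircle := by
      rw [e2] at e1
      refine mul_left_cancel₀ c1 (e1.trans (by ring))
    let γ : ℝ → Fin 3 → Real.Angle := fun y =>
      ![((unitDir τ' y).arg : Real.Angle), ((-unitDir τ' y).arg : Real.Angle), k 2]
    have hγ0 : γ ((k 0).toCircle : ℂ).re = k := by
      ext i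
      fin_cases i
      · change ((unitDir τ' _).arg : Real.Angle) = k 0
        rw [← hw', Real.Angle.arg_toCircle]
      · change ((-unitDir τ' _).arg : Real.Angle) = k 1
        rw [← hw', ← e3, Real.Angle.arg_toCircle]
      · rfl
    have hne : unitDir τ' ((k 0).toCircle : ℂ).re ≠ 0 := by
      rw [← hw']; exact Circle.coe_ne_zero _
    rw [← hγ0] at hU
    have hev : ∀ᶠ y in nhdsWithin ((k 0).toCircle : ℂ).re (Icc (-1) 1), y ∈ Icc (-1 : ℝ) 1 :=
      self_mem_nhdsWithin
    have hun : ∀ y ∈ Icc (-1 : ℝ) 1, Complex.normSq (unitDir τ' y) = 1 := fun y hy =>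
      normSq_unitDir hτ' (sq_le_one_iff_abs_le_one y |>.2 (abs_le.2 hy))
    refine one_le_dimH_of_path γ 0 (α := -1) (β := 1) (by norm_num) ?_ ?_
      (hev.mono fun y hy => ?_) (hev.mono fun y hy => ?_) hU
    · rw [mem_Icc, ← abs_le, ← sq_le_one_iff_abs_le_one]
      rw [Complex.normSq_apply] at n0
      nlinarith [sq_nonneg ((k 0).toCircle : ℂ).im]
    · refine ContinuousAt.continuousWithinAt ?_
      rw [continuousAt_pi]
      have c0 := (continuous_unitDir τ').continuousAt (x := ((k 0).toCircle : ℂ).re)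
      intro i
      fin_cases i
      · exact ContinuousAt.comp (f := unitDir τ') (g := fun w : ℂ => (w.arg : Real.Angle))
          (Complex.continuousAt_arg_coe_angle hne) c0
      · exact ContinuousAt.comp (f := fun y => -unitDir τ' y)
          (g := fun w : ℂ => (w.arg : Real.Angle))
          (Complex.continuousAt_arg_coe_angle (neg_ne_zero.2 hne)) c0.neg
      · exact continuousAt_const
    · change _ * (((Complex.arg _ : Real.Angle).toCircle : Circle) : ℂ) +
        _ * (((Complex.arg _ : Real.Angle).toCircle : Circle) : ℂ) +
        (q 2 : ℂ) * (k 2).toCircle + q 3 = 0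
      rw [coe_toCircle_coe_arg (hun y hy), coe_toCircle_coe_arg (by
        rw [Complex.normSq_neg, hun y hy]), e2]
      linear_combination hz
    · change (Complex.arg (unitDir τ' y) : Real.Angle).cos = y
      rw [Real.Angle.cos_coe, Complex.cos_arg (ne_zero_of_normSq_eq_one (hun y hy)),
        Complex.norm_def, hun y hy]
      simp [unitDir]
  · have e1 : (q 3 : ℂ) + q 2 * (k 2).toCircle + q 0 * (k 0).toCircle = -(q 1 * (k 1).toCircle) := by
      linear_combination hk'
    obtain ⟨σ, hσ, hw0⟩ := exists_eq_triangleDir (q := q 1) (hq 0) hz n0 (by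
      rw [e1, Complex.normSq_neg, Complex.normSq_mul, n1, Complex.normSq_ofReal]; ring)
    have e2 : (-(q 3 + q 2 * (k 2).toCircle + q 0 * (k 0).toCircle) / q 1 : ℂ) = (k 1).toCircle := by
      rw [e1]; field_simp
    obtain ⟨α, β, hαβ, hiff⟩ := exists_Icc_cos hq hlt
    set y₀ := ((k 2).toCircle : ℂ).re with hy₀
    have hγ0 : quadranglePath q τ σ y₀ = k := by
      ext i
      fin_cases i
      · change ((triangleDir (q 0) (q 1) σ (q 3 + q 2 * unitDir τ y₀)).arg : Real.Angle) = k 0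
        rw [← hw, ← hw0, Real.Angle.arg_toCircle]
      · change ((-(q 3 + q 2 * unitDir τ y₀ + q 0 *
          triangleDir (q 0) (q 1) σ (q 3 + q 2 * unitDir τ y₀)) / q 1 : ℂ).arg : Real.Angle) = k 1
        rw [← hw, ← hw0, e2, Real.Angle.arg_toCircle]
      · change ((unitDir τ y₀).arg : Real.Angle) = k 2
        rw [← hw, Real.Angle.arg_toCircle]
    rw [← hγ0] at hU
    have hz' : (q 3 : ℂ) + q 2 * unitDir τ y₀ ≠ 0 := by rwa [← hw]
    have hopen : ∀ᶠ y in nhds y₀, (q 3 : ℂ) + q 2 * unitDir τ y ≠ 0 := by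
      refine ContinuousAt.eventually_ne ?_ hz'
      exact (continuous_const.add (continuous_const.mul (continuous_unitDir τ))).continuousAt
    have hev : ∀ᶠ y in nhdsWithin y₀ (Icc α β),
        quadranglePath q τ σ y ∈ quadrangles q ∧ (quadranglePath q τ σ y 2).cos = y := by
      filter_upwards [self_mem_nhdsWithin, mem_nhdsWithin_of_mem_nhds hopen] with y hy hyz
      obtain ⟨hy1, hy2, hy3⟩ := (hiff y).1 hy
      exact quadranglePath_mem hq hτ hσ hy1 hy2 hy3 hyz
    refine one_le_dimH_of_path (quadranglePath q τ σ) 2 hαβ ?_ ?_ (hev.mono fun y hy => hy.1)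
      (hev.mono fun y hy => hy.2) hU
    · rw [hiff, ← normSq_diagonal n2, ← abs_le, ← sq_le_one_iff_abs_le_one]
      have hd : (q 3 : ℂ) + q 2 * (k 2).toCircle
        = -(q 0 * (k 0).toCircle + q 1 * (k 1).toCircle) := by linear_combination hk'
      rw [hd, Complex.normSq_neg]
      rw [Complex.normSq_apply] at n0 n1 n2
      simp only [Complex.normSq_apply, Complex.add_re, Complex.add_im, Complex.re_ofReal_mul,
        Complex.im_ofReal_mul]
      have q01 := mul_pos (hq 0) (hq 1)
      refine ⟨by nlinarith [sq_nonneg ((k 2).toCircle : ℂ).im], ?_, ?_⟩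
      · have := mul_nonneg q01.le (add_nonneg
          (sq_nonneg (((k 0).toCircle : ℂ).re + ((k 1).toCircle : ℂ).re))
          (sq_nonneg (((k 0).toCircle : ℂ).im + ((k 1).toCircle : ℂ).im)))
        linear_combination this - (q 0 ^ 2 - q 0 * q 1) * n0 - (q 1 ^ 2 - q 0 * q 1) * n1
      · have := mul_nonneg q01.le (add_nonneg
          (sq_nonneg (((k 0).toCircle : ℂ).re - ((k 1).toCircle : ℂ).re))
          (sq_nonneg (((k 0).toCircle : ℂ).im - ((k 1).toCircle : ℂ).im)))
        linear_combination this + (q 0 ^ 2 + q 0 * q 1) * n0 + (q 1 ^ 2 + q 0 * q 1) * n1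
    · refine (continuousAt_quadranglePath ?_ hz' ?_ ?_).continuousWithinAt
      · rw [← hw]; exact Circle.coe_ne_zero _
      · rw [← hw, ← hw0]; exact Circle.coe_ne_zero _
      · rw [← hw, ← hw0, e2]; exact Circle.coe_ne_zero _

lemma nonempty_quadrangles {q : Fin 4 → ℝ} (hq : ∀ j, 0 < q j) (hlt : ∀ j, 2 * q j < ∑ i, q i) :
    (quadrangles q).Nonempty := by
  obtain ⟨α, β, hαβ, hiff⟩ := exists_Icc_cos hq hlt
  obtain ⟨h1, h2, h3⟩ := (hiff ((α + β) / 2)).1 ⟨by linarith, by linarith⟩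
  obtain ⟨-, h4, -⟩ := (hiff α).1 ⟨le_rfl, hαβ.le⟩
  refine ⟨_, (quadranglePath_mem hq (τ := 1) (σ := 1) (by norm_num) (by norm_num) h1 h2 h3
    fun hz => ?_).1⟩
  have hR := normSq_diagonal (q := q) (normSq_unitDir (τ := 1) (y := (α + β) / 2) (by norm_num)
    (sq_le_one_iff_abs_le_one _ |>.2 (abs_le.2 h1)))
  rw [hz, map_zero] at hR
  change _ = _ + _ * ((α + β) / 2) at hR
  nlinarith [mul_pos (hq 2) (hq 3), sq_nonneg (q 0 - q 1)]

/-- The configuration space of the quadrangles with given side lengths is an algebraic curve, if no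
side is as long as the other three together. -/
lemma isAlgebraicCurve_quadrangles {q : Fin 4 → ℝ} (hq : ∀ j, 0 < q j)
    (hlt : ∀ j, 2 * q j < ∑ i, q i) : IsAlgebraicCurve (quadrangles q) :=
  ⟨isTorusAlgebraic_quadrangles q, nonempty_quadrangles hq hlt, fun _ hk _ hU =>
    le_antisymm ((dimH_mono inter_subset_left).trans (dimH_quadrangles_le hq))
      (one_le_dimH_quadrangles hq hlt hk hU)⟩

lemma fluxSum_eq_zero_iff {Λ : ℝ} {ℓ : Fin 4 → ℝ} {k : Fin 3 → Real.Angle} :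
    fluxSum Λ ℓ k = 0 ↔ k ∈ quadrangles fun j => edgeCsc Λ (ℓ j) := by
  have h0 : voltage (some 0) = Pi.single 0 1 := by decide
  have h1 : voltage (some 1) = Pi.single 1 1 := by decide
  have h2 : voltage (some 2) = Pi.single 2 1 := by decide
  have h3 : voltage (some 3) = 0 := by decide
  rw [fluxSum, Fin.sum_univ_four, h0, h1, h2, h3, floquetChar_single, floquetChar_single,
    floquetChar_single, floquetChar_zero, mul_one]
  rfl

/-! ### The difference equations in `ℓ²(ℤ³)` -/

section Discrete

open scoped InnerProductSpace

local notation "ℓ²" => lp (fun _ : Fin 3 → ℤ => ℂ) 2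

lemma memℓp_two_iff {f : (Fin 3 → ℤ) → ℂ} : Memℓp f 2 ↔ Summable fun n => ‖f n‖ ^ 2 := by
  rw [memℓp_gen_iff (by norm_num)]
  norm_num

lemma lp_two_norm_sq (f : ℓ²) : ‖f‖ ^ 2 = ∑' n, ‖f n‖ ^ 2 := by
  have := lp.norm_rpow_eq_tsum (p := 2) (by norm_num) f
  norm_num at this
  exact this

lemma memℓp_lpTranslate {f : (Fin 3 → ℤ) → ℂ} (hf : Memℓp f 2) (m : Fin 3 → ℤ) :
    Memℓp (fun n => f (n + m)) 2 :=
  memℓp_two_iff.2 ((Equiv.addRight m).summable_iff.2 (memℓp_two_iff.1 hf))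

/-- The translation `a ↦ a (⋅ + m)` of `ℓ²(ℤ³)`. -/
noncomputable def lpTranslate (m : Fin 3 → ℤ) : ℓ² →ₗᵢ[ℂ] ℓ² where
  toFun f := ⟨fun n => f (n + m), memℓp_lpTranslate (lp.memℓp f) m⟩
  map_add' _ _ := rfl
  map_smul' _ _ := rfl
  norm_map' f := by
    refine (sq_eq_sq₀ (norm_nonneg _) (norm_nonneg _)).1 ?_
    rw [lp_two_norm_sq, lp_two_norm_sq]
    exact (Equiv.addRight m).tsum_eq fun n => ‖f n‖ ^ 2

@[simp] lemma lpTranslate_apply (m : Fin 3 → ℤ) (f : ℓ²) (n : Fin 3 → ℤ) :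
    lpTranslate m f n = f (n + m) := rfl

lemma inner_lpTranslate (m : Fin 3 → ℤ) (f g : ℓ²) :
    ⟪lpTranslate m f, g⟫_ℂ = ⟪f, lpTranslate (-m) g⟫_ℂ := by
  rw [lp.inner_eq_tsum, lp.inner_eq_tsum, ← (Equiv.addRight m).tsum_eq fun n => ⟪f n, _⟫_ℂ]
  simp

/-- The operator `a ↦ ∑ⱼ cⱼ a (⋅ + gⱼ)` on `ℓ²(ℤ³)`. -/
noncomputable def hopping (c : Fin 4 → ℝ) (g : Fin 4 → Fin 3 → ℤ) : ℓ² →L[ℂ] ℓ² :=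
  ∑ j, (c j : ℂ) • (lpTranslate (g j)).toContinuousLinearMap

lemma hopping_eq_sum (c : Fin 4 → ℝ) (g : Fin 4 → Fin 3 → ℤ) (f : ℓ²) :
    hopping c g f = ∑ j, (c j : ℂ) • lpTranslate (g j) f := by
  rw [hopping, sum_apply]
  rfl

lemma hopping_apply (c : Fin 4 → ℝ) (g : Fin 4 → Fin 3 → ℤ) (f : ℓ²) (n : Fin 3 → ℤ) :
    hopping c g f n = ∑ j, (c j : ℂ) * f (n + g j) := by
  rw [hopping_eq_sum, lp.coeFn_sum, Finset.sum_apply]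
  rfl

lemma inner_hopping (c : Fin 4 → ℝ) (g : Fin 4 → Fin 3 → ℤ) (x y : ℓ²) :
    ⟪hopping c g x, y⟫_ℂ = ⟪x, hopping c (-g) y⟫_ℂ := by
  rw [hopping_eq_sum, hopping_eq_sum, sum_inner, inner_sum]
  refine Finset.sum_congr rfl fun j _ => ?_
  rw [inner_smul_left, inner_smul_right, Complex.conj_ofReal, inner_lpTranslate]
  rfl

/-- After elimination of the values at the lifts of `B`, the difference equations are governed by
this operator on `ℓ²(ℤ³)`, a positive multiple of the identity plus a positive operator. -/
noncomputable def schur (r t : ℝ) (c : Fin 4 → ℝ) (g : Fin 4 → Fin 3 → ℤ) : ℓ² →L[ℂ] ℓ² :=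
  (r : ℂ) • ContinuousLinearMap.id ℂ ℓ² + (t : ℂ) • (hopping c (-g)).comp (hopping c g)

lemma schur_apply (r t : ℝ) (c : Fin 4 → ℝ) (g : Fin 4 → Fin 3 → ℤ) (x : ℓ²) :
    schur r t c g x = (r : ℂ) • x + (t : ℂ) • hopping c (-g) (hopping c g x) := rfl

variable {r t : ℝ} (hr : 0 < r) (ht : 0 ≤ t) (c : Fin 4 → ℝ) (g : Fin 4 → Fin 3 → ℤ)

include ht in
lemma le_norm_inner_schur (x : ℓ²) : ‖x‖ ^ 2 * r ≤ ‖⟪schur r t c g x, x⟫_ℂ‖ := by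
  have e : ⟪hopping c (-g) (hopping c g x), x⟫_ℂ = ((‖hopping c g x‖ ^ 2 : ℝ) : ℂ) := by
    rw [inner_hopping, neg_neg, inner_self_eq_norm_sq_to_K]
    simp
  have e' : ⟪x, x⟫_ℂ = ((‖x‖ ^ 2 : ℝ) : ℂ) := by
    rw [inner_self_eq_norm_sq_to_K]
    simp
  refine le_trans ?_ (Complex.re_le_norm _)
  rw [schur_apply, inner_add_left, inner_smul_left, inner_smul_left, Complex.conj_ofReal,
    Complex.conj_ofReal, e, e', ← Complex.ofReal_mul, ← Complex.ofReal_mul, ← Complex.ofReal_add,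
    Complex.ofReal_re]
  nlinarith [mul_nonneg ht (sq_nonneg ‖hopping c g x‖)]

include hr ht in
lemma exists_schur_eq (y : ℓ²) : ∃ x, schur r t c g x = y := by
  have := ContinuousLinearMap.isUnit_of_forall_le_norm_inner_map (schur r t c g) (c := ⟨r, hr.le⟩)
    hr (le_norm_inner_schur ht c g)
  exact (ContinuousLinearMap.isUnit_iff_bijective.1 this).2 y

include hr ht in
lemma norm_le_schur (x : ℓ²) : ‖x‖ ≤ r⁻¹ * ‖schur r t c g x‖ := by
  rcases (norm_nonneg x).eq_or_lt with h | h
  · rw [← h]; positivity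
  have h1 := (le_norm_inner_schur ht c g x).trans (norm_inner_le_norm (𝕜 := ℂ) (schur r t c g x) x)
  (conv_rhs at h1 => rw [mul_comm])
  rw [sq, mul_assoc] at h1
  have h2 := le_of_mul_le_mul_left h1 h
  rw [inv_mul_eq_div, le_div_iff₀ hr]
  exact h2

/-- The inhomogeneous difference equations have square summable solutions, with a bound. Here `T`
stands for the coefficient of the four parallel edges and `R` for the one of the tail; for `T < R`
the operator that remains after the elimination of `b` is coercive. -/
lemma exists_discrete_solution {T R : ℝ} (hT : 0 < T) (hTR : T < R) :
    ∃ K : ℝ, 0 ≤ K ∧ ∀ α β : (Fin 3 → ℤ) → ℂ, (Summable fun n => ‖α n‖ ^ 2) →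
      (Summable fun n => ‖β n‖ ^ 2) → ∃ a b : (Fin 3 → ℤ) → ℂ,
      (Summable fun n => ‖a n‖ ^ 2) ∧ (Summable fun n => ‖b n‖ ^ 2) ∧
      (∀ n, T * b n - ∑ j, c j * a (n + g j) = β n) ∧
      (∀ n, (∑ j, c j * b (n - g j)) + (R - T) * a n = α n) ∧
      (∑' n, ‖a n‖ ^ 2) ≤ K * ((∑' n, ‖α n‖ ^ 2) + ∑' n, ‖β n‖ ^ 2) ∧
      (∑' n, ‖b n‖ ^ 2) ≤ K * ((∑' n, ‖α n‖ ^ 2) + ∑' n, ‖β n‖ ^ 2) := by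
  have hr : 0 < R - T := sub_pos.2 hTR
  have ht : 0 ≤ T⁻¹ := (inv_pos.2 hT).le
  have hT' : (T : ℂ) ≠ 0 := mod_cast hT.ne'
  set F := hopping c g with hF
  set F' := hopping c (-g) with hF'
  obtain ⟨K₁, hK₁⟩ : ∃ K, K = (R - T)⁻¹ * (1 + T⁻¹ * ‖F'‖) := ⟨_, rfl⟩
  obtain ⟨K₂, hK₂⟩ : ∃ K, K = T⁻¹ * (1 + ‖F‖ * K₁) := ⟨_, rfl⟩
  have hK₁0 : 0 ≤ K₁ := by rw [hK₁]; positivity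
  have hK₂0 : 0 ≤ K₂ := by rw [hK₂]; positivity
  refine ⟨2 * (K₁ + K₂) ^ 2, by positivity, fun α β hα hβ => ?_⟩
  let x : ℓ² := ⟨α, memℓp_two_iff.2 hα⟩
  let y : ℓ² := ⟨β, memℓp_two_iff.2 hβ⟩
  obtain ⟨a, ha⟩ := exists_schur_eq hr ht c g (x - (T⁻¹ : ℂ) • F' y)
  obtain ⟨b, hb⟩ : ∃ b : ℓ², b = (T⁻¹ : ℂ) • (y + F a) := ⟨_, rfl⟩
  have hTn : ‖(T⁻¹ : ℂ)‖ = T⁻¹ := by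
    rw [← Complex.ofReal_inv, Complex.norm_real, Real.norm_of_nonneg ht]
  have hna : ‖a‖ ≤ K₁ * (‖x‖ + ‖y‖) := by
    calc ‖a‖ ≤ (R - T)⁻¹ * ‖x - (T⁻¹ : ℂ) • F' y‖ := ha ▸ norm_le_schur hr ht c g a
      _ ≤ (R - T)⁻¹ * (‖x‖ + T⁻¹ * (‖F'‖ * ‖y‖)) := by
          have := F'.le_opNorm y
          refine mul_le_mul_of_nonneg_left ((norm_sub_le _ _).trans ?_) (inv_pos.2 hr).le
          rw [norm_smul, hTn]
          gcongr
      _ ≤ (R - T)⁻¹ * ((1 + T⁻¹ * ‖F'‖) * (‖x‖ + ‖y‖)) := by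
          have : 0 ≤ T⁻¹ * ‖F'‖ * ‖x‖ + ‖y‖ := by positivity
          refine mul_le_mul_of_nonneg_left ?_ (inv_pos.2 hr).le
          linarith
      _ = _ := by rw [hK₁]; ring
  have hnb : ‖b‖ ≤ K₂ * (‖x‖ + ‖y‖) := by
    calc ‖b‖ ≤ T⁻¹ * (‖y‖ + ‖F‖ * ‖a‖) := by
          rw [hb, norm_smul, hTn]
          have := F.le_opNorm a
          exact mul_le_mul_of_nonneg_left ((norm_add_le _ _).trans (by gcongr)) ht
      _ ≤ T⁻¹ * ((‖x‖ + ‖y‖) + ‖F‖ * (K₁ * (‖x‖ + ‖y‖))) := by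
          have := norm_nonneg x
          gcongr
          linarith
      _ = _ := by rw [hK₂]; ring
  have hsq : ∀ z : ℓ², ‖z‖ ≤ (K₁ + K₂) * (‖x‖ + ‖y‖) →
      ∑' n, ‖z n‖ ^ 2 ≤ 2 * (K₁ + K₂) ^ 2 * ((∑' n, ‖α n‖ ^ 2) + ∑' n, ‖β n‖ ^ 2) := fun z hz => by
    have e1 : ∑' n, ‖α n‖ ^ 2 = ‖x‖ ^ 2 := (lp_two_norm_sq x).symm
    have e2 : ∑' n, ‖β n‖ ^ 2 = ‖y‖ ^ 2 := (lp_two_norm_sq y).symm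
    rw [← lp_two_norm_sq z, e1, e2]
    calc ‖z‖ ^ 2 ≤ ((K₁ + K₂) * (‖x‖ + ‖y‖)) ^ 2 := by gcongr
      _ = (K₁ + K₂) ^ 2 * (‖x‖ + ‖y‖) ^ 2 := by ring
      _ ≤ (K₁ + K₂) ^ 2 * (2 * (‖x‖ ^ 2 + ‖y‖ ^ 2)) := by
          gcongr; linarith [sq_nonneg (‖x‖ - ‖y‖)]
      _ = _ := by ring
  refine ⟨a, b, memℓp_two_iff.1 (lp.memℓp a), memℓp_two_iff.1 (lp.memℓp b), fun n => ?_,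
    fun n => ?_, hsq a (hna.trans ?_), hsq b (hnb.trans ?_)⟩
  · have : b n = (T⁻¹ : ℂ) * (β n + F a n) := by rw [hb]; rfl
    rw [this, mul_inv_cancel_left₀ hT', hF, hopping_apply]
    ring
  · have h1 : ((R - T : ℝ) : ℂ) * a n + ((T⁻¹ : ℝ) : ℂ) * F' (F a) n
        = α n - (T⁻¹ : ℂ) * F' y n := congrArg (fun z : ℓ² => z n) ha
    have h2 : F' b n = (T⁻¹ : ℂ) * (F' y n + F' (F a) n) := by
      rw [hb, map_smul, map_add]; rfl
    have h3 : F' b n = ∑ j, c j * b (n - g j) := by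
      rw [hF', hopping_apply]; rfl
    rw [← h3, h2]
    push_cast at h1
    linear_combination h1
  · gcongr; linarith
  · gcongr; linarith

/-- The homogeneous difference equations have no square summable solution. -/
lemma eq_zero_of_discrete_solution {T R : ℝ} (hT : 0 < T) (hTR : T < R) {a b : (Fin 3 → ℤ) → ℂ}
    (ha : Summable fun n => ‖a n‖ ^ 2) (hB : ∀ n, T * b n = ∑ j, c j * a (n + g j))
    (hA : ∀ n, (T - R) * a n = ∑ j, c j * b (n - g j)) : (∀ n, a n = 0) ∧ ∀ n, b n = 0 := by
  have hr : 0 < R - T := sub_pos.2 hTR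
  have ht : 0 ≤ T⁻¹ := (inv_pos.2 hT).le
  have hT' : (T : ℂ) ≠ 0 := mod_cast hT.ne'
  let x : ℓ² := ⟨a, memℓp_two_iff.2 ha⟩
  have hb : ∀ n, hopping c g x n = T * b n := fun n => by
    rw [hopping_apply, hB]
  have hx : schur (R - T) T⁻¹ c g x = 0 := by
    refine lp.ext (funext fun n => ?_)
    have h1 : hopping c (-g) (hopping c g x) n = T * ∑ j, c j * b (n - g j) := by
      rw [hopping_apply, Finset.mul_sum]
      refine Finset.sum_congr rfl fun j _ => ?_
      rw [hb, Pi.neg_apply, ← sub_eq_add_neg]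
      ring
    change ((R - T : ℝ) : ℂ) * a n + ((T⁻¹ : ℝ) : ℂ) * hopping c (-g) (hopping c g x) n = 0
    rw [h1, ← hA]
    push_cast
    rw [inv_mul_cancel_left₀ hT']
    ring
  have hx0 : x = 0 := by
    have := norm_le_schur hr ht c g x
    rw [hx, norm_zero, mul_zero] at this
    exact norm_le_zero_iff.1 this
  have ha0 : ∀ n, a n = 0 := fun n => congrArg (fun z : ℓ² => z n) hx0
  refine ⟨ha0, fun n => ?_⟩
  have := hB n
  simp only [ha0, mul_zero, Finset.sum_const_zero] at this
  exact (mul_eq_zero.1 this).resolve_left hT'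

end Discrete

/-! ### Square integrable functions on a metric graph -/

lemma norm_add_sq_le (z w : ℂ) : ‖z + w‖ ^ 2 ≤ 2 * (‖z‖ ^ 2 + ‖w‖ ^ 2) :=
  (pow_le_pow_left₀ (norm_nonneg _) (norm_add_le z w) 2).trans (add_sq_le)

lemma norm_sum_sq_le {ι : Type*} [Fintype ι] (z : ι → ℂ) :
    ‖∑ i, z i‖ ^ 2 ≤ Fintype.card ι * ∑ i, ‖z i‖ ^ 2 :=
  (pow_le_pow_left₀ (norm_nonneg _) (norm_sum_le _ _) 2).trans sq_sum_le_card_mul_sum_sq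

namespace MetricGraph

variable {V E : Type} {G : MetricGraph V E}

lemma memL2_const_mul_add {f g : E → ℝ → ℂ} (hf : G.MemL2 f) (hg : G.MemL2 g) (c : ℂ) :
    G.MemL2 fun e x => c * f e x + g e x := by
  have hm : ∀ e, MemLp (fun x => c * f e x + g e x) 2 (volume.restrict (Ioo 0 (G.len e))) :=
    fun e => ((hf.1 e).const_mul c).add (hg.1 e)
  refine ⟨hm, Summable.of_nonneg_of_le (fun e => integral_nonneg fun x => sq_nonneg _) (fun e => ?_)
    ((hf.2.mul_left (2 * ‖c‖ ^ 2)).add (hg.2.mul_left 2))⟩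
  have i1 : Integrable (fun x => ‖f e x‖ ^ 2) (volume.restrict (Ioo 0 (G.len e))) :=
    (hf.1 e).integrable_norm_pow two_ne_zero
  have i2 : Integrable (fun x => ‖g e x‖ ^ 2) (volume.restrict (Ioo 0 (G.len e))) :=
    (hg.1 e).integrable_norm_pow two_ne_zero
  rw [← integral_const_mul, ← integral_const_mul, ← integral_add (i1.const_mul _) (i2.const_mul _)]
  refine integral_mono ((hm e).integrable_norm_pow two_ne_zero)
    ((i1.const_mul _).add (i2.const_mul _)) fun x => ?_
  refine (norm_add_sq_le _ _).trans (le_of_eq ?_)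
  rw [norm_mul]
  ring

lemma memL2_of_bound {f : E → ℝ → ℂ} {B : E → ℝ} {L : ℝ} (hL : ∀ e, G.len e ≤ L)
    (hf : ∀ e, ContinuousOn (f e) (Icc 0 (G.len e)))
    (hB : ∀ e, ∀ x ∈ Icc 0 (G.len e), ‖f e x‖ ^ 2 ≤ B e) (hs : Summable B) :
    G.MemL2 f ∧ G.normSq f ≤ L * ∑' e, B e := by
  have h1 : ∀ e, ∫ x in Ioo 0 (G.len e), ‖f e x‖ ^ 2 ≤ L * B e := fun e => by
    have h0 : 0 ≤ B e := (sq_nonneg _).trans (hB e 0 ⟨le_rfl, (G.len_pos e).le⟩)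
    have hi : IntegrableOn (fun x => ‖f e x‖ ^ 2) (Ioo 0 (G.len e)) :=
      MemLp.integrable_norm_pow (memLp_of_continuousOn (hf e)) two_ne_zero
    calc ∫ x in Ioo 0 (G.len e), ‖f e x‖ ^ 2 ≤ ∫ x in Ioo 0 (G.len e), B e :=
          setIntegral_mono_on hi (by simp) measurableSet_Ioo fun x hx => hB e x (Ioo_subset_Icc_self hx)
      _ = G.len e * B e := by simp [(G.len_pos e).le]
      _ ≤ L * B e := by have := hL e; gcongr
  have h2 : Summable fun e => ∫ x in Ioo 0 (G.len e), ‖f e x‖ ^ 2 :=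
    Summable.of_nonneg_of_le (fun e => integral_nonneg fun x => sq_nonneg _) h1 (hs.mul_left L)
  refine ⟨⟨fun e => memLp_of_continuousOn (hf e), h2⟩, ?_⟩
  rw [normSq, ← tsum_mul_left]
  exact h2.tsum_le_tsum h1 (hs.mul_left L)

lemma normSq_congr {f g : E → ℝ → ℂ} (h : ∀ e, ∀ᵐ x ∂(volume.restrict (Ioo 0 (G.len e))),
    f e x = g e x) : G.normSq f = G.normSq g :=
  tsum_congr fun e => integral_congr_ae <| by
    filter_upwards [h e] with x hx
    rw [hx]

lemma InDomain.sub {u u₁ u₂ v v₁ v₂ : E → ℝ → ℂ} (hu : G.InDomain u u₁ u₂)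
    (hv : G.InDomain v v₁ v₂) : G.InDomain (fun e x => u e x - v e x)
      (fun e x => u₁ e x - v₁ e x) (fun e x => u₂ e x - v₂ e x) := by
  have key : ∀ {f g : E → ℝ → ℂ}, G.MemL2 f → G.MemL2 g → G.MemL2 fun e x => f e x - g e x :=
    fun hf hg => by
      convert! memL2_const_mul_add hg hf (-1) using 3
      ring
  refine ⟨⟨fun e => (hu.admissible.isH2 e).sub (hv.admissible.isH2 e),
    fun v hv => absurd hv (notMem_empty v), fun p hp => ?_, fun p hp => ?_⟩,
    key hu.memL2 hv.memL2, key hu.memL2_deriv hv.memL2_deriv, key hu.memL2_deriv2 hv.memL2_deriv2⟩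
  · obtain ⟨c, hc⟩ := hu.admissible.continuous p hp
    obtain ⟨d, hd⟩ := hv.admissible.continuous p hp
    exact ⟨c - d, fun e => ⟨fun he => congrArg₂ (· - ·) ((hc e).1 he) ((hd e).1 he),
      fun he => congrArg₂ (· - ·) ((hc e).2 he) ((hd e).2 he)⟩⟩
  · have h1 := hu.admissible.kirchhoff p hp
    have h2 := hv.admissible.kirchhoff p hp
    rw [outflow] at h1 h2 ⊢
    rw [Finset.sum_sub_distrib, Finset.sum_sub_distrib]
    linear_combination h1 - h2

end MetricGraph

/-- A sum over the edges of the cover, rearranged as a sum over the cells; the edges over `e` are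
assigned to the cells with a shift `s e`. -/
lemma hasSum_sum_edges {N : Option (Fin 4) × (Fin 3 → ℤ) → ℝ} (hN : Summable N)
    (s : Option (Fin 4) → Fin 3 → ℤ) : HasSum (fun n => ∑ e, N (e, n + s e)) (∑' e, N e) := by
  rw [hN.tsum_prod, tsum_fintype]
  refine hasSum_sum fun e _ => ?_
  exact (Equiv.addRight (s e)).hasSum_iff.2 (hN.prod_factor e).hasSum

lemma hasSum_edges {A : (Fin 3 → ℤ) → ℝ} (hA : Summable A) (hA0 : ∀ n, 0 ≤ A n)
    (s : Option (Fin 4) → Fin 3 → ℤ) :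
    HasSum (fun e : Option (Fin 4) × (Fin 3 → ℤ) => A (e.2 + s e.1)) (5 * ∑' n, A n) := by
  have h1 : ∀ e, Summable fun n => A (n + s e) := fun e => (Equiv.addRight (s e)).summable_iff.2 hA
  have h2 : Summable fun e : Option (Fin 4) × (Fin 3 → ℤ) => A (e.2 + s e.1) :=
    (summable_prod_of_nonneg fun e => hA0 _).2 ⟨h1, Summable.of_finite⟩
  convert! h2.hasSum
  have h3 : ∀ e, ∑' n, A (n + s e) = ∑' n, A n := fun e => (Equiv.addRight (s e)).tsum_eq A
  rw [h2.tsum_prod, tsum_fintype (β := Option (Fin 4))]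
  simp [h3]

/-! ### The resolvent set of the Laplacian on the cover -/

section Cover

variable {ℓ₀ : ℝ} {ℓ : Fin 4 → ℝ} (h₀ : 0 < ℓ₀) (h : ∀ j, 0 < ℓ j) (hle : ∀ j, ℓ j ≤ ℓ₀)

local notation "Γ" => compactGraph ℓ₀ ℓ h₀ h
local notation "X" => MetricGraph.cover (compactGraph ℓ₀ ℓ h₀ h) voltage

/-- Particular solutions of `-w'' - Λ w = f` on the edges of the cover, bounded by `f` uniformly in
the edge. -/
lemma exists_source_cover {Λ : ℝ} (hS : ∀ j, sinL Λ (ℓ j) ≠ 0) (hC : cosL Λ ℓ₀ ≠ 0) :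
    ∃ K : ℝ, 0 ≤ K ∧ ∀ f, (X).MemL2 f → ∃ w w₁ : Option (Fin 4) × (Fin 3 → ℤ) → ℝ → ℂ,
      (∀ e, IsH2 ((X).len e) (w e) (w₁ e) (fun x => -f e x - Λ * w e x)) ∧
      (∀ j n, w (some j, n) 0 = 0) ∧ (∀ j n, w (some j, n) (ℓ j) = 0) ∧
      (∀ n, w (none, n) ℓ₀ = 0) ∧ (∀ n, w₁ (none, n) 0 = 0) ∧
      ∀ e, ∀ x ∈ Icc 0 ((X).len e),
        ‖w e x‖ ^ 2 ≤ K * (∫ x in Ioo 0 ((X).len e), ‖f e x‖ ^ 2) ∧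
        ‖w₁ e x‖ ^ 2 ≤ K * (∫ x in Ioo 0 ((X).len e), ‖f e x‖ ^ 2) := by
  obtain ⟨K₀, hK₀, H₀⟩ := exists_mixed_source h₀ hC
  choose K hK H using fun j => exists_dirichlet_source (h j) (hS j)
  refine ⟨K₀ + ∑ j, K j, add_nonneg hK₀ (Finset.sum_nonneg fun j _ => hK j), fun f hf => ?_⟩
  choose v v₁ hv h0 hL hb using fun n => H₀ (f (none, n)) (hf.1 (none, n))
  choose w w₁ hw g0 gL gb using fun j n => H j (f (some j, n)) (hf.1 (some j, n))
  have i0 : ∀ e, 0 ≤ ∫ x in Ioo 0 ((X).len e), ‖f e x‖ ^ 2 := fun e =>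
    integral_nonneg fun x => sq_nonneg _
  refine ⟨fun e => e.1.elim (v e.2) fun j => w j e.2, fun e => e.1.elim (v₁ e.2) fun j => w₁ j e.2,
    ?_, g0, gL, hL, h0, ?_⟩
  · rintro ⟨_ | j, n⟩
    exacts [hv n, hw j n]
  · rintro ⟨_ | j, n⟩ x hx
    · have : K₀ ≤ K₀ + ∑ j, K j := le_add_of_nonneg_right (Finset.sum_nonneg fun j _ => hK j)
      exact ⟨(hb n x hx).1.trans (mul_le_mul_of_nonneg_right this (i0 (none, n))),
        (hb n x hx).2.trans (mul_le_mul_of_nonneg_right this (i0 (none, n)))⟩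
    · have : K j ≤ K₀ + ∑ j, K j := (Finset.single_le_sum (fun j _ => hK j)
        (Finset.mem_univ j)).trans (le_add_of_nonneg_left hK₀)
      exact ⟨(gb j n x hx).1.trans (mul_le_mul_of_nonneg_right this (i0 (some j, n))),
        (gb j n x hx).2.trans (mul_le_mul_of_nonneg_right this (i0 (some j, n)))⟩

lemma exists_bound_interp (Λ : ℝ) :
    ∃ K : ℝ, 0 ≤ K ∧ ∀ (a b : (Fin 3 → ℤ) → ℂ) (e : Option (Fin 4) × (Fin 3 → ℤ)),
      ∀ x ∈ Icc 0 ((X).len e),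
        ‖interp Λ ℓ₀ ℓ a b e x‖ ^ 2 ≤ K * (‖a (e.2 + voltage e.1)‖ ^ 2 + ‖b e.2‖ ^ 2) ∧
        ‖interpDeriv Λ ℓ₀ ℓ a b e x‖ ^ 2 ≤ K * (‖a (e.2 + voltage e.1)‖ ^ 2 + ‖b e.2‖ ^ 2) := by
  have hc := continuous_cosL Λ
  have hs := continuous_sinL Λ
  -- on each edge, the coefficients of the two vertex values are bounded functions
  have hlin : ∀ {p q : ℂ} {P : ℝ} (z w : ℂ), ‖p‖ + ‖q‖ ≤ P →
      ‖p * z + q * w‖ ^ 2 ≤ 2 * P ^ 2 * (‖z‖ ^ 2 + ‖w‖ ^ 2) := fun {p q P} z w hP => by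
    have hp := norm_nonneg p
    have hq := norm_nonneg q
    calc ‖p * z + q * w‖ ^ 2 ≤ 2 * (‖p * z‖ ^ 2 + ‖q * w‖ ^ 2) := norm_add_sq_le _ _
      _ = 2 * (‖p‖ ^ 2 * ‖z‖ ^ 2 + ‖q‖ ^ 2 * ‖w‖ ^ 2) := by rw [norm_mul, norm_mul]; ring
      _ ≤ 2 * (P ^ 2 * ‖z‖ ^ 2 + P ^ 2 * ‖w‖ ^ 2) := by
          gcongr <;> linarith
      _ = _ := by ring
  have edge : ∀ e : Option (Fin 4), ∃ K : ℝ, 0 ≤ K ∧ ∀ (a b : (Fin 3 → ℤ) → ℂ) (n : Fin 3 → ℤ),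
      ∀ x ∈ Icc 0 ((X).len (e, n)),
        ‖interp Λ ℓ₀ ℓ a b (e, n) x‖ ^ 2 ≤ K * (‖a (n + voltage e)‖ ^ 2 + ‖b n‖ ^ 2) ∧
        ‖interpDeriv Λ ℓ₀ ℓ a b (e, n) x‖ ^ 2 ≤ K * (‖a (n + voltage e)‖ ^ 2 + ‖b n‖ ^ 2) := by
    rintro (_ | j)
    · obtain ⟨P, hP⟩ := isCompact_Icc.exists_bound_of_continuousOn (s := Icc 0 ℓ₀)
        (f := fun x => ‖(cosL Λ x / cosL Λ ℓ₀ : ℂ)‖ + ‖(-Λ * sinL Λ x / cosL Λ ℓ₀ : ℂ)‖) (by fun_prop)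
      refine ⟨2 * P ^ 2, by positivity, fun a b n x hx => ?_⟩
      have hPx := (le_abs_self _).trans (hP x hx)
      have h1 := norm_nonneg (cosL Λ x / cosL Λ ℓ₀ : ℂ)
      have h2 := norm_nonneg (-Λ * sinL Λ x / cosL Λ ℓ₀ : ℂ)
      have hv : n + voltage none = n := add_zero n
      rw [hv]
      refine ⟨?_, ?_⟩
      · have := hlin (p := (cosL Λ x / cosL Λ ℓ₀ : ℂ)) (q := 0) (P := P) (a n) (b n)
          (by rw [norm_zero]; linarith)
        refine le_of_eq_of_le ?_ this
        simp only [interp]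
        congr 2
        ring
      · have := hlin (p := (-Λ * sinL Λ x / cosL Λ ℓ₀ : ℂ)) (q := 0) (P := P) (a n) (b n)
          (by rw [norm_zero]; linarith)
        refine le_of_eq_of_le ?_ this
        simp only [interpDeriv]
        congr 2
        ring
    · obtain ⟨P, hP⟩ := isCompact_Icc.exists_bound_of_continuousOn (s := Icc 0 (ℓ j))
        (f := fun x => (‖(edgeCsc Λ (ℓ j) * sinL Λ x : ℂ)‖
          + ‖(cosL Λ x - edgeCot Λ (ℓ j) * sinL Λ x : ℂ)‖) + (‖(edgeCsc Λ (ℓ j) * cosL Λ x : ℂ)‖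
          + ‖(-Λ * sinL Λ x - edgeCot Λ (ℓ j) * cosL Λ x : ℂ)‖)) (by fun_prop)
      refine ⟨2 * P ^ 2, by positivity, fun a b n x hx => ?_⟩
      have hPx := (le_abs_self _).trans (hP x hx)
      have h1 := norm_nonneg (edgeCsc Λ (ℓ j) * sinL Λ x : ℂ)
      have h2 := norm_nonneg (cosL Λ x - edgeCot Λ (ℓ j) * sinL Λ x : ℂ)
      have h3 := norm_nonneg (edgeCsc Λ (ℓ j) * cosL Λ x : ℂ)
      have h4 := norm_nonneg (-Λ * sinL Λ x - edgeCot Λ (ℓ j) * cosL Λ x : ℂ)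
      refine ⟨?_, ?_⟩
      · have := hlin (P := P) (p := (edgeCsc Λ (ℓ j) * sinL Λ x : ℂ))
          (q := (cosL Λ x - edgeCot Λ (ℓ j) * sinL Λ x : ℂ)) (a (n + voltage (some j))) (b n)
          (by linarith)
        refine le_of_eq_of_le ?_ this
        simp only [interp]
        congr 2
        ring
      · have := hlin (P := P) (p := (edgeCsc Λ (ℓ j) * cosL Λ x : ℂ))
          (q := (-Λ * sinL Λ x - edgeCot Λ (ℓ j) * cosL Λ x : ℂ)) (a (n + voltage (some j))) (b n)
          (by linarith)
        refine le_of_eq_of_le ?_ this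
        simp only [interpDeriv]
        congr 2
        ring
  choose K hK H using edge
  refine ⟨∑ e, K e, Finset.sum_nonneg fun e _ => hK e, fun a b ⟨e, n⟩ x hx => ?_⟩
  have hKe : K e ≤ ∑ e, K e := Finset.single_le_sum (fun e _ => hK e) (Finset.mem_univ e)
  have hnn : 0 ≤ ‖a (n + voltage e)‖ ^ 2 + ‖b n‖ ^ 2 := by positivity
  exact ⟨(H e a b n x hx).1.trans (mul_le_mul_of_nonneg_right hKe hnn),
    (H e a b n x hx).2.trans (mul_le_mul_of_nonneg_right hKe hnn)⟩

include hle in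
lemma len_cover_le (e : Option (Fin 4) × (Fin 3 → ℤ)) : (X).len e ≤ ℓ₀ := by
  obtain ⟨_ | j, n⟩ := e
  exacts [le_rfl, hle j]

include hle in
/-- The equation `-u'' - Λ u = f` on the cover is solved by particular solutions on the edges, with
a homogeneous solution that corrects their defects in the Kirchhoff conditions. -/
lemma exists_resolvent {Λ : ℝ} (hS : ∀ j, sinL Λ (ℓ j) ≠ 0) (hC : cosL Λ ℓ₀ ≠ 0)
    (hT : 0 < cotSum Λ ℓ) (hTR : cotSum Λ ℓ < edgeTan Λ ℓ₀) :
    ∃ C : ℝ, ∀ f, (X).MemL2 f → ∃ u u₁ u₂, (X).InDomain u u₁ u₂ ∧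
      (∀ e x, -u₂ e x - Λ * u e x = f e x) ∧ (X).normSq u ≤ C * (X).normSq f := by
  obtain ⟨K, hK, hsrc⟩ := exists_source_cover h₀ h hS hC
  obtain ⟨Q, hQ, hint⟩ := exists_bound_interp (ℓ := ℓ) h₀ h Λ
  obtain ⟨D, hD, hdisc⟩ := exists_discrete_solution (fun j => edgeCsc Λ (ℓ j))
    (fun j => voltage (some j)) hT hTR
  refine ⟨ℓ₀ * (2 * (K + Q * (5 * (2 * (D * (2 * (5 * K))))))), fun f hf => ?_⟩
  obtain ⟨w, w₁, hw, hw0, hwL, hwt, hwt', hwb⟩ := hsrc f hf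
  obtain ⟨N, hN⟩ : ∃ N : Option (Fin 4) × (Fin 3 → ℤ) → ℝ,
    N = fun e => ∫ x in Ioo 0 ((X).len e), ‖f e x‖ ^ 2 := ⟨_, rfl⟩
  have hN0 : ∀ e, 0 ≤ N e := fun e => by rw [hN]; exact integral_nonneg fun x => sq_nonneg _
  have hNs : Summable N := hN ▸ hf.2
  have hNt : ∑' e, N e = (X).normSq f := by rw [hN]; rfl
  have hwb' : ∀ e, ∀ x ∈ Icc 0 ((X).len e), ‖w e x‖ ^ 2 ≤ K * N e ∧ ‖w₁ e x‖ ^ 2 ≤ K * N e := by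
    rw [hN]; exact hwb
  -- the defects of the particular solution in the Kirchhoff conditions are square summable
  have hvert : ∀ (φ : (Fin 3 → ℤ) → ℂ) (s : Option (Fin 4) → Fin 3 → ℤ),
      (∀ n, ‖φ n‖ ^ 2 ≤ 5 * K * ∑ e, N (e, n + s e)) →
      (Summable fun n => ‖φ n‖ ^ 2) ∧ ∑' n, ‖φ n‖ ^ 2 ≤ 5 * K * (X).normSq f := fun φ s hφ => by
    have hs := (hasSum_sum_edges hNs s).mul_left (5 * K)
    have h1 := Summable.of_nonneg_of_le (fun n => sq_nonneg ‖φ n‖) hφ hs.summable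
    refine ⟨h1, ?_⟩
    rw [← hNt, ← hs.tsum_eq]
    exact h1.tsum_le_tsum hφ hs.summable
  obtain ⟨hα, hα'⟩ := hvert (fun n => w₁ (none, n) ℓ₀ + ∑ j, w₁ (some j, n - voltage (some j)) (ℓ j))
    (fun e => -voltage e) fun n => by
      have := norm_sum_sq_le fun e : Option (Fin 4) => w₁ (e, n + -voltage e) ((X).len (e, n))
      have e1 : ∑ e : Option (Fin 4), w₁ (e, n + -voltage e) ((X).len (e, n))
          = w₁ (none, n) ℓ₀ + ∑ j, w₁ (some j, n - voltage (some j)) (ℓ j) := by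
        have hv : n + -voltage none = n := by simp [voltage]
        rw [Fintype.sum_option, hv]
        rfl
      rw [e1] at this
      refine this.trans ?_
      have hc : (Fintype.card (Option (Fin 4)) : ℝ) = 5 := by simp
      rw [hc, mul_assoc]
      refine mul_le_mul_of_nonneg_left ?_ (by norm_num)
      rw [Finset.mul_sum]
      exact Finset.sum_le_sum fun e _ => (hwb' (e, n + -voltage e) _ ⟨((X).len_pos _).le, le_rfl⟩).2
  obtain ⟨hβ, hβ'⟩ := hvert (fun n => ∑ j, w₁ (some j, n) 0) (fun _ => 0) fun n => by
      have h1 := norm_sum_sq_le fun j => w₁ (some j, n) 0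
      have h2 : ∑ j, ‖w₁ (some j, n) 0‖ ^ 2 ≤ K * ∑ e, N (e, n + 0) := by
        rw [Finset.mul_sum, Fintype.sum_option, add_zero]
        exact le_add_of_nonneg_of_le (mul_nonneg hK (hN0 _)) (Finset.sum_le_sum fun j _ =>
          (hwb' (some j, n) 0 ⟨le_rfl, ((X).len_pos _).le⟩).2)
      have h3 : 0 ≤ ∑ j, ‖w₁ (some j, n) 0‖ ^ 2 := Finset.sum_nonneg fun j _ => sq_nonneg _
      rw [Fintype.card_fin] at h1
      push_cast at h1
      linarith
  obtain ⟨a, b, ha, hb, hB, hA, hab, hbb⟩ := hdisc _ _ hα hβ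
  have hadm := isAdmissible_add_interp h₀ h hS hC a b hw hw0 hwL hwt hwt' hB hA
  have hsum := ((hasSum_edges ha (fun n => sq_nonneg _) voltage).add
    (hasSum_edges hb (fun n => sq_nonneg _) 0)).mul_left Q
  have hsum' := ((hNs.hasSum.mul_left K).add hsum).mul_left 2
  simp only [Pi.zero_apply, add_zero] at hsum'
  have hbd : ∀ {p q : ℂ} {e}, ‖p‖ ^ 2 ≤ K * N e →
      ‖q‖ ^ 2 ≤ Q * (‖a (e.2 + voltage e.1)‖ ^ 2 + ‖b e.2‖ ^ 2) → ‖p + q‖ ^ 2 ≤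
      2 * (K * N e + Q * (‖a (e.2 + voltage e.1)‖ ^ 2 + ‖b e.2‖ ^ 2)) := fun hp hq =>
    (norm_add_sq_le _ _).trans (by gcongr)
  have hu := MetricGraph.memL2_of_bound (len_cover_le h₀ h hle)
    (fun e => (hadm.isH2 e).continuousOn)
    (fun e x hx => hbd (hwb' e x hx).1 (hint a b e x hx).1) hsum'.summable
  have hu₁ := MetricGraph.memL2_of_bound (len_cover_le h₀ h hle)
    (fun e => (hadm.isH2 e).continuousOn_deriv)
    (fun e x hx => hbd (hwb' e x hx).2 (hint a b e x hx).2) hsum'.summable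
  refine ⟨_, _, _, ⟨hadm, hu.1, hu₁.1, ?_⟩, fun e x => by ring, hu.2.trans ?_⟩
  · have hneg : (X).MemL2 fun e x => (-Λ : ℂ) * (w e x + interp Λ ℓ₀ ℓ a b e x) + 0 := by
      simpa using MetricGraph.memL2_const_mul_add hu.1
        (MetricGraph.memL2_of_bound (f := fun _ _ => 0) (B := fun _ => 0)
          (len_cover_le h₀ h hle) (fun e => continuousOn_const) (by simp) summable_zero).1 (-Λ)
    convert! MetricGraph.memL2_const_mul_add hf hneg (-1) using 3
    ring
  · rw [hsum'.tsum_eq, hNt, mul_assoc]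
    refine mul_le_mul_of_nonneg_left ?_ h₀.le
    have e1 : D * ((∑' n, ‖w₁ (none, n) ℓ₀ + ∑ j, w₁ (some j, n - voltage (some j)) (ℓ j)‖ ^ 2)
        + ∑' n, ‖∑ j, w₁ (some j, n) 0‖ ^ 2) ≤ D * (2 * (5 * K)) * (X).normSq f := by
      rw [mul_assoc]
      exact mul_le_mul_of_nonneg_left (by linarith) hD
    have e2 := mul_le_mul_of_nonneg_left (add_le_add (hab.trans e1) (hbb.trans e1)) hQ
    linarith

include h₀ in
lemma integral_tail_pos {Λ : ℝ} (hC : cosL Λ ℓ₀ ≠ 0) :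
    0 < ∫ x in Ioo 0 ℓ₀, ‖(cosL Λ x / cosL Λ ℓ₀ : ℂ)‖ ^ 2 := by
  have hc := continuous_cosL Λ
  have hC' : (cosL Λ ℓ₀ : ℂ) ≠ 0 := mod_cast hC
  rw [← integral_Ioc_eq_integral_Ioo, ← intervalIntegral.integral_of_le h₀.le]
  refine intervalIntegral.integral_pos h₀ (by fun_prop) (fun x _ => by positivity)
    ⟨ℓ₀, ⟨h₀.le, le_rfl⟩, ?_⟩
  rw [div_self hC']
  norm_num

lemma integral_tail (Λ : ℝ) (z : ℂ) :
    ∫ x in Ioo 0 ℓ₀, ‖z / cosL Λ ℓ₀ * cosL Λ x‖ ^ 2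
      = ‖z‖ ^ 2 * ∫ x in Ioo 0 ℓ₀, ‖(cosL Λ x / cosL Λ ℓ₀ : ℂ)‖ ^ 2 := by
  rw [← integral_const_mul]
  refine integral_congr_ae (Filter.Eventually.of_forall fun x => ?_)
  change ‖_‖ ^ 2 = ‖_‖ ^ 2 * ‖_‖ ^ 2
  rw [← mul_pow, ← norm_mul]
  congr 2
  ring

include h₀ h in
/-- On the tails, a square integrable solution of `-u'' = Λ u` is controlled by its values at the
lifts of `A`, which therefore are square summable; the difference equations then force it to vanish.
-/
lemma eq_zero_of_inDomain {Λ : ℝ} (hS : ∀ j, sinL Λ (ℓ j) ≠ 0) (hC : cosL Λ ℓ₀ ≠ 0)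
    (hT : 0 < cotSum Λ ℓ) (hTR : cotSum Λ ℓ < edgeTan Λ ℓ₀)
    {u u₁ u₂ : Option (Fin 4) × (Fin 3 → ℤ) → ℝ → ℂ} (hu : (X).InDomain u u₁ u₂)
    (hΛ : ∀ e, ∀ᵐ x ∂(volume.restrict (Ioo 0 ((X).len e))), -u₂ e x = Λ * u e x) :
    ∀ e, ∀ x ∈ Icc 0 ((X).len e), u e x = 0 := by
  obtain ⟨a, b, -, ht, hB, hA, hz⟩ := cover_reduction h₀ h hS hC hu.admissible hΛ
  have hn : ∀ n, ∫ x in Ioo 0 ((X).len (none, n)), ‖u (none, n) x‖ ^ 2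
      = ‖a n‖ ^ 2 * ∫ x in Ioo 0 ℓ₀, ‖(cosL Λ x / cosL Λ ℓ₀ : ℂ)‖ ^ 2 := fun n => by
    rw [← integral_tail]
    refine setIntegral_congr_fun measurableSet_Ioo fun x hx => ?_
    rw [ht n x (Ioo_subset_Icc_self hx)]
  have ha : Summable fun n => ‖a n‖ ^ 2 := by
    have := hu.memL2.2.prod_factor none
    simp only [hn] at this
    exact (summable_mul_right_iff (integral_tail_pos h₀ hC).ne').1 this
  obtain ⟨h1, h2⟩ := eq_zero_of_discrete_solution _ _ hT hTR ha hB hA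
  exact hz h1 h2

include hle in
/-- Above the eigenvalue of the Dirichlet graph and below the pole of the tangent of the tail, there
is no spectrum. -/
lemma inResolventSet {Λ : ℝ} (hS : ∀ j, sinL Λ (ℓ j) ≠ 0) (hC : cosL Λ ℓ₀ ≠ 0)
    (hT : 0 < cotSum Λ ℓ) (hTR : cotSum Λ ℓ < edgeTan Λ ℓ₀) : (X).InResolventSet Λ := by
  obtain ⟨C, hres⟩ := exists_resolvent h₀ h hle hS hC hT hTR
  refine ⟨⟨C, fun u u₁ u₂ hu => ?_⟩, fun f hf => ?_⟩
  · have hf : (X).MemL2 fun e x => -u₂ e x - Λ * u e x := by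
      have hz := (hu.sub hu).memL2
      convert! MetricGraph.memL2_const_mul_add hu.memL2_deriv2
        (MetricGraph.memL2_const_mul_add hu.memL2 hz (-Λ)) (-1) using 3
      ring
    obtain ⟨v, v₁, v₂, hv, hv', hle⟩ := hres _ hf
    have heq : ∀ e, ∀ x ∈ Icc 0 ((X).len e), u e x - v e x = 0 :=
      eq_zero_of_inDomain h₀ h hS hC hT hTR (hu.sub hv) fun e =>
        Filter.Eventually.of_forall fun x => by linear_combination -hv' e x
    rw [MetricGraph.normSq_congr (g := v)]
    · exact hle
    · intro e
      filter_upwards [ae_restrict_mem measurableSet_Ioo] with x hx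
      exact sub_eq_zero.1 (heq e x (Ioo_subset_Icc_self hx))
  · obtain ⟨u, u₁, u₂, hu, hu', -⟩ := hres f hf
    exact ⟨u, u₁, u₂, hu, fun e => Filter.Eventually.of_forall (hu' e)⟩

end Cover

/-! ### The maximum of the first band function belongs to the spectrum -/

lemma summable_pi_prod {ι κ : Type*} [Fintype ι] [DecidableEq ι] [DecidableEq κ] {f : κ → ℝ}
    (hf0 : ∀ x, 0 ≤ f x) (hf : Summable f) : Summable fun n : ι → κ => ∏ i, f (n i) := by
  refine summable_of_sum_le (c := ∏ _ : ι, ∑' x, f x)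
    (fun n => Finset.prod_nonneg fun i _ => hf0 _) fun s => ?_
  calc ∑ n ∈ s, ∏ i, f (n i)
      ≤ ∑ n ∈ Fintype.piFinset fun i => s.image fun n => n i, ∏ i, f (n i) :=
        Finset.sum_le_sum_of_subset_of_nonneg
          (fun n hn => Fintype.mem_piFinset.2 fun i => Finset.mem_image_of_mem _ hn)
          fun n _ _ => Finset.prod_nonneg fun i _ => hf0 _
    _ = ∏ i, ∑ x ∈ s.image fun n => n i, f x := by rw [Finset.prod_univ_sum]
    _ ≤ _ := Finset.prod_le_prod (fun i _ => Finset.sum_nonneg fun x _ => hf0 x) fun i _ =>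
        hf.sum_le_tsum _ fun x _ => hf0 x

lemma summable_pow_natAbs {r : ℝ} (h0 : 0 ≤ r) (h1 : r < 1) :
    Summable fun n : ℤ => r ^ n.natAbs := by
  have := summable_geometric_of_lt_one h0 h1
  exact Summable.of_nat_of_neg (by simpa using this) (by simpa using this)

/-- The `ℓ¹`-norm on `ℤ³`. -/
def latticeNorm (n : Fin 3 → ℤ) : ℕ := ∑ i, (n i).natAbs

lemma latticeNorm_add_voltage (n : Fin 3 → ℤ) (j : Fin 4) :
    latticeNorm (n + voltage (some j)) ≤ latticeNorm n + 1 ∧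
      latticeNorm n ≤ latticeNorm (n + voltage (some j)) + 1 := by
  simp only [latticeNorm, Fin.sum_univ_three, Pi.add_apply]
  fin_cases j <;> simp [voltage, Fin.ext_iff] <;> omega

lemma abs_inv_pow_sub_pow_le {ε : ℝ} (hε : 0 < ε) {p q : ℕ} (h1 : q ≤ p + 1) (h2 : p ≤ q + 1) :
    |(1 + ε)⁻¹ ^ q - (1 + ε)⁻¹ ^ p| ≤ ε * (1 + ε)⁻¹ ^ p := by
  have hr : 0 < (1 + ε)⁻¹ := by positivity
  have e : (1 + ε)⁻¹ * (1 + ε) = 1 := inv_mul_cancel₀ (by positivity)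
  set r := (1 + ε)⁻¹
  have hr1 : r ≤ 1 := by nlinarith
  obtain rfl | rfl | rfl : q = p + 1 ∨ q = p ∨ p = q + 1 := by omega
  · have hp : 0 < r ^ p := by positivity
    rw [abs_le, pow_succ]
    constructor <;> nlinarith [mul_pos hp hε]
  · rw [sub_self, abs_zero]
    positivity
  · have hp : 0 < r ^ q := by positivity
    have : r ^ q - r ^ (q + 1) = ε * r ^ (q + 1) := by
      rw [pow_succ]
      linear_combination (-r ^ q) * e
    rw [this, abs_of_pos (by positivity)]

section Weyl

variable {ℓ₀ : ℝ} {ℓ : Fin 4 → ℝ} (h₀ : 0 < ℓ₀) (h : ∀ j, 0 < ℓ j) (hle : ∀ j, ℓ j ≤ ℓ₀)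

local notation "Γ" => compactGraph ℓ₀ ℓ h₀ h
local notation "X" => MetricGraph.cover (compactGraph ℓ₀ ℓ h₀ h) voltage

include h hle h₀ in
/-- A function with a prescribed derivative at one end of a fixed edge from `B` to `A`, and
vanishing Cauchy data at all other ends: a cubic polynomial on this edge. -/
lemma exists_corrector (Λ : ℝ) : ∃ P : ℝ, 0 ≤ P ∧ ∀ d : (Fin 3 → ℤ) → ℂ,
    ∃ w w₁ g : Option (Fin 4) × (Fin 3 → ℤ) → ℝ → ℂ,
      (∀ e, IsH2 ((X).len e) (w e) (w₁ e) (fun x => -g e x - Λ * w e x)) ∧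
      (∀ j n, w (some j, n) 0 = 0) ∧ (∀ j n, w (some j, n) (ℓ j) = 0) ∧
      (∀ n x, w (none, n) x = 0) ∧ (∀ n x, w₁ (none, n) x = 0) ∧
      (∀ j n, w₁ (some j, n) (ℓ j) = 0) ∧ (∀ n, ∑ j, w₁ (some j, n) 0 = d n) ∧
      (∀ e, Continuous (g e)) ∧ ∀ e, ∀ x ∈ Icc 0 ((X).len e), ‖w e x‖ ^ 2 ≤ P * ‖d e.2‖ ^ 2 ∧
        ‖w₁ e x‖ ^ 2 ≤ P * ‖d e.2‖ ^ 2 ∧ ‖g e x‖ ^ 2 ≤ P * ‖d e.2‖ ^ 2 := by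
  obtain ⟨L, hL⟩ : ∃ L, L = ℓ 3 := ⟨_, rfl⟩
  have hL0 : 0 < L := hL ▸ h 3
  have hL0' : (L : ℂ) ≠ 0 := mod_cast hL0.ne'
  let p : ℝ → ℂ := fun x => x - 2 / L * x ^ 2 + 1 / L ^ 2 * x ^ 3
  let p₁ : ℝ → ℂ := fun x => 1 - 4 / L * x + 3 / L ^ 2 * x ^ 2
  let p₂ : ℝ → ℂ := fun x => -(4 / L) + 6 / L ^ 2 * x
  have hp : ∀ x : ℝ, HasDerivAt p (p₁ x) x := fun x => by
    have h1 := Complex.ofRealCLM.hasDerivAt (x := x)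
    convert! ((h1.sub ((h1.pow 2).const_mul (2 / L : ℂ))).add ((h1.pow 3).const_mul (1 / L ^ 2 : ℂ)))
      using 1
    simp only [p₁, Complex.ofRealCLM_apply, Complex.ofReal_one]
    push_cast
    ring
  have hp₁ : ∀ x : ℝ, HasDerivAt p₁ (p₂ x) x := fun x => by
    have h1 := Complex.ofRealCLM.hasDerivAt (x := x)
    convert! (((h1.const_mul (4 / L : ℂ)).const_sub 1).add ((h1.pow 2).const_mul (3 / L ^ 2 : ℂ)))
      using 1
    simp only [p₂, Complex.ofRealCLM_apply, Complex.ofReal_one]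
    push_cast
    ring
  have c0 : Continuous p := by fun_prop
  have c1 : Continuous p₁ := by fun_prop
  have c2 : Continuous p₂ := by fun_prop
  obtain ⟨P, hP⟩ := isCompact_Icc.exists_bound_of_continuousOn (s := Icc 0 ℓ₀)
    (f := fun x => ‖p x‖ + ‖p₁ x‖ + ‖-p₂ x - Λ * p x‖) (by fun_prop)
  let c : Option (Fin 4) → ℂ := fun e => if e = some 3 then 1 else 0
  have hc : ∀ e, ‖c e‖ ≤ 1 := fun e => by
    simp only [c]; split_ifs <;> simp
  have hbd : ∀ (z : ℂ) (e : Option (Fin 4)) (y : ℂ), ‖y‖ ≤ P → ‖z * c e * y‖ ^ 2 ≤ P ^ 2 * ‖z‖ ^ 2 :=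
    fun z e y hy => by
      rw [← mul_pow, norm_mul, norm_mul]
      have := norm_nonneg z
      refine pow_le_pow_left₀ (by positivity) ?_ 2
      calc ‖z‖ * ‖c e‖ * ‖y‖ ≤ ‖z‖ * 1 * P := by have := hc e; gcongr
        _ = _ := by ring
  have hpL : p L = 0 := by simp only [p]; field_simp; ring
  have hp₁L : p₁ L = 0 := by simp only [p₁]; field_simp; ring
  have hcj : ∀ (j : Fin 4) (φ : ℝ → ℂ), φ L = 0 → c (some j) * φ (ℓ j) = 0 := fun j φ hφ => by
    by_cases hj : j = 3
    · rw [hj, ← hL, hφ, mul_zero]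
    · simp [c, hj]
  refine ⟨P ^ 2, sq_nonneg _, fun d => ⟨fun e x => d e.2 * c e.1 * p x,
    fun e x => d e.2 * c e.1 * p₁ x, fun e x => d e.2 * c e.1 * (-p₂ x - Λ * p x), fun e => ?_,
    fun j n => by simp [p], fun j n => by simp only [mul_assoc, hcj j p hpL, mul_zero],
    fun n x => by simp [c], fun n x => by simp [c],
    fun j n => by simp only [mul_assoc, hcj j p₁ hp₁L, mul_zero], fun n => ?_,
    fun e => by fun_prop, fun e x hx => ?_⟩⟩
  · refine IsH2.of_hasDerivAt (fun x => (hp x).const_mul _) (fun x => ?_) (by fun_prop)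
    convert! (hp₁ x).const_mul (d e.2 * c e.1) using 1
    ring
  · rw [Finset.sum_eq_single 3 (fun j _ hj => by simp [c, hj]) (by simp)]
    simp [c, p₁]
  · have hx' : x ∈ Icc 0 ℓ₀ := ⟨hx.1, hx.2.trans (len_cover_le h₀ h hle e)⟩
    have hPx := (le_abs_self _).trans (hP x hx')
    have n0 := norm_nonneg (p x)
    have n1 := norm_nonneg (p₁ x)
    have n2 := norm_nonneg (-p₂ x - Λ * p x)
    exact ⟨hbd _ _ _ (by linarith), hbd _ _ _ (by linarith), hbd _ _ _ (by linarith)⟩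

include hle in
/-- If the flux vanishes at the quasimomentum `k`, the eigenfunction at `k` vanishes at the lifts of
`B`; cut off exponentially, with a slow rate, it becomes a Weyl sequence. -/
lemma not_inResolventSet {Λ : ℝ} (hS : ∀ j, sinL Λ (ℓ j) ≠ 0) (hC : cosL Λ ℓ₀ ≠ 0)
    (hTR : cotSum Λ ℓ = edgeTan Λ ℓ₀) {k : Fin 3 → Real.Angle} (hk : fluxSum Λ ℓ k = 0) :
    ¬ (X).InResolventSet Λ := by
  rintro ⟨⟨C, hres⟩, -⟩
  obtain ⟨P, hP, hcorr⟩ := exists_corrector h₀ h hle Λ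
  obtain ⟨Q, hQ, hint⟩ := exists_bound_interp (ℓ := ℓ) h₀ h Λ
  have hpos := integral_tail_pos h₀ hC
  set c := ∫ x in Ioo 0 ℓ₀, ‖(cosL Λ x / cosL Λ ℓ₀ : ℂ)‖ ^ 2 with hc
  set S := ∑ j, ‖(edgeCsc Λ (ℓ j) : ℂ)‖ with hSdef
  have hS0 : 0 ≤ S := Finset.sum_nonneg fun j _ => norm_nonneg _
  obtain ⟨η, hη, hηc⟩ := exists_pos_mul_lt hpos (|C| * (ℓ₀ * (5 * (P * S ^ 2))))
  obtain ⟨ε, hε⟩ : ∃ ε, ε = min η 1 := ⟨_, rfl⟩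
  have hε0 : 0 < ε := by rw [hε]; exact lt_min hη one_pos
  have hε1 : ε ≤ 1 := by rw [hε]; exact min_le_right _ _
  have hε2 : ε ≤ η := by rw [hε]; exact min_le_left _ _
  set r := (1 + ε)⁻¹ with hr
  have hr0 : 0 < r := by rw [hr]; positivity
  have hr1 : r < 1 := inv_lt_one_of_one_lt₀ (by linarith)
  let a : (Fin 3 → ℤ) → ℂ := fun n => floquetChar k n * (r ^ latticeNorm n : ℝ)
  have hna : ∀ n, ‖a n‖ = r ^ latticeNorm n := fun n => by
    simp only [a]
    rw [norm_mul, norm_floquetChar, one_mul, Complex.norm_real, Real.norm_of_nonneg (by positivity)]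
  have ha : Summable fun n => ‖a n‖ ^ 2 := by
    have := summable_pi_prod (ι := Fin 3) (fun x : ℤ => by positivity)
      (summable_pow_natAbs (sq_nonneg r) (by nlinarith : r ^ 2 < 1))
    refine this.congr fun n => ?_
    rw [hna, latticeNorm, ← pow_mul, mul_comm, pow_mul, Finset.prod_pow_eq_pow_sum]
  obtain ⟨d, hd⟩ : ∃ d : (Fin 3 → ℤ) → ℂ,
    d = fun n => -∑ j, edgeCsc Λ (ℓ j) * a (n + voltage (some j)) := ⟨_, rfl⟩
  -- the flux is almost cancelled, as the cut-off varies slowly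
  have hnd : ∀ n, ‖d n‖ ≤ S * ε * ‖a n‖ := fun n => by
    have e1 : d n = -(floquetChar k n * ∑ j, edgeCsc Λ (ℓ j) * floquetChar k (voltage (some j)) *
        ((r ^ latticeNorm (n + voltage (some j)) - r ^ latticeNorm n : ℝ) : ℂ)) := by
      have hk' : ∑ j, edgeCsc Λ (ℓ j) * floquetChar k (voltage (some j)) = 0 := hk
      simp only [hd, a, floquetChar_add, Complex.ofReal_sub, mul_sub, Finset.sum_sub_distrib,
        ← Finset.sum_mul, hk', zero_mul, sub_zero]
      rw [Finset.mul_sum]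
      congr 1
      exact Finset.sum_congr rfl fun j _ => by ring
    rw [e1, norm_neg, norm_mul, norm_floquetChar, one_mul, hna, hSdef, Finset.sum_mul,
      Finset.sum_mul]
    refine (norm_sum_le _ _).trans (Finset.sum_le_sum fun j _ => ?_)
    rw [norm_mul, norm_mul, norm_floquetChar, mul_one, mul_assoc]
    refine mul_le_mul_of_nonneg_left ?_ (norm_nonneg _)
    have := latticeNorm_add_voltage n j
    rw [Complex.norm_real, Real.norm_eq_abs]
    exact abs_inv_pow_sub_pow_le hε0 this.1 this.2
  have hnd2 : ∀ n, ‖d n‖ ^ 2 ≤ S ^ 2 * ε ^ 2 * ‖a n‖ ^ 2 := fun n => by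
    rw [← mul_pow, ← mul_pow]
    exact pow_le_pow_left₀ (norm_nonneg _) (hnd n) 2
  have hds : Summable fun n => ‖d n‖ ^ 2 :=
    Summable.of_nonneg_of_le (fun n => sq_nonneg _) hnd2 (ha.mul_left _)
  obtain ⟨w, w₁, g, hw, hw0, hwL, hwt, hwt', hw₁L, hw₁0, hg, hb⟩ := hcorr d
  have hadm := isAdmissible_add_interp h₀ h hS hC a 0 hw hw0 hwL (fun n => hwt n _)
    (fun n => hwt' n _) (fun n => by rw [hw₁0, hd]; simp) (fun n => by simp [hwt', hw₁L, hTR])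
  have hlen := len_cover_le h₀ h hle
  have hsum := ((hasSum_edges hds (fun n => sq_nonneg _) 0).mul_left P)
  have hsum' := ((hasSum_edges ha (fun n => sq_nonneg _) voltage).mul_left Q)
  simp only [Pi.zero_apply, add_zero] at hsum
  have hwm := (MetricGraph.memL2_of_bound hlen (fun e => (hw e).continuousOn)
    (fun e x hx => (hb e x hx).1) hsum.summable).1
  have hw₁m := (MetricGraph.memL2_of_bound hlen (fun e => (hw e).continuousOn_deriv)
    (fun e x hx => (hb e x hx).2.1) hsum.summable).1
  have hgm := MetricGraph.memL2_of_bound hlen (fun e => (hg e).continuousOn)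
    (fun e x hx => (hb e x hx).2.2) hsum.summable
  have him := (MetricGraph.memL2_of_bound hlen (fun e => (isH2_interp Λ a 0 e _).continuousOn)
    (fun e x hx => by simpa using (hint a 0 e x hx).1) hsum'.summable).1
  have hi₁m := (MetricGraph.memL2_of_bound hlen (fun e => (isH2_interp Λ a 0 e _).continuousOn_deriv)
    (fun e x hx => by simpa using (hint a 0 e x hx).2) hsum'.summable).1
  have hum : (X).MemL2 fun e x => w e x + interp Λ ℓ₀ ℓ a 0 e x := by
    simpa using MetricGraph.memL2_const_mul_add hwm him 1
  have hdom : (X).InDomain _ _ _ := ⟨hadm, hum,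
    by simpa using MetricGraph.memL2_const_mul_add hw₁m hi₁m 1, by
      have hz := MetricGraph.memL2_const_mul_add hum hum (-1)
      convert! MetricGraph.memL2_const_mul_add hgm.1
        (MetricGraph.memL2_const_mul_add hum hz (-Λ)) (-1) using 3
      ring⟩
  have hfin := hres _ _ _ hdom
  have hgeq : (fun (e : Option (Fin 4) × (Fin 3 → ℤ)) (x : ℝ) =>
      -(-g e x - Λ * (w e x + interp Λ ℓ₀ ℓ a 0 e x)) - Λ * (w e x + interp Λ ℓ₀ ℓ a 0 e x)) = g := by
    funext e x
    ring
  rw [hgeq] at hfin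
  have hlow : (∑' n, ‖a n‖ ^ 2) * c ≤ (X).normSq fun e x => w e x + interp Λ ℓ₀ ℓ a 0 e x := by
    have e1 : ∀ n, ∫ x in Ioo 0 ((X).len (none, n)), ‖w (none, n) x + interp Λ ℓ₀ ℓ a 0 (none, n) x‖ ^ 2
        = ‖a n‖ ^ 2 * c := fun n => by
      rw [hc, ← integral_tail]
      simp only [hwt, interp, zero_add, zero_mul, add_zero]
      rfl
    rw [← tsum_mul_right, ← tsum_congr e1]
    exact tsum_comp_le_tsum_of_inj hum.2 (fun e => integral_nonneg fun x => sq_nonneg _)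
      (Prod.mk_right_injective none)
  have hpos' : 0 < ∑' n, ‖a n‖ ^ 2 := by
    refine ha.tsum_pos (fun n => sq_nonneg _) 0 ?_
    rw [hna]
    positivity
  have hup : (X).normSq g ≤ ℓ₀ * (P * (5 * (S ^ 2 * ε ^ 2 * ∑' n, ‖a n‖ ^ 2))) := by
    refine hgm.2.trans ?_
    rw [hsum.tsum_eq]
    have : ∑' n, ‖d n‖ ^ 2 ≤ S ^ 2 * ε ^ 2 * ∑' n, ‖a n‖ ^ 2 := by
      rw [← tsum_mul_left]
      exact hds.tsum_le_tsum hnd2 (ha.mul_left _)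
    gcongr
  have hg0 : 0 ≤ (X).normSq g := tsum_nonneg fun e => integral_nonneg fun x => sq_nonneg _
  have hε3 : ε ^ 2 ≤ η := by nlinarith
  have : (∑' n, ‖a n‖ ^ 2) * c < (∑' n, ‖a n‖ ^ 2) * c := by
    calc (∑' n, ‖a n‖ ^ 2) * c ≤ C * (X).normSq g := hlow.trans hfin
      _ ≤ |C| * (X).normSq g := mul_le_mul_of_nonneg_right (le_abs_self C) hg0
      _ ≤ |C| * (ℓ₀ * (P * (5 * (S ^ 2 * ε ^ 2 * ∑' n, ‖a n‖ ^ 2)))) :=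
        mul_le_mul_of_nonneg_left hup (abs_nonneg C)
      _ = (∑' n, ‖a n‖ ^ 2) * (|C| * (ℓ₀ * (5 * (P * S ^ 2))) * ε ^ 2) := by ring
      _ ≤ (∑' n, ‖a n‖ ^ 2) * (|C| * (ℓ₀ * (5 * (P * S ^ 2))) * η) := by
        have := abs_nonneg C
        gcongr
      _ < _ := mul_lt_mul_of_pos_left hηc hpos'
  exact lt_irrefl _ this

end Weyl

/-! ### The constant `ρ₀` -/

lemma strictAntiOn_sq_sub_cube : StrictAntiOn (fun ρ : ℝ => ρ ^ 2 - ρ ^ 3 / 3) (Ici 2) := by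
  intro x hx y _ hxy
  have hx' : (2 : ℝ) ≤ x := hx
  have h1 : 0 < (x ^ 2 + x * y + y ^ 2) / 3 - (x + y) := by
    nlinarith [mul_nonneg (sub_nonneg.2 hx') (sub_nonneg.2 (hx'.trans hxy.le)), sq_nonneg (x - 2),
      sq_nonneg (y - 2)]
  change y ^ 2 - y ^ 3 / 3 < x ^ 2 - x ^ 3 / 3
  linear_combination mul_pos (sub_pos.2 hxy) h1

lemma existsUnique_sq_sub_cube :
    ∃! ρ : ℝ, ρ ∈ Ioo 2 3 ∧ ρ ^ 2 - ρ ^ 3 / 3 = Real.pi ^ 2 / 24 := by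
  have hpi := Real.pi_pos
  have hpi4 := Real.pi_le_four
  have hc : ContinuousOn (fun ρ : ℝ => ρ ^ 2 - ρ ^ 3 / 3) (Icc 2 3) := by fun_prop
  obtain ⟨ρ, hρ, hρe⟩ := intermediate_value_Ioo' (by norm_num) hc
    (show Real.pi ^ 2 / 24 ∈ _ from ⟨by norm_num; positivity, by norm_num; nlinarith⟩)
  refine ⟨ρ, ⟨hρ, hρe⟩, fun σ ⟨hσ, hσe⟩ => ?_⟩
  exact strictAntiOn_sq_sub_cube.injOn hσ.1.le hρ.1.le (hσe.trans hρe.symm)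

theorem mainTheorem2 (ℓ₀ : ℝ) (ℓ : Fin 4 → ℝ) (h₀ : 0 < ℓ₀) (h : ∀ j, 0 < ℓ j) :
    -- `ρ₀` is well defined
    (∃! ρ : ℝ, ρ ∈ Ioo 2 3 ∧ ρ ^ 2 - ρ ^ 3 / 3 = Real.pi ^ 2 / 24) ∧
    ∀ ρ₀ : ℝ, ρ₀ ∈ Ioo 2 3 → ρ₀ ^ 2 - ρ₀ ^ 3 / 3 = Real.pi ^ 2 / 24 →
      (⨆ j, ℓ j) ≤ min (ρ₀ * ⨅ j, ℓ j) ℓ₀ →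
      -- the quadrangle inequalities for the ground states of `Γ` with a Dirichlet condition at `B`
      ((∃ φ φ₁, (compactGraph ℓ₀ ℓ h₀ h).IsGroundState {Vtx.B} φ φ₁) ∧
        ∀ φ φ₁, (compactGraph ℓ₀ ℓ h₀ h).IsGroundState {Vtx.B} φ φ₁ →
          ∀ j : Fin 4, 2 * ‖φ₁ (some j) 0‖ < ∑ i : Fin 4, ‖φ₁ (some i) 0‖) ∧
      -- the first band function `λ₁` is maximal exactly on an algebraic curve
      (∀ k, IsLeast ((compactGraph ℓ₀ ℓ h₀ h).floquetSpectrum voltage k)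
        ((compactGraph ℓ₀ ℓ h₀ h).firstBand voltage k)) ∧
      ∃ μ : Set (Fin 3 → Real.Angle), IsAlgebraicCurve μ ∧
        (∀ k, k ∈ μ ↔ IsMaxOn ((compactGraph ℓ₀ ℓ h₀ h).firstBand voltage) univ k) ∧
        -- the maximal value is an edge of a gap in the spectrum of the Laplacian on the cover
        ∃ M : ℝ, (∀ k ∈ μ, (compactGraph ℓ₀ ℓ h₀ h).firstBand voltage k = M) ∧
          M ∈ ((compactGraph ℓ₀ ℓ h₀ h).cover voltage).laplaceSpectrum ∧
          ∃ δ > 0, Disjoint (Ioo M (M + δ))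
            ((compactGraph ℓ₀ ℓ h₀ h).cover voltage).laplaceSpectrum := by
  refine ⟨existsUnique_sq_sub_cube, fun ρ₀ hρ₀ _ hmax => ?_⟩
  obtain ⟨hmax1, hmax2⟩ := le_min_iff.1 hmax
  have hsup : ∀ j, ℓ j ≤ ⨆ j, ℓ j := le_ciSup (finite_range ℓ).bddAbove
  have hinf : ∀ j, ⨅ j, ℓ j ≤ ℓ j := ciInf_le (finite_range ℓ).bddBelow
  have hle : ∀ j, ℓ j ≤ ℓ₀ := fun j => (hsup j).trans hmax2
  have h3 : ∀ i j, ℓ i < 3 * ℓ j := fun i j => by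
    have h1 : ρ₀ * ⨅ j, ℓ j ≤ ρ₀ * ℓ j := mul_le_mul_of_nonneg_left (hinf j) (by linarith [hρ₀.1])
    have h2 : ρ₀ * ℓ j < 3 * ℓ j := mul_lt_mul_of_pos_right hρ₀.2 (h j)
    linarith [hsup i]
  obtain ⟨s₀, hs0, hs1, hs2⟩ := exists_cotSum_eq_edgeTan h₀ h hle
  have hS := sinL_sq_ne_zero h hle hs0.le hs1
  have hC := (cosL_sq_pos hs0.le h₀ hs1).ne'
  have hq := edgeCsc_sq_pos h hle hs0.le hs1
  have hquad := two_mul_edgeCsc_lt h hle hs0 hs1 h3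
  have hleast := isLeast_dirichlet_eigenvalues h₀ h hle hs0 hs1 hs2
  have hcurve := isAlgebraicCurve_quadrangles hq hquad
  choose lam hlam hlam_le hlam_eq using exists_isLeast_floquetSpectrum h₀ h hle hs0 hs1 hs2
  have hband : ∀ k, (compactGraph ℓ₀ ℓ h₀ h).firstBand voltage k = lam k := fun k =>
    (hlam k).csInf_eq
  have hM : ∀ k, k ∈ quadrangles (fun j => edgeCsc (s₀ ^ 2) (ℓ j)) ↔
      (compactGraph ℓ₀ ℓ h₀ h).firstBand voltage k = s₀ ^ 2 := fun k => by
    rw [← fluxSum_eq_zero_iff, ← hlam_eq, hband]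
  obtain ⟨k₀, hk₀⟩ := hcurve.2.1
  refine ⟨⟨?_, ?_⟩, fun k => hband k ▸ hlam k, _, hcurve, fun k => ?_, s₀ ^ 2,
    fun k hk => (hM k).1 hk, ?_, ?_⟩
  · obtain ⟨u, u₁, hu⟩ := hleast.1
    exact ⟨u, u₁, _, hleast, hu⟩
  · rintro φ φ₁ ⟨Λ, hΛ, ⟨φ₂, hφ, hφΛ⟩, e, x, hx, hne⟩ j
    obtain rfl := hΛ.unique hleast
    obtain ⟨a, ha, -, hz⟩ := dirichlet_reduction h₀ h hS hC hφ hφΛ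
    have ha0 : 0 < ‖a‖ := norm_pos_iff.2 fun ha0 => hne (hz ha0 e x hx)
    have hn : ∀ i, ‖φ₁ (some i) 0‖ = edgeCsc (s₀ ^ 2) (ℓ i) * ‖a‖ := fun i => by
      rw [ha, norm_mul, Complex.norm_real, Real.norm_of_nonneg (hq i).le]
    simp only [hn, ← Finset.sum_mul, ← mul_assoc]
    exact mul_lt_mul_of_pos_right (hquad j) ha0
  · rw [hM, isMaxOn_iff]
    refine ⟨fun hk k' _ => ?_, fun hk => ?_⟩
    · rw [hk, hband]
      exact hlam_le k'
    · refine le_antisymm (hband k ▸ hlam_le k) ?_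
      rw [← (hM k₀).1 hk₀]
      exact hk k₀ (mem_univ _)
  · exact not_inResolventSet h₀ h hle hS hC hs2 (fluxSum_eq_zero_iff.2 hk₀)
  -- the gap extends at least to the lowest Dirichlet-Neumann eigenvalue of the tail
  · have hpi := Real.pi_pos
    have hs1' : s₀ < Real.pi / 2 / ℓ₀ := (lt_div_iff₀ h₀).2 hs1
    refine ⟨(Real.pi / 2 / ℓ₀) ^ 2 - s₀ ^ 2,
      sub_pos.2 (pow_lt_pow_left₀ hs1' hs0.le two_ne_zero), ?_⟩
    rw [add_sub_cancel, disjoint_left]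
    rintro Λ ⟨hΛ1, hΛ2⟩ hΛ
    obtain ⟨r, hr, rfl⟩ : ∃ r : ℝ, 0 ≤ r ∧ r ^ 2 = Λ :=
      ⟨√Λ, Real.sqrt_nonneg _, Real.sq_sqrt ((sq_nonneg s₀).trans hΛ1.le)⟩
    have hr1 : s₀ < r := lt_of_pow_lt_pow_left₀ 2 hr hΛ1
    have hr2 : r * ℓ₀ < Real.pi / 2 :=
      (lt_div_iff₀ h₀).1 (lt_of_pow_lt_pow_left₀ 2 (by positivity) hΛ2)
    exact hΛ (inResolventSet h₀ h hle (sinL_sq_ne_zero h hle hr hr2) (cosL_sq_pos hr h₀ hr2).ne'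
      (cotSum_sq_pos h hle hr hr2) (cotSum_lt_edgeTan h₀ h hle hs0 hs2 hr1 hr2))
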